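/- Let $f_c\in\mathbb N$, $n=2f_c+1$, $\lambda>0$, $\mathbb T=\mathbb R/\mathbb Z$ and $$\phi(x)=\big(1,(\sqrt2\sin(2\pi\ell x))_{\ell=1}^{f_c},(\sqrt2\cos(2\pi\ell x))_{\ell=1}^{f_c}\big)\in\mathbb R^n,\qquad x\in\mathbb T.$$ For a finite signed Borel measure $\mathbf m$ on $\mathbb T$ let $\Phi\mathbf m=\int\phi\,d\mathbf m$ and let $|\mathbf m|_{TV}$ be its total variation norm; for $p\in\mathbb R^n$ let $(\Phi^*p)(x)=\langle\phi(x),p\rangle$. For $y\in\mathbb R^n$ consider the Blasso $$(\mathcal P_\lambda(y))\qquad \min_{\mathbf m}\ \tfrac12\|\Phi\mathbf m-y\|_2^2+\lambda|\mathbf m|_{TV}.$$ It has a solution, and $\hat\mu(y):=\Phi\mathbf m_y$ does not depend on the choice of the solution $\mathbf m_y$. Let $\eta_y=\Phi^*\big((y-\hat\mu(y))/\lambda\big)$ be the dual certificate and $\mathcal E_y=\{x\in\mathbb T:|\eta_y(x)|=1\}$ the extended support. For $X=(x_j)_{j=1}^k\in\mathbb T^k$ and $\beta\in\mathbb R^k$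 let $\mathbf m_{\beta,X}=\sum_j\beta_j\delta_{x_j}$, let $\Phi_X\in\mathbb R^{n\times k}$ have columns $\phi(x_j)$, and let $\Gamma_X=[\Phi_X,\Phi_X^{(1)}]\in\mathbb R^{n\times 2k}$, where $\Phi_X^{(1)}$ has columns $\phi'(x_j)$. *The exceptional set.* For $m\ge1$, $\sigma\in\{-1,1\}^m$, $I\subseteq\{1,\dots,m\}$ and $\boldsymbol\ell\in\mathbb N^m$ let $P_{m,\sigma,I,\boldsymbol\ell}$ be the set of all $y\in\mathbb R^n$ for which there are $E=(x_i)_{i=1}^m\in\mathbb T^m$ and $\beta\in\mathbb R^m$ such that, with $M=\Phi_E$ and $\eta=\frac1\lambda\Phi^*(y-\Phi_E\beta)$: $\eta$ lies in the subdifferential of $|\cdot|_{TV}$ at $\mathbf m_{\beta,E}$ (in $C(\mathbb T)$); $\operatorname{rank}M=m$; $\big(M^\dagger(y-(M^*)^\dagger\lambda\sigma)\big)_i=0$ for all $i\in I$, where $\dagger$ is the Moore–Penrose pseudo-inverse; and $\eta^{(2j)}(x_i)=0$ for all $i$ and all $1\le j\le\boldsymbol\ell_i-1$. Let $\mathcal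 H$ be the union of the boundaries of the sets $P_{m,\sigma,I,\boldsymbol\ell}$ over all $1\le m\le 2f_c$, $\sigma$, $I$, and $\boldsymbol\ell$ with $\sum_i\boldsymbol\ell_i\le n$. With $\delta_1=(1,0,\dots,0)\in\mathbb R^n$, let $\mathcal G^{+}$ be the boundary of $\{y:\exists\,\beta\in\mathbb R_{\ge0}^n,\ E\in\mathbb T^n,\ y-\Phi_E\beta=\lambda\delta_1\}$ and $\mathcal G^{-}$ the boundary of $\{y:\exists\,\beta\in\mathbb R_{\le0}^n,\ E\in\mathbb T^n,\ y-\Phi_E\beta=-\lambda\delta_1\}$. Put $\mathcal K=\mathcal H\cup\mathcal G^+\cup\mathcal G^-$. **Theorem.** Let $y\notin\mathcal K$. 1. If $\mathcal E_y=\emptyset$, then $\hat\mu$ is differentiable at $y$ and $\operatorname{div}(\hat\mu)(y)=0$. 2. If $\mathcal E_y=\mathbb T$, then $\hat\mu$ is differentiable at $y$ and $\operatorname{div}(\hat\mu)(y)=2f_c+1$. 3. If $\mathcal E_y$ is discrete, then $\hat\mu$ is differentiable at $y$, and $\mathcal P_\lambda(y)$ has a unique solution, which has the form $\mathbf m_{\beta,X}$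 with distinct points $X=(x_j)_{j=1}^k$ and all $\beta_j\ne0$ ($k\ge 0$). For every such $(\beta,X)$ the matrix $$M=\Gamma_X^*\Gamma_X+\begin{pmatrix}0&0\\0&\operatorname{diag}(Q_j)_{j=1}^k\end{pmatrix},\qquad Q_j=-\frac{\lambda}{\beta_j}\eta_y''(x_j),$$ is invertible and, with $v_j=(M^{-1})_{k+j,k+j}$, $$\operatorname{div}(\hat\mu)(y)=2k-\nu,\qquad \nu=-\lambda\sum_{j=1}^k\frac1{\beta_j}\eta_y''(x_j)\,v_j\ \ge\ 0.$$ -/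

import Mathlib

namespace BlassoFourier

open MeasureTheory

/-- The torus `𝕋 = ℝ / ℤ`. -/
abbrev Torus : Type := UnitAddCircle

/-- The `2 f + 1` measurement indices: the constant, the `f` sines, the `f` cosines. -/
abbrev Idx (f : ℕ) : Type := Unit ⊕ (Fin f ⊕ Fin f)

/-- The space of observations `ℝ ^ n`, `n = 2 f + 1`, with its Euclidean norm. -/
abbrev Obs (f : ℕ) : Type := EuclideanSpace ℝ (Idx f)

/-- `φ(x) = (1, (√2 sin (2π ℓ x))_{ℓ=1..f}, (√2 cos (2π ℓ x))_{ℓ=1..f})`; here `fourier ℓ x` is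
`exp (2 π i ℓ x)`, and the index `i : Fin f` stands for the frequency `ℓ = i + 1`. -/
noncomputable def phi (f : ℕ) (x : Torus) : Obs f :=
  WithLp.toLp 2 (Sum.elim (fun _ => 1)
    (Sum.elim (fun i : Fin f => √2 * (fourier ((i : ℤ) + 1) x : ℂ).im)
      (fun i : Fin f => √2 * (fourier ((i : ℤ) + 1) x : ℂ).re)))

theorem fourier_im_coe (l : ℤ) (t : ℝ) :
    (fourier l (t : Torus) : ℂ).im = Real.sin (2 * Real.pi * l * t) := by
  rw [fourier_coe_apply]
  have h : (2 * Real.pi * Complex.I * l * t / (1 : ℝ) : ℂ)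
      = ((2 * Real.pi * l * t : ℝ) : ℂ) * Complex.I := by push_cast; ring
  rw [h, Complex.exp_ofReal_mul_I_im]

theorem fourier_re_coe (l : ℤ) (t : ℝ) :
    (fourier l (t : Torus) : ℂ).re = Real.cos (2 * Real.pi * l * t) := by
  rw [fourier_coe_apply]
  have h : (2 * Real.pi * Complex.I * l * t / (1 : ℝ) : ℂ)
      = ((2 * Real.pi * l * t : ℝ) : ℂ) * Complex.I := by push_cast; ring
  rw [h, Complex.exp_ofReal_mul_I_re]

theorem phi_const (f : ℕ) (t : ℝ) : phi f (t : Torus) (Sum.inl ()) = 1 := rfl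

theorem phi_sin (f : ℕ) (t : ℝ) (i : Fin f) :
    phi f (t : Torus) (Sum.inr (Sum.inl i)) = √2 * Real.sin (2 * Real.pi * (i + 1) * t) := by
  have h := fourier_im_coe ((i : ℤ) + 1) t
  push_cast at h
  simp only [phi, Sum.elim_inr, Sum.elim_inl, h]

theorem phi_cos (f : ℕ) (t : ℝ) (i : Fin f) :
    phi f (t : Torus) (Sum.inr (Sum.inr i)) = √2 * Real.cos (2 * Real.pi * (i + 1) * t) := by
  have h := fourier_re_coe ((i : ℤ) + 1) t
  push_cast at h
  simp only [phi, Sum.elim_inr, h]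

theorem continuous_phi (f : ℕ) : Continuous (phi f) := by
  refine (PiLp.continuous_toLp 2 _).comp (continuous_pi fun j => ?_)
  rcases j with j | j | j
  · exact continuous_const
  · exact continuous_const.mul (Complex.continuous_im.comp (fourier _).continuous)
  · exact continuous_const.mul (Complex.continuous_re.comp (fourier _).continuous)

/-- The `j`-th derivative at `x` of a function on the torus, that is, of its periodic lift. -/
noncomputable def torusDeriv {F : Type*} [NormedAddCommGroup F] [NormedSpace ℝ F]
    (j : ℕ) (g : Torus → F) (x : Torus) : F :=
  iteratedDeriv j (fun t : ℝ => g (x + (t : Torus))) 0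

/-! ### The Blasso -/

/-- `∫ g dm` for a signed measure `m`. -/
noncomputable def integralSM {F : Type*} [NormedAddCommGroup F] [NormedSpace ℝ F]
    (m : SignedMeasure Torus) (g : Torus → F) : F :=
  VectorMeasure.integral m g (ContinuousLinearMap.lsmul ℝ ℝ).flip

/-- The total variation norm `|m|(𝕋)`. -/
noncomputable def tvNorm (m : SignedMeasure Torus) : ℝ :=
  m.totalVariation.real Set.univ

/-- `Φ m = ∫ φ dm`. -/
noncomputable def Phi (f : ℕ) (m : SignedMeasure Torus) : Obs f :=
  integralSM m (phi f)

/-- `Φ* p`, the continuous function `x ↦ ⟪φ(x), p⟫`. -/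
noncomputable def PhiAdj (f : ℕ) (p : Obs f) : C(Torus, ℝ) where
  toFun x := inner ℝ (phi f x) p
  continuous_toFun := (continuous_phi f).inner continuous_const

/-- The objective function of the problem `P_λ(y)`. -/
noncomputable def objective (f : ℕ) (lam : ℝ) (y : Obs f) (m : SignedMeasure Torus) : ℝ :=
  1 / 2 * ‖Phi f m - y‖ ^ 2 + lam * tvNorm m

/-- `m` is a solution of `P_λ(y)`. -/
def IsSolution (f : ℕ) (lam : ℝ) (y : Obs f) (m : SignedMeasure Torus) : Prop :=
  ∀ m' : SignedMeasure Torus, objective f lam y m ≤ objective f lam y m'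

/-- The estimator `μ̂(y) = Φ m_y`, for some solution `m_y` of `P_λ(y)`. -/
noncomputable def muHat (f : ℕ) (lam : ℝ) (y : Obs f) : Obs f :=
  Phi f (Classical.epsilon (IsSolution f lam y))

/-- The dual certificate `η_y = Φ* ((y - Φ m_y) / λ)`. -/
noncomputable def eta (f : ℕ) (lam : ℝ) (y : Obs f) : C(Torus, ℝ) :=
  PhiAdj f (lam⁻¹ • (y - muHat f lam y))

/-- The extended support `E_y`. -/
def extSupport (f : ℕ) (lam : ℝ) (y : Obs f) : Set Torus :=
  {x | |eta f lam y x| = 1}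

/-- The divergence at `y` of a vector field. -/
noncomputable def divergence {f : ℕ} (F : Obs f → Obs f) (y : Obs f) : ℝ :=
  ∑ i, (fderiv ℝ F y (EuclideanSpace.single i 1)) i

/-- The discrete measure `m_{β,X} = ∑ j, β_j δ_{x_j}`. -/
noncomputable def discreteMeasure {k : ℕ} (β : Fin k → ℝ) (x : Fin k → Torus) :
    SignedMeasure Torus :=
  ∑ j, VectorMeasure.dirac (x j) (β j)

/-- The subdifferential of the total variation norm at `m`, inside `C(𝕋)`. -/
def tvSubdifferential (m : SignedMeasure Torus) : Set C(Torus, ℝ) :=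
  {g | ∀ m' : SignedMeasure Torus, tvNorm m + integralSM (m' - m) g ≤ tvNorm m'}

/-! ### Matrices -/

/-- The matrix `Φ_X`, with columns `φ(x_j)`. -/
noncomputable def PhiMat (f : ℕ) {k : ℕ} (x : Fin k → Torus) : Matrix (Idx f) (Fin k) ℝ :=
  Matrix.of fun i j => phi f (x j) i

/-- The matrix `Φ_X^{(1)}`, with columns `φ'(x_j)`. -/
noncomputable def PhiMat' (f : ℕ) {k : ℕ} (x : Fin k → Torus) : Matrix (Idx f) (Fin k) ℝ :=
  Matrix.of fun i j => torusDeriv 1 (phi f) (x j) i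

/-- `Γ_X = [Φ_X, Φ_X^{(1)}]`. -/
noncomputable def Gam (f : ℕ) {k : ℕ} (x : Fin k → Torus) :
    Matrix (Idx f) (Fin k ⊕ Fin k) ℝ :=
  Matrix.fromCols (PhiMat f x) (PhiMat' f x)

/-- `Q_j = - (λ / β_j) η_y''(x_j)`. -/
noncomputable def Qcoef (f : ℕ) (lam : ℝ) (y : Obs f) {k : ℕ}
    (β : Fin k → ℝ) (x : Fin k → Torus) (j : Fin k) : ℝ :=
  -(lam / β j) * torusDeriv 2 (eta f lam y) (x j)

/-- `M = Γ_X* Γ_X + [[0, 0], [0, diag Q]]`. -/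
noncomputable def Mmat (f : ℕ) (lam : ℝ) (y : Obs f) {k : ℕ}
    (β : Fin k → ℝ) (x : Fin k → Torus) : Matrix (Fin k ⊕ Fin k) (Fin k ⊕ Fin k) ℝ :=
  (Gam f x).transpose * Gam f x
    + Matrix.fromBlocks 0 0 0 (Matrix.diagonal (Qcoef f lam y β x))

/-- `ν = - λ ∑ j, η_y''(x_j) v_j / β_j`, with `v_j` the `(k + j)`-th diagonal entry of `M⁻¹`. -/
noncomputable def nu (f : ℕ) (lam : ℝ) (y : Obs f) {k : ℕ}
    (β : Fin k → ℝ) (x : Fin k → Torus) : ℝ :=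
  -lam * ∑ j, 1 / β j * torusDeriv 2 (eta f lam y) (x j)
    * (Mmat f lam y β x)⁻¹ (Sum.inr j) (Sum.inr j)

/-- `P` is the Moore–Penrose pseudo-inverse of `A`. -/
def IsPseudoInverse {m n : Type*} [Fintype m] [Fintype n]
    (A : Matrix m n ℝ) (P : Matrix n m ℝ) : Prop :=
  A * P * A = A ∧ P * A * P = P ∧ (A * P).transpose = A * P ∧ (P * A).transpose = P * A

/-! ### The exceptional set -/

/-- `Π_Y Q_{(m,σ,I,ℓ)}`: the observations `y` for which there are `E = (x_1, …, x_m)` and `β` with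
`(y, E, β) ∈ Q_{(m,σ,I,ℓ)}`. -/
def projQ (f : ℕ) (lam : ℝ) (m : ℕ) (σ : Fin m → ℝ) (I : Set (Fin m)) (l : Fin m → ℕ) :
    Set (Obs f) :=
  {y | ∃ (x : Fin m → Torus) (β : Fin m → ℝ) (η : C(Torus, ℝ)),
    η = PhiAdj f (lam⁻¹ • (y - WithLp.toLp 2 ((PhiMat f x).mulVec β))) ∧
    η ∈ tvSubdifferential (discreteMeasure β x) ∧
    (PhiMat f x).rank = m ∧
    (∃ (P : Matrix (Fin m) (Idx f) ℝ) (R : Matrix (Idx f) (Fin m) ℝ),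
      IsPseudoInverse (PhiMat f x) P ∧ IsPseudoInverse (PhiMat f x).transpose R ∧
      ∀ i ∈ I, P.mulVec (y.ofLp - R.mulVec (lam • σ)) i = 0) ∧
    ∀ i : Fin m, ∀ j : ℕ, 1 ≤ j → j + 1 ≤ l i → torusDeriv (2 * j) η (x i) = 0}

/-- The set `H`. -/
def setH (f : ℕ) (lam : ℝ) : Set (Obs f) :=
  {y | ∃ (m : ℕ) (σ : Fin m → ℝ) (I : Set (Fin m)) (l : Fin m → ℕ),
    1 ≤ m ∧ m ≤ 2 * f ∧ (∀ i, σ i = -1 ∨ σ i = 1) ∧ ∑ i, l i ≤ 2 * f + 1 ∧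
    y ∈ frontier (projQ f lam m σ I l)}

/-- The first basis vector `δ_1` of `ℝ ^ n`. -/
noncomputable def delta1 (f : ℕ) : Obs f := EuclideanSpace.single (Sum.inl ()) 1

/-- The set `G⁺`. -/
def setGpos (f : ℕ) (lam : ℝ) : Set (Obs f) :=
  frontier {y | ∃ (β : Fin (2 * f + 1) → ℝ) (x : Fin (2 * f + 1) → Torus),
    (∀ j, 0 ≤ β j) ∧ y - WithLp.toLp 2 ((PhiMat f x).mulVec β) = lam • delta1 f}

/-- The set `G⁻`. -/
def setGneg (f : ℕ) (lam : ℝ) : Set (Obs f) :=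
  frontier {y | ∃ (β : Fin (2 * f + 1) → ℝ) (x : Fin (2 * f + 1) → Torus),
    (∀ j, β j ≤ 0) ∧ y - WithLp.toLp 2 ((PhiMat f x).mulVec β) = -(lam • delta1 f)}

/-- The set `K`. -/
def setK (f : ℕ) (lam : ℝ) : Set (Obs f) :=
  setH f lam ∪ setGpos f lam ∪ setGneg f lam

end BlassoFourier

open BlassoFourier

/-!
The whole problem is read off its dual. The image `Φ m` of a solution is `y - p`, where `p = pHat y`
is the Euclidean projection of `y` onto the dual ball `{p | ∀ x, |⟪φ(x), p⟫| ≤ λ}`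
(`isSolution_iff`, `muHat_eq`). Convexity gives existence, uniqueness of the image and the Lipschitz
bound `‖pHat y - pHat y'‖ ≤ ‖y - y'‖`, and the cone `y - p` is generated by the vectors `±φ(t)` at
the contacts `⟪φ(t), p⟫ = ±λ`, so there are always finitely supported solutions
(`IsProj.exists_atoms`). The certificate `η_y` is `λ⁻¹ ⟪φ(·), p⟫`, a trigonometric polynomial of
degree at most `f`; it has at most `2 f` zeros with multiplicity unless it vanishes, and Hermite
interpolation with `2 f + 1` conditions is possible (`eq_zero_of_zeros`, `exists_hermite`).

If `E_y = ∅`, the point `y` is interior to the dual ball and `μ̂ = 0` nearby. If `E_y = 𝕋`, then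
`p = ±λ δ₁`, and as `y` avoids `G⁺` and `G⁻`, the projection is constant near `y`.

Let `E_y = {x_1, …, x_m}` be finite. Every contact is a zero of the trigonometric polynomial `η_y'`,
a triple one if `η_y''(x_i) = 0`, and `η_y'` does not vanish identically, so `m ≤ 2 f`, the vectors
`φ(x_i)` are independent and the solution is unique (`ContactData.eq_of_isSolution`). Membership
in a stratum `projQ` is a statement about the amplitudes of a solution and the degenerate contacts
(`mem_projQ`, `exists_of_mem_projQ`). As `y` is in no boundary, it is interior to the stratum that
records its vanishing amplitudes and its degenerate contacts, those with `η_y''(x_i) = 0`. Two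
perturbations then show that there are neither.

* Adding a small positive multiple of the signs to the amplitudes changes `y` but not `p`; for a
  generic multiple the result leaves the stratum if some amplitude vanishes
  (`ContactData.amplitude_ne_zero`).
* The contacts and amplitudes depend on `y` with a Lipschitz bound, even at degenerate contacts,
  where `η_y'''` vanishes too (`ContactFamily.isBigO_increments`). The linearized optimality system
  is monotone, so its solution gives the first-order change of `p`
  (`ContactFamily.sub_isLittleO_of_linearized`). By Hermite interpolation some direction makes the
  second derivative at the degenerate contacts grow at unit speed, which leaves the stratum if there
  is a degenerate contact (`ContactData.second_deriv_ne_zero`).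

At a nondegenerate support each atom persists and stays unique nearby by Rolle's theorem
(`ContactData.eventually_exists_atoms`), so the same linearization shows that `μ̂` has the
derivative `Γ M⁻¹ Γ*` (`ContactData.hasFDerivAt_muHat`). Its trace is that of
`M⁻¹ Γ* Γ = 1 - M⁻¹ diag(0, Q)`, which is `2 k - ν`, and `ν ≥ 0` as `Q > 0` and `M` is positive
definite.
-/

namespace BlassoFourier

open MeasureTheory Filter Topology Asymptotics
open scoped InnerProductSpace Pointwise Matrix

section

open Polynomial

/-! ### The curve `φ` and its derivatives -/

/-- The lift `ψ(t) = φ(t mod 1)` of `φ` to the real line. -/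
noncomputable def psi (f : ℕ) (t : ℝ) : Obs f := phi f (t : Torus)

/-- The linear map `A` with `ψ' = A ψ`: it rotates the sine and cosine coordinates of frequency
`ℓ` by a quarter turn, with factor `2 π ℓ`, and kills the constant coordinate. -/
noncomputable def dOp (f : ℕ) : Obs f →L[ℝ] Obs f :=
  LinearMap.toContinuousLinearMap
    { toFun := fun v => WithLp.toLp 2 (Sum.elim (fun _ => 0) (Sum.elim
        (fun i : Fin f => 2 * Real.pi * (i + 1) * v (Sum.inr (Sum.inr i)))
        (fun i : Fin f => -(2 * Real.pi * (i + 1) * v (Sum.inr (Sum.inl i))))))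
      map_add' := by
        intro v w
        ext i
        rcases i with i | i | i <;> simp <;> ring
      map_smul' := by
        intro c v
        ext i
        rcases i with i | i | i <;> simp <;> ring }

theorem dOp_const (f : ℕ) (v : Obs f) (i : Unit) : dOp f v (Sum.inl i) = 0 := rfl

theorem dOp_sin (f : ℕ) (v : Obs f) (i : Fin f) :
    dOp f v (Sum.inr (Sum.inl i)) = 2 * Real.pi * (i + 1) * v (Sum.inr (Sum.inr i)) := rfl

theorem dOp_cos (f : ℕ) (v : Obs f) (i : Fin f) :
    dOp f v (Sum.inr (Sum.inr i)) = -(2 * Real.pi * (i + 1) * v (Sum.inr (Sum.inl i))) := rfl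

theorem inner_obs {f : ℕ} (v p : Obs f) :
    ⟪v, p⟫_ℝ = v (Sum.inl ()) * p (Sum.inl ())
      + (∑ i : Fin f, v (Sum.inr (Sum.inl i)) * p (Sum.inr (Sum.inl i))
        + ∑ i : Fin f, v (Sum.inr (Sum.inr i)) * p (Sum.inr (Sum.inr i))) := by
  rw [PiLp.inner_apply, Fintype.sum_sum_type, Fintype.sum_sum_type]
  simp [mul_comm]

/-- `A` is skew-symmetric. -/
theorem inner_dOp (f : ℕ) (v p : Obs f) : ⟪dOp f v, p⟫_ℝ = ⟪v, -dOp f p⟫_ℝ := by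
  simp only [inner_obs, PiLp.neg_apply, dOp_const, dOp_sin, dOp_cos]
  simp only [zero_mul, mul_neg, neg_zero, mul_zero, neg_neg, zero_add, ← Finset.sum_add_distrib]
  exact Finset.sum_congr rfl fun i _ => by ring

theorem hasDerivAt_psi (f : ℕ) (t : ℝ) : HasDerivAt (psi f) (dOp f (psi f t)) t := by
  rw [hasDerivAt_iff_hasFDerivAt, ← hasFDerivWithinAt_univ, hasFDerivWithinAt_euclidean]
  intro i
  have key : HasDerivAt (fun s => psi f s i) (dOp f (psi f t) i) t := by
    rcases i with i | i | i
    · exact hasDerivAt_const t (1 : ℝ)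
    · have h : (fun s => psi f s (Sum.inr (Sum.inl i)))
          = fun s => √2 * Real.sin (2 * Real.pi * (i + 1) * s) := funext fun s => phi_sin f s i
      rw [h, dOp_sin, psi, phi_cos]
      have h1 : HasDerivAt (fun s : ℝ => 2 * Real.pi * (i + 1) * s) (2 * Real.pi * (i + 1)) t := by
        simpa using (hasDerivAt_id t).const_mul (2 * Real.pi * ((i : ℝ) + 1))
      exact (h1.sin.const_mul √2).congr_deriv (by ring)
    · have h : (fun s => psi f s (Sum.inr (Sum.inr i)))
          = fun s => √2 * Real.cos (2 * Real.pi * (i + 1) * s) := funext fun s => phi_cos f s i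
      rw [h, dOp_cos, psi, phi_sin]
      have h1 : HasDerivAt (fun s : ℝ => 2 * Real.pi * (i + 1) * s) (2 * Real.pi * (i + 1)) t := by
        simpa using (hasDerivAt_id t).const_mul (2 * Real.pi * ((i : ℝ) + 1))
      exact (h1.cos.const_mul √2).congr_deriv (by ring)
  refine (key.hasFDerivAt.congr_fderiv ?_).hasFDerivWithinAt
  ext
  simp

theorem hasDerivAt_pow_dOp_psi (f j : ℕ) (t : ℝ) :
    HasDerivAt (fun s => (dOp f ^ j) (psi f s)) ((dOp f ^ (j + 1)) (psi f t)) t := by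
  rw [pow_succ]
  exact (dOp f ^ j).hasFDerivAt.comp_hasDerivAt t (hasDerivAt_psi f t)

theorem hasDerivAt_inner_pow_dOp_psi (f j : ℕ) (p : Obs f) (t : ℝ) :
    HasDerivAt (fun s => ⟪(dOp f ^ j) (psi f s), p⟫_ℝ) ⟪(dOp f ^ (j + 1)) (psi f t), p⟫_ℝ t := by
  have h := (hasDerivAt_pow_dOp_psi f j t).inner ℝ (hasDerivAt_const t p)
  simpa using h

theorem continuous_psi (f : ℕ) : Continuous (psi f) :=
  (continuous_phi f).comp (AddCircle.continuous_mk' 1)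

theorem torusDeriv_phi (f j : ℕ) (x : Torus) :
    torusDeriv j (phi f) x = (dOp f ^ j) (phi f x) := by
  obtain ⟨t, rfl⟩ := QuotientAddGroup.mk_surjective x
  have h : ∀ j, iteratedDeriv j (fun s : ℝ => phi f ((t : Torus) + (s : Torus)))
      = fun s => (dOp f ^ j) (psi f (t + s)) := by
    intro j
    induction j with
    | zero => ext1 s; simp [psi]
    | succ j ih =>
      rw [iteratedDeriv_succ, ih]
      ext1 s
      exact ((hasDerivAt_pow_dOp_psi f j (t + s)).comp_const_add t s).deriv
  have := congrFun (h j) 0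
  simpa [torusDeriv, psi] using this

theorem torusDeriv_PhiAdj (f j : ℕ) (p : Obs f) (x : Torus) :
    torusDeriv j (PhiAdj f p) x = ⟪(dOp f ^ j) (phi f x), p⟫_ℝ := by
  obtain ⟨t, rfl⟩ := QuotientAddGroup.mk_surjective x
  have h : ∀ j, iteratedDeriv j (fun s : ℝ => PhiAdj f p ((t : Torus) + (s : Torus)))
      = fun s => ⟪(dOp f ^ j) (psi f (t + s)), p⟫_ℝ := by
    intro j
    induction j with
    | zero => ext1 s; simp [psi, PhiAdj]
    | succ j ih =>
      rw [iteratedDeriv_succ, ih]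
      ext1 s
      exact ((hasDerivAt_inner_pow_dOp_psi f j p (t + s)).comp_const_add t s).deriv
  have := congrFun (h j) 0
  simpa [torusDeriv, psi] using this

/-! ### Zeros of trigonometric polynomials -/

/-- The polynomial `P` of degree at most `2 f` with `P(z) = z ^ f ⟪φ(x), p⟫` for
`z = exp (2 π i x)`. -/
noncomputable def trigPoly (f : ℕ) (p : Obs f) : ℂ[X] :=
  C ((p (Sum.inl ()) : ℝ) : ℂ) * X ^ f
    + ∑ i : Fin f,
      (C ((√2 / 2 : ℝ) * ((p (Sum.inr (Sum.inr i)) : ℂ) - Complex.I * p (Sum.inr (Sum.inl i))))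
          * X ^ (f + (i + 1))
        + C ((√2 / 2 : ℝ) * ((p (Sum.inr (Sum.inr i)) : ℂ) + Complex.I * p (Sum.inr (Sum.inl i))))
          * X ^ (f - (i + 1)))

theorem fourier_eq_pow (l : ℕ) (x : Torus) : (fourier (l : ℤ) x : ℂ) = (fourier 1 x : ℂ) ^ l := by
  rw [fourier_apply, fourier_apply, one_zsmul, AddCircle.toCircle_zsmul]
  simp

theorem trigPoly_eval (f : ℕ) (p : Obs f) (x : Torus) :
    (trigPoly f p).eval (fourier 1 x : ℂ) = (fourier 1 x : ℂ) ^ f * (⟪phi f x, p⟫_ℝ : ℝ) := by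
  set z : ℂ := fourier 1 x with hz
  have hz1 : z * (starRingEnd ℂ) z = 1 := by
    rw [Complex.mul_conj, hz, fourier_apply]
    simp
  have hpow : ∀ i : Fin f, z ^ (f - ((i : ℕ) + 1)) = z ^ f * (starRingEnd ℂ) z ^ ((i : ℕ) + 1) := by
    intro i
    have h : z ^ f = z ^ (f - ((i : ℕ) + 1)) * z ^ ((i : ℕ) + 1) := by
      rw [← pow_add]; congr 1; omega
    rw [h, mul_assoc, ← mul_pow, hz1, one_pow, mul_one]
  have hs : ∀ i : Fin f, phi f x (Sum.inr (Sum.inl i)) = √2 * (z ^ ((i : ℕ) + 1)).im := by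
    intro i
    have := fourier_eq_pow ((i : ℕ) + 1) x
    push_cast at this
    simp only [phi, Sum.elim_inr, Sum.elim_inl, this, hz]
  have hc : ∀ i : Fin f, phi f x (Sum.inr (Sum.inr i)) = √2 * (z ^ ((i : ℕ) + 1)).re := by
    intro i
    have := fourier_eq_pow ((i : ℕ) + 1) x
    push_cast at this
    simp only [phi, Sum.elim_inr, this, hz]
  have h0 : phi f x (Sum.inl ()) = 1 := rfl
  rw [inner_obs, h0]
  simp only [hs, hc, trigPoly, eval_add, eval_mul, eval_C, eval_pow, eval_X, eval_finsetSum, hpow,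
    pow_add z f]
  push_cast
  rw [mul_add, ← Finset.sum_add_distrib, Finset.mul_sum]
  congr 1
  · ring
  · refine Finset.sum_congr rfl fun i _ => ?_
    rw [← map_pow (starRingEnd ℂ)]
    generalize z ^ ((i : ℕ) + 1) = w
    have h1 : w = w.re + w.im * Complex.I := (Complex.re_add_im w).symm
    have h2 : (starRingEnd ℂ) w = w.re - w.im * Complex.I := by
      apply Complex.ext <;> simp
    rw [h2]
    nth_rewrite 1 [h1]
    ring_nf
    rw [Complex.I_sq]
    ring

theorem trigPoly_natDegree_le (f : ℕ) (p : Obs f) : (trigPoly f p).natDegree ≤ 2 * f := by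
  refine natDegree_add_le_of_degree_le ((natDegree_C_mul_X_pow_le _ _).trans (by omega)) ?_
  refine natDegree_sum_le_of_forall_le _ _ fun i _ => ?_
  have := i.2
  exact natDegree_add_le_of_degree_le ((natDegree_C_mul_X_pow_le _ _).trans (by omega))
    ((natDegree_C_mul_X_pow_le _ _).trans (by omega))

theorem trigPoly_eq_zero {f : ℕ} {p : Obs f} (h : trigPoly f p = 0) : p = 0 := by
  have hcoef : ∀ k : ℕ, (trigPoly f p).coeff k = 0 := fun k => by rw [h]; simp
  simp only [trigPoly, coeff_add, coeff_C_mul, coeff_X_pow, finsetSum_coeff] at hcoef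
  have h0 := hcoef f
  rw [Finset.sum_eq_zero (fun i _ => by
    have := i.2
    rw [if_neg (by omega), if_neg (by omega)]; simp)] at h0
  have h1 : ∀ i : Fin f, p (Sum.inr (Sum.inr i)) = 0 ∧ p (Sum.inr (Sum.inl i)) = 0 := by
    intro i
    have hi := hcoef (f + (i + 1))
    rw [Finset.sum_eq_single i (fun j _ hj => by
      have hj' : (j : ℕ) ≠ i := fun h => hj (Fin.ext h)
      have := j.2
      rw [if_neg (by omega), if_neg (by omega)]; simp) (by simp), if_neg (by omega), if_pos rfl,
      if_neg (by have := i.2; omega)] at hi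
    have h2 : ((√2 / 2 : ℝ) : ℂ) ≠ 0 := by
      have : (√2 / 2 : ℝ) ≠ 0 := by positivity
      exact_mod_cast this
    have h3 := (mul_eq_zero.1 (by simpa using hi : ((√2 / 2 : ℝ) : ℂ) *
      ((p (Sum.inr (Sum.inr i)) : ℂ) - Complex.I * p (Sum.inr (Sum.inl i))) = 0)).resolve_left h2
    constructor
    · simpa using congrArg Complex.re h3
    · simpa using congrArg Complex.im h3
  ext k
  rcases k with k | k | k
  · simpa using h0
  · exact (h1 k).2
  · exact (h1 k).1

/-- Differentiating the trigonometric polynomial `⟪ψ(t), p⟫` amounts to applying the operator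
`2 π i (X d/dX - f)` to the polynomial `trigPoly f p`. -/
theorem trigPoly_neg_dOp (f : ℕ) (p : Obs f) :
    trigPoly f (-dOp f p)
      = C (2 * Real.pi * Complex.I)
        * (X * derivative (trigPoly f p) - C (f : ℂ) * trigPoly f p) := by
  let D : ℂ[X] →+ ℂ[X] :=
    { toFun := fun P => C (2 * Real.pi * Complex.I) * (X * derivative P - C (f : ℂ) * P)
      map_zero' := by simp
      map_add' := fun P Q => by rw [derivative_add]; ring }
  have hD : ∀ (a : ℂ) (k : ℕ),
      D (C a * X ^ k) = C (2 * Real.pi * Complex.I * (k - f) * a) * X ^ k := by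
    intro a k
    have h : X * derivative (C a * X ^ k) = C (k : ℂ) * (C a * X ^ k) := by
      rw [derivative_C_mul_X_pow]
      rcases k with _ | k
      · simp
      · simp only [C_mul, Nat.add_sub_cancel, pow_succ]
        ring
    change C (2 * Real.pi * Complex.I)
      * (X * derivative (C a * X ^ k) - C (f : ℂ) * (C a * X ^ k)) = _
    rw [h]
    simp only [C_mul, C_sub]
    ring
  change _ = D (trigPoly f p)
  rw [trigPoly, trigPoly, map_add, map_sum, hD]
  have hI := Complex.I_mul_I
  congr 1
  · simp [dOp_const]
  · refine Finset.sum_congr rfl fun i _ => ?_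
    have hk : ((f - ((i : ℕ) + 1) : ℕ) : ℂ) = f - (i + 1) := by
      have := i.2
      rw [Nat.cast_sub (by omega)]; push_cast; ring
    rw [map_add, hD, hD, hk]
    simp only [PiLp.neg_apply, dOp_sin, dOp_cos]
    push_cast
    generalize (p (Sum.inr (Sum.inl i)) : ℂ) = a
    generalize (p (Sum.inr (Sum.inr i)) : ℂ) = b
    congr 3
    · linear_combination ((√2 : ℂ) * Real.pi * (i + 1) * a) * hI
    · linear_combination ((√2 : ℂ) * Real.pi * (i + 1) * a) * hI

theorem inner_pow_dOp_succ (f j : ℕ) (v p : Obs f) :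
    ⟪(dOp f ^ (j + 1)) v, p⟫_ℝ = ⟪(dOp f ^ j) v, -dOp f p⟫_ℝ := by
  rw [pow_succ', mul_apply_eq_comp, inner_dOp]

/-- A zero of order `μ` of `⟪φ, p⟫` is a root of multiplicity `μ` of `trigPoly f p`. -/
theorem pow_dvd_trigPoly (f : ℕ) (x : Torus) (μ : ℕ) (p : Obs f)
    (h : ∀ j < μ, ⟪(dOp f ^ j) (phi f x), p⟫_ℝ = 0) :
    (X - C (fourier 1 x : ℂ)) ^ μ ∣ trigPoly f p := by
  induction μ generalizing p with
  | zero => simp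
  | succ μ ih =>
    set z : ℂ := fourier 1 x with hz
    have hz0 : z ≠ 0 := by rw [hz, fourier_apply]; simp
    by_cases hp : trigPoly f p = 0
    · simp [hp]
    have hroot : (trigPoly f p).IsRoot z := by
      have := h 0 (Nat.succ_pos μ)
      rw [IsRoot, hz, trigPoly_eval]
      simp only [pow_zero, one_apply_eq_self] at this
      simp [this]
    have h1 := ih p fun j hj => h j (by omega)
    have h2 := ih (-dOp f p) fun j hj => by rw [← inner_pow_dOp_succ]; exact h (j + 1) (by omega)
    rw [trigPoly_neg_dOp] at h2
    have hc : IsUnit (C (2 * Real.pi * Complex.I) : ℂ[X]) := by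
      rw [isUnit_C]
      exact isUnit_iff_ne_zero.2 (by simp [Real.pi_ne_zero])
    rw [hc.dvd_mul_left] at h2
    have h3 : (X - C z) ^ μ ∣ X * derivative (trigPoly f p) := by
      have := dvd_add h2 (h1.mul_left (C (f : ℂ)))
      simpa using this
    have hcop : IsCoprime ((X - C z) ^ μ) (X : ℂ[X]) := by
      apply IsCoprime.pow_left
      have := isCoprime_X_sub_C_of_isUnit_sub (R := ℂ) (a := z) (b := 0)
        (by simpa using isUnit_iff_ne_zero.2 hz0)
      simpa using this
    have h4 := hcop.dvd_of_dvd_mul_left h3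
    have hder : derivative (trigPoly f p) ≠ 0 := by
      intro h0
      obtain ⟨a, ha⟩ := (natDegree_eq_zero.1 (derivative_eq_zero.1 h0))
      rw [← ha] at hroot hp
      simp only [IsRoot, eval_C] at hroot
      simp [hroot] at hp
    have h5 := (le_rootMultiplicity_iff hder).2 h4
    rw [derivative_rootMultiplicity_of_root hroot] at h5
    have h6 := (rootMultiplicity_pos hp).2 hroot
    exact (le_rootMultiplicity_iff hp).1 (by omega)

theorem fourier_one_injective : Function.Injective fun x : Torus => (fourier 1 x : ℂ) := by
  intro x y h
  simp only [fourier_apply, one_zsmul] at h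
  exact AddCircle.injective_toCircle one_ne_zero (Subtype.ext h)

theorem infinite_torus : Infinite Torus := by
  have : Infinite (Set.Ico (0 : ℝ) (0 + 1)) := (Set.Ico_infinite (by norm_num)).to_subtype
  exact Infinite.of_injective _ (AddCircle.equivIco 1 0).symm.injective

/-- A trigonometric polynomial of degree `f` with at least `2 f + 1` zeros, counted with
multiplicity, vanishes. -/
theorem eq_zero_of_zeros {f : ℕ} {ι : Type*} [Fintype ι] {x : ι → Torus}
    (hx : Function.Injective x) (μ : ι → ℕ) (hμ : 2 * f + 1 ≤ ∑ i, μ i) {p : Obs f}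
    (h : ∀ i, ∀ j < μ i, ⟪(dOp f ^ j) (phi f (x i)), p⟫_ℝ = 0) : p = 0 := by
  by_contra hp
  have hP : trigPoly f p ≠ 0 := fun h0 => hp (trigPoly_eq_zero h0)
  have hdvd : ∏ i, (X - C (fourier 1 (x i) : ℂ)) ^ μ i ∣ trigPoly f p := by
    refine Finset.prod_dvd_of_coprime (fun i _ j _ hij => ?_) fun i _ =>
      pow_dvd_trigPoly f (x i) (μ i) p (h i)
    exact (pairwise_coprime_X_sub_C (fourier_one_injective.comp hx) hij).pow
  have h1 := natDegree_le_of_dvd hdvd hP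
  rw [natDegree_prod_of_monic _ _ fun i _ => (monic_X_sub_C _).pow _] at h1
  simp only [natDegree_pow, natDegree_X_sub_C, mul_one] at h1
  have := trigPoly_natDegree_le f p
  omega

/-- Hermite interpolation by trigonometric polynomials of degree `f`, with `2 f + 1` conditions. -/
theorem exists_hermite_of_eq {f : ℕ} {ι : Type*} [Fintype ι] {x : ι → Torus}
    (hx : Function.Injective x) (μ : ι → ℕ) (hμ : ∑ i, μ i = 2 * f + 1) (c : ι → ℕ → ℝ) :
    ∃ q : Obs f, ∀ i, ∀ j < μ i, ⟪(dOp f ^ j) (phi f (x i)), q⟫_ℝ = c i j := by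
  let L : Obs f →ₗ[ℝ] ((Σ i, Fin (μ i)) → ℝ) :=
    { toFun := fun q s => ⟪(dOp f ^ (s.2 : ℕ)) (phi f (x s.1)), q⟫_ℝ
      map_add' := fun a b => by ext s; simp [inner_add_right]
      map_smul' := fun a b => by ext s; simp [inner_smul_right] }
  have hinj : Function.Injective L := by
    rw [← LinearMap.ker_eq_bot, LinearMap.ker_eq_bot']
    intro q hq
    exact eq_zero_of_zeros hx μ hμ.ge fun i j hj => congrFun hq ⟨i, ⟨j, hj⟩⟩
  have hdim : Module.finrank ℝ (Obs f) = Module.finrank ℝ ((Σ i, Fin (μ i)) → ℝ) := by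
    simp [hμ]
    ring
  obtain ⟨q, hq⟩ := (LinearMap.injective_iff_surjective_of_finrank_eq_finrank hdim).1 hinj
    fun s => c s.1 s.2
  exact ⟨q, fun i j hj => congrFun hq ⟨i, ⟨j, hj⟩⟩⟩

/-- Hermite interpolation by trigonometric polynomials of degree `f`, with at most `2 f + 1`
conditions: superfluous degrees of freedom are used up at additional simple nodes. -/
theorem exists_hermite {f : ℕ} {ι : Type*} [Fintype ι] {x : ι → Torus}
    (hx : Function.Injective x) (μ : ι → ℕ) (hμ : ∑ i, μ i ≤ 2 * f + 1) (c : ι → ℕ → ℝ) :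
    ∃ q : Obs f, ∀ i, ∀ j < μ i, ⟪(dOp f ^ j) (phi f (x i)), q⟫_ℝ = c i j := by
  have hinf := infinite_torus
  have hfin : (Set.range x).Finite := Set.finite_range x
  have hinf' : Infinite ↥(Set.range x)ᶜ := hfin.infinite_compl.to_subtype
  let e : Fin (2 * f + 1 - ∑ i, μ i) → Torus := fun k =>
    (Infinite.natEmbedding ↥(Set.range x)ᶜ k : _)
  have he : Function.Injective e := fun a b hab =>
    Fin.ext ((Infinite.natEmbedding ↥(Set.range x)ᶜ).injective (Subtype.ext hab))
  have hxe : Function.Injective (Sum.elim x e) := by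
    refine hx.sumElim he fun a b hab => ?_
    exact (Infinite.natEmbedding ↥(Set.range x)ᶜ b).2 ⟨a, hab⟩
  obtain ⟨q, hq⟩ := exists_hermite_of_eq (f := f) hxe (Sum.elim μ fun _ => 1)
    (by simp [Fintype.sum_sum_type, Nat.add_sub_cancel' hμ]) (Sum.elim c fun _ _ => 0)
  exact ⟨q, fun i j hj => hq (Sum.inl i) j hj⟩

end

/-! ### Integrals against signed measures -/

theorem integrable_variation (m : SignedMeasure Torus) {F : Type*} [NormedAddCommGroup F]
    [SecondCountableTopology F] {g : Torus → F} (hg : Continuous g) :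
    VectorMeasure.Integrable m g := by
  have : IsFiniteMeasure m.variation := by
    rw [← SignedMeasure.totalVariation_eq_variation]; infer_instance
  exact (hg.integrable_of_hasCompactSupport (HasCompactSupport.of_compactSpace g))

theorem integralSM_eq_sub (m : SignedMeasure Torus) {F : Type*} [NormedAddCommGroup F]
    [NormedSpace ℝ F] [SecondCountableTopology F] {g : Torus → F} (hg : Continuous g) :
    integralSM m g = ∫ x, g x ∂m.toJordanDecomposition.posPart
      - ∫ x, g x ∂m.toJordanDecomposition.negPart := by
  have h := m.toSignedMeasure_toJordanDecomposition
  rw [JordanDecomposition.toSignedMeasure] at h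
  conv_lhs => rw [integralSM, ← h]
  rw [VectorMeasure.integral_sub_vectorMeasure (integrable_variation _ hg)
    (integrable_variation _ hg), VectorMeasure.integral_toSignedMeasure,
    VectorMeasure.integral_toSignedMeasure]

theorem integrable_of_continuous (μ : Measure Torus) [IsFiniteMeasure μ] {F : Type*}
    [NormedAddCommGroup F] [SecondCountableTopology F] {g : Torus → F} (hg : Continuous g) :
    Integrable g μ :=
  hg.integrable_of_hasCompactSupport (HasCompactSupport.of_compactSpace g)

theorem inner_Phi (f : ℕ) (m : SignedMeasure Torus) (p : Obs f) :
    ⟪p, Phi f m⟫_ℝ = integralSM m (PhiAdj f p) := by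
  rw [Phi, integralSM_eq_sub m (continuous_phi f), integralSM_eq_sub m (PhiAdj f p).continuous,
    inner_sub_right, ← integral_inner (integrable_of_continuous _ (continuous_phi f)),
    ← integral_inner (integrable_of_continuous _ (continuous_phi f))]
  simp only [PhiAdj, ContinuousMap.coe_mk, real_inner_comm]

theorem tvNorm_eq_add (m : SignedMeasure Torus) :
    tvNorm m = m.toJordanDecomposition.posPart.real Set.univ
      + m.toJordanDecomposition.negPart.real Set.univ := by
  rw [tvNorm, SignedMeasure.totalVariation, measureReal_add_apply]

/-- The defect in `∫ g dm ≤ |m|` as the integral of a nonnegative function. -/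
theorem tvNorm_sub_integralSM (m : SignedMeasure Torus) (c : ℝ) (g : C(Torus, ℝ)) :
    c * tvNorm m - integralSM m g = ∫ x, (c - g x) ∂m.toJordanDecomposition.posPart
      + ∫ x, (c + g x) ∂m.toJordanDecomposition.negPart := by
  rw [integralSM_eq_sub m g.continuous, tvNorm_eq_add,
    integral_sub (integrable_const _) (integrable_of_continuous _ g.continuous),
    integral_add (integrable_const _) (integrable_of_continuous _ g.continuous)]
  simp
  ring

theorem integralSM_le_tvNorm (m : SignedMeasure Torus) {c : ℝ} {g : C(Torus, ℝ)}
    (hg : ∀ x, |g x| ≤ c) : integralSM m g ≤ c * tvNorm m := by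
  have h1 : 0 ≤ ∫ x, (c - g x) ∂m.toJordanDecomposition.posPart :=
    integral_nonneg fun x => by have := abs_le.1 (hg x); simp; linarith
  have h2 : 0 ≤ ∫ x, (c + g x) ∂m.toJordanDecomposition.negPart :=
    integral_nonneg fun x => by have := abs_le.1 (hg x); simp; linarith
  have := tvNorm_sub_integralSM m c g
  linarith

/-- If `g` attains `∫ g dm = c |m|`, then the positive part of `m` lives on `{g = c}` and its
negative part on `{g = -c}`. -/
theorem null_of_integralSM_eq (m : SignedMeasure Torus) {c : ℝ} {g : C(Torus, ℝ)}
    (hg : ∀ x, |g x| ≤ c) (h : integralSM m g = c * tvNorm m) :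
    m.toJordanDecomposition.posPart {x | g x ≠ c} = 0
      ∧ m.toJordanDecomposition.negPart {x | g x ≠ -c} = 0 := by
  have n1 : ∀ x, 0 ≤ c - g x := fun x => by have := abs_le.1 (hg x); linarith
  have n2 : ∀ x, 0 ≤ c + g x := fun x => by have := abs_le.1 (hg x); linarith
  have h1 : 0 ≤ ∫ x, (c - g x) ∂m.toJordanDecomposition.posPart := integral_nonneg n1
  have h2 : 0 ≤ ∫ x, (c + g x) ∂m.toJordanDecomposition.negPart := integral_nonneg n2
  have h3 := tvNorm_sub_integralSM m c g
  have e1 : ∫ x, (c - g x) ∂m.toJordanDecomposition.posPart = 0 := by linarith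
  have e2 : ∫ x, (c + g x) ∂m.toJordanDecomposition.negPart = 0 := by linarith
  rw [integral_eq_zero_iff_of_nonneg n1
    (integrable_of_continuous _ (continuous_const.sub g.continuous))] at e1
  rw [integral_eq_zero_iff_of_nonneg n2
    (integrable_of_continuous _ (continuous_const.add g.continuous))] at e2
  constructor
  · rw [measure_eq_zero_iff_ae_notMem]
    filter_upwards [e1] with x hx hx'
    exact hx' (by simp at hx; linarith)
  · rw [measure_eq_zero_iff_ae_notMem]
    filter_upwards [e2] with x hx hx'
    exact hx' (by simp at hx; linarith)

theorem apply_eq_zero_of_integralSM_eq (m : SignedMeasure Torus) {c : ℝ} {g : C(Torus, ℝ)}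
    (hg : ∀ x, |g x| ≤ c) (h : integralSM m g = c * tvNorm m) {s : Set Torus}
    (hs : ∀ x ∈ s, |g x| ≠ c) : m s = 0 := by
  have hc : ∀ x ∈ s, g x ≠ c ∧ g x ≠ -c := fun x hx => by
    have h0 : 0 ≤ c := (abs_nonneg _).trans (hg x)
    constructor
    · intro h1; exact hs x hx (by rw [h1, abs_of_nonneg h0])
    · intro h1; exact hs x hx (by rw [h1, abs_neg, abs_of_nonneg h0])
  obtain ⟨h1, h2⟩ := null_of_integralSM_eq m hg h
  apply SignedMeasure.null_of_totalVariation_zero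
  rw [SignedMeasure.totalVariation, Measure.add_apply,
    measure_mono_null (fun x hx => (hc x hx).1) h1, measure_mono_null (fun x hx => (hc x hx).2) h2,
    add_zero]

theorem singleton_mul_of_integralSM_eq (m : SignedMeasure Torus) {c : ℝ} {g : C(Torus, ℝ)}
    (hg : ∀ x, |g x| ≤ c) (h : integralSM m g = c * tvNorm m) (x : Torus) :
    m {x} * g x = c * |m {x}| := by
  obtain ⟨h1, h2⟩ := null_of_integralSM_eq m hg h
  have h0 : 0 ≤ c := (abs_nonneg _).trans (hg x)
  rw [m.apply_eq_posPart_real_sub_negPart_real (measurableSet_singleton x)]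
  by_cases e1 : g x = c
  · by_cases e2 : g x = -c
    · have : c = 0 := by linarith
      rw [e1, this]; ring
    · have : m.toJordanDecomposition.negPart.real {x} = 0 := by
        rw [measureReal_def, measure_mono_null (fun y hy => by rw [hy]; exact e2) h2]; rfl
      rw [this, e1, sub_zero, abs_of_nonneg measureReal_nonneg, mul_comm]
  · have h3 : m.toJordanDecomposition.posPart.real {x} = 0 := by
      rw [measureReal_def, measure_mono_null (fun y hy => by rw [hy]; exact e1) h1]; rfl
    by_cases e2 : g x = -c
    · rw [h3, e2, zero_sub, abs_neg, abs_of_nonneg measureReal_nonneg]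
      ring
    · have : m.toJordanDecomposition.negPart.real {x} = 0 := by
        rw [measureReal_def, measure_mono_null (fun y hy => by rw [hy]; exact e2) h2]; rfl
      rw [h3, this]; simp

theorem integralSM_discreteMeasure {k : ℕ} (β : Fin k → ℝ) (x : Fin k → Torus) {F : Type*}
    [NormedAddCommGroup F] [NormedSpace ℝ F] [CompleteSpace F] [SecondCountableTopology F]
    {g : Torus → F} (hg : Continuous g) :
    integralSM (discreteMeasure β x) g = ∑ j, β j • g (x j) := by
  rw [integralSM, discreteMeasure, VectorMeasure.integral_finsetSum_vectorMeasure fun i _ =>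
    integrable_variation _ hg]
  refine Finset.sum_congr rfl fun j _ => ?_
  rw [VectorMeasure.integral_dirac]
  simp

theorem Phi_discreteMeasure (f : ℕ) {k : ℕ} (β : Fin k → ℝ) (x : Fin k → Torus) :
    Phi f (discreteMeasure β x) = ∑ j, β j • phi f (x j) :=
  integralSM_discreteMeasure β x (continuous_phi f)

theorem tvNorm_discreteMeasure_le {k : ℕ} (β : Fin k → ℝ) (x : Fin k → Torus) :
    tvNorm (discreteMeasure β x) ≤ ∑ j, |β j| := by
  rw [tvNorm, SignedMeasure.totalVariation_eq_variation, measureReal_def]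
  have h : (discreteMeasure β x).variation Set.univ ≤ ENNReal.ofReal (∑ j, |β j|) := by
    refine (VectorMeasure.variation_finsetSum_le Finset.univ
      (fun j => VectorMeasure.dirac (x j) (β j)) Set.univ).trans ?_
    rw [ENNReal.ofReal_sum_of_nonneg fun i _ => abs_nonneg _]
    simp [Real.enorm_eq_ofReal_abs]
  exact (ENNReal.toReal_mono ENNReal.ofReal_ne_top h).trans
    (ENNReal.toReal_ofReal (Finset.sum_nonneg fun i _ => abs_nonneg _)).le

theorem discreteMeasure_apply {k : ℕ} (β : Fin k → ℝ) (x : Fin k → Torus) {s : Set Torus}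
    (hs : MeasurableSet s) [DecidablePred (· ∈ s)] :
    discreteMeasure β x s = ∑ j, if x j ∈ s then β j else 0 := by
  rw [discreteMeasure, FunLike.coe_sum, Finset.sum_apply]
  refine Finset.sum_congr rfl fun j _ => ?_
  split_ifs with h
  · rw [VectorMeasure.dirac_apply_of_mem hs h]
  · rw [VectorMeasure.dirac_apply_of_notMem h]

theorem discreteMeasure_singleton {k : ℕ} (β : Fin k → ℝ) {x : Fin k → Torus}
    (hx : Function.Injective x) (j : Fin k) : discreteMeasure β x {x j} = β j := by
  classical
  rw [discreteMeasure_apply β x (measurableSet_singleton _), Finset.sum_eq_single j]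
  · simp
  · intro i _ hij
    rw [if_neg]
    exact fun h => hij (hx h)
  · simp

/-! ### Convex hulls of compact sets -/

universe u

/-- Carathéodory's theorem with a prescribed number of points, some of which may have weight
zero. -/
theorem exists_fin_of_mem_convexHull {E : Type u} [AddCommGroup E] [Module ℝ E] {s : Set E} {N : ℕ}
    (hN : ∀ (ι : Type u) [Fintype ι] (z : ι → E), Set.range z ⊆ s → AffineIndependent ℝ z →
      Fintype.card ι ≤ N) {z : E} (hz : z ∈ convexHull ℝ s) :
    ∃ (w : Fin N → ℝ) (v : Fin N → E), (∀ i, 0 ≤ w i) ∧ ∑ i, w i = 1 ∧ (∀ i, v i ∈ s)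
      ∧ ∑ i, w i • v i = z := by
  obtain ⟨ι, hι, v, w, hv, hind, hw, hw1, hsum⟩ := eq_pos_convex_span_of_mem_convexHull hz
  obtain ⟨v0, hv0⟩ : s.Nonempty := by
    rw [← convexHull_nonempty_iff (𝕜 := ℝ)]; exact ⟨z, hz⟩
  have hcard : Fintype.card ι ≤ Fintype.card (Fin N) := by
    rw [Fintype.card_fin]; exact hN ι v hv hind
  obtain ⟨e⟩ := Function.Embedding.nonempty_of_card_le hcard
  refine ⟨Function.extend e w 0, Function.extend e v fun _ => v0, fun i => ?_, ?_, fun i => ?_, ?_⟩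
  · by_cases hi : ∃ a, e a = i
    · obtain ⟨a, rfl⟩ := hi
      rw [e.injective.extend_apply]; exact (hw a).le
    · rw [Function.extend_apply' _ _ _ hi]; rfl
  · rw [← hw1]
    refine (Fintype.sum_of_injective e e.injective _ _ (fun i hi => ?_) fun i => ?_).symm
    · rw [Function.extend_apply' _ _ _ (by simpa using hi)]; rfl
    · rw [e.injective.extend_apply]
  · by_cases hi : ∃ a, e a = i
    · obtain ⟨a, rfl⟩ := hi
      rw [e.injective.extend_apply]; exact hv ⟨a, rfl⟩
    · rw [Function.extend_apply' _ _ _ hi]; exact hv0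
  · rw [← hsum]
    refine (Fintype.sum_of_injective e e.injective _ _ (fun i hi => ?_) fun i => ?_).symm
    · rw [Function.extend_apply' _ _ _ (by simpa using hi)]; simp
    · rw [e.injective.extend_apply, e.injective.extend_apply]

theorem isCompact_convexHull_of_finiteDimensional {E : Type*} [NormedAddCommGroup E]
    [NormedSpace ℝ E] [FiniteDimensional ℝ E] {s : Set E} (hs : IsCompact s) :
    IsCompact (convexHull ℝ s) := by
  set N := Module.finrank ℝ E + 1
  have hK : IsCompact ((stdSimplex ℝ (Fin N)) ×ˢ (Set.univ.pi fun _ : Fin N => s)) :=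
    (isCompact_stdSimplex ℝ (Fin N)).prod (isCompact_univ_pi fun _ => hs)
  have hcont : Continuous fun q : (Fin N → ℝ) × (Fin N → E) => ∑ i, q.1 i • q.2 i := by fun_prop
  convert hK.image hcont
  ext z
  constructor
  · intro hz
    obtain ⟨w, v, hw, hw1, hv, hz⟩ := exists_fin_of_mem_convexHull (N := N) (fun ι _ v _ hind =>
      hind.card_le_finrank_succ.trans (by
        simpa [N] using Submodule.finrank_le (vectorSpan ℝ (Set.range v)))) hz
    exact ⟨(w, v), ⟨⟨hw, hw1⟩, fun i _ => hv i⟩, hz⟩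
  · rintro ⟨⟨w, v⟩, ⟨⟨hw, hw1⟩, hv⟩, rfl⟩
    exact (convex_convexHull ℝ s).sum_mem (fun i _ => hw i) hw1 fun i _ =>
      subset_convexHull ℝ s (hv i trivial)

/-! ### The dual problem: projection onto the dual ball -/

/-- The feasible set `{p | ‖Φ* p‖_∞ ≤ λ}` of the dual problem. -/
def dualBall (f : ℕ) (lam : ℝ) : Set (Obs f) := {p | ∀ x, |⟪phi f x, p⟫_ℝ| ≤ lam}

/-- `p` is the projection of `y` onto the dual ball, expressed by the variational inequality. -/
def IsProj (f : ℕ) (lam : ℝ) (y p : Obs f) : Prop :=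
  p ∈ dualBall f lam ∧ ∀ q ∈ dualBall f lam, ⟪y - p, q - p⟫_ℝ ≤ 0

theorem isClosed_dualBall (f : ℕ) (lam : ℝ) : IsClosed (dualBall f lam) := by
  have : dualBall f lam = ⋂ x, {p | |⟪phi f x, p⟫_ℝ| ≤ lam} := by ext; simp [dualBall]
  rw [this]
  exact isClosed_iInter fun x => isClosed_le (by fun_prop) continuous_const

theorem convex_dualBall (f : ℕ) (lam : ℝ) : Convex ℝ (dualBall f lam) := by
  intro p hp q hq a b ha hb hab x
  rw [inner_add_right, inner_smul_right, inner_smul_right]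
  have h1 := abs_le.1 (hp x)
  have h2 := abs_le.1 (hq x)
  have hb' : b = 1 - a := by linarith
  subst hb'
  rw [abs_le]
  constructor <;> nlinarith

theorem zero_mem_dualBall (f : ℕ) {lam : ℝ} (hlam : 0 < lam) : (0 : Obs f) ∈ dualBall f lam :=
  fun x => by simpa using hlam.le

theorem exists_isProj (f : ℕ) {lam : ℝ} (hlam : 0 < lam) (y : Obs f) : ∃ p, IsProj f lam y p := by
  obtain ⟨p, hp, hmin⟩ := exists_norm_eq_iInf_of_complete_convex ⟨0, zero_mem_dualBall f hlam⟩
    (isClosed_dualBall f lam).isComplete (convex_dualBall f lam) y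
  exact ⟨p, hp, (norm_eq_iInf_iff_real_inner_le_zero (convex_dualBall f lam) hp).1 hmin⟩

theorem IsProj.norm_sub_le {f : ℕ} {lam : ℝ} {y y' p p' : Obs f} (h : IsProj f lam y p)
    (h' : IsProj f lam y' p') : ‖p' - p‖ ≤ ‖y' - y‖ := by
  have h1 := h.2 p' h'.1
  have h2 := h'.2 p h.1
  have h3 : ‖p' - p‖ * ‖p' - p‖ ≤ ⟪y' - y, p' - p⟫_ℝ := by
    rw [← real_inner_self_eq_norm_mul_norm]
    have e1 : ⟪y' - p', p - p'⟫_ℝ = -⟪y' - p', p' - p⟫_ℝ := by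
      rw [← inner_neg_right, neg_sub]
    have e2 : ⟪p' - p, p' - p⟫_ℝ
        = ⟪y' - y, p' - p⟫_ℝ + ⟪y - p, p' - p⟫_ℝ - ⟪y' - p', p' - p⟫_ℝ := by
      rw [← inner_add_left, ← inner_sub_left]; congr 1; abel
    linarith
  have h4 := real_inner_le_norm (y' - y) (p' - p)
  by_contra hlt
  push Not at hlt
  have h5 : 0 < ‖p' - p‖ := (norm_nonneg _).trans_lt hlt
  nlinarith

theorem IsProj.eq {f : ℕ} {lam : ℝ} {y p p' : Obs f} (h : IsProj f lam y p)
    (h' : IsProj f lam y p') : p' = p := by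
  have := h.norm_sub_le h'
  rw [sub_self, norm_zero] at this
  exact sub_eq_zero.1 (norm_le_zero_iff.1 this)

theorem isProj_of_atoms {f : ℕ} {lam : ℝ} {ι : Type*} [Fintype ι] {y p : Obs f} {b : ι → ℝ}
    {t : ι → Torus} (hp : p ∈ dualBall f lam) (hy : y = p + ∑ j, b j • phi f (t j))
    (hb : ∀ j, b j * ⟪phi f (t j), p⟫_ℝ = lam * |b j|) : IsProj f lam y p := by
  refine ⟨hp, fun q hq => ?_⟩
  rw [hy, add_sub_cancel_left, sum_inner]
  refine Finset.sum_nonpos fun j _ => ?_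
  rw [inner_smul_left, inner_sub_right]
  simp only [conj_trivial]
  rw [mul_sub, hb j]
  have h1 : b j * ⟪phi f (t j), q⟫_ℝ ≤ |b j| * lam :=
    (le_abs_self _).trans (by rw [abs_mul]; gcongr; exact hq _)
  linarith

/-- The residual at the projection is a combination of atoms that saturate the constraint: it lies
in a multiple of the convex hull of `± φ(𝕋)`, as otherwise a separating hyperplane would violate
the variational inequality. -/
theorem IsProj.exists_atoms {f : ℕ} {lam : ℝ} (hlam : 0 < lam) {y p : Obs f}
    (h : IsProj f lam y p) : ∃ (N : ℕ) (b : Fin N → ℝ) (t : Fin N → Torus),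
      y = p + ∑ j, b j • phi f (t j) ∧ ∀ j, b j * ⟪phi f (t j), p⟫_ℝ = lam * |b j| := by
  set S : Set (Obs f) := Set.range (phi f) ∪ Set.range fun x => -phi f x with hS
  have hScomp : IsCompact S :=
    (isCompact_range (continuous_phi f)).union (isCompact_range (continuous_phi f).neg)
  set z := y - p with hz
  set t := ⟪z, p⟫_ℝ / lam with ht
  have hzp : 0 ≤ ⟪z, p⟫_ℝ := by
    have := h.2 0 (zero_mem_dualBall f hlam)
    rw [zero_sub, inner_neg_right] at this
    linarith
  have ht0 : 0 ≤ t := div_nonneg hzp hlam.le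
  have hle : ∀ q ∈ dualBall f lam, ⟪z, q⟫_ℝ ≤ ⟪z, p⟫_ℝ := by
    intro q hq
    have := h.2 q hq
    rw [inner_sub_right] at this
    linarith
  have hmem : z ∈ t • convexHull ℝ S := by
    by_contra hnot
    have hconv : Convex ℝ (t • convexHull ℝ S) := (convex_convexHull ℝ S).smul t
    have hclosed : IsClosed (t • convexHull ℝ S) :=
      ((isCompact_convexHull_of_finiteDimensional hScomp).smul t).isClosed
    obtain ⟨g, u, hg1, hg2⟩ := geometric_hahn_banach_closed_point hconv hclosed hnot
    obtain ⟨q, rfl⟩ := (InnerProductSpace.toDual ℝ (Obs f)).surjective g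
    simp only [InnerProductSpace.toDual_apply_apply] at hg1 hg2
    have hphi : ∀ x, t * |⟪phi f x, q⟫_ℝ| < u := by
      intro x
      have h1 := hg1 (t • phi f x) (Set.smul_mem_smul_set (subset_convexHull ℝ S (Or.inl ⟨x, rfl⟩)))
      have h2 := hg1 (t • -phi f x)
        (Set.smul_mem_smul_set (subset_convexHull ℝ S (Or.inr ⟨x, rfl⟩)))
      rw [inner_smul_right] at h1 h2
      rw [inner_neg_right] at h2
      rw [real_inner_comm] at h1 h2
      rcases abs_cases ⟪phi f x, q⟫_ℝ with ⟨e, _⟩ | ⟨e, _⟩ <;> rw [e] <;> linarith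
    obtain ⟨x0, -, hx0⟩ := isCompact_univ.exists_isMaxOn (Set.univ_nonempty (α := Torus))
      (f := fun x => |⟪phi f x, q⟫_ℝ|)
      ((continuous_phi f).inner continuous_const).abs.continuousOn
    have hx0' : ∀ x, |⟪phi f x, q⟫_ℝ| ≤ |⟪phi f x0, q⟫_ℝ| := fun x => hx0 (Set.mem_univ x)
    set s := |⟪phi f x0, q⟫_ℝ| with hs
    have hu : t * s < ⟪z, q⟫_ℝ := by
      rw [real_inner_comm]; exact (hphi x0).trans hg2
    have hs0 : 0 ≤ s := abs_nonneg _
    rcases hs0.eq_or_lt with hs0 | hs0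
    · have hzq : 0 < ⟪z, q⟫_ℝ := by rw [← hs0, mul_zero] at hu; exact hu
      have hmemq : ((⟪z, p⟫_ℝ + 1) / ⟪z, q⟫_ℝ) • q ∈ dualBall f lam := by
        intro x
        have : ⟪phi f x, q⟫_ℝ = 0 := abs_nonpos_iff.1 ((hx0' x).trans hs0.ge)
        rw [inner_smul_right, this]
        simpa using hlam.le
      have := hle _ hmemq
      rw [inner_smul_right, div_mul_cancel₀ _ hzq.ne'] at this
      linarith
    · have hmemq : (lam / s) • q ∈ dualBall f lam := by
        intro x
        rw [inner_smul_right, abs_mul, abs_of_pos (div_pos hlam hs0)]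
        calc lam / s * |⟪phi f x, q⟫_ℝ| ≤ lam / s * s := by gcongr; exact hx0' x
          _ = lam := div_mul_cancel₀ _ hs0.ne'
      have h1 := hle _ hmemq
      rw [inner_smul_right] at h1
      have h2 : lam / s * (t * s) < lam / s * ⟪z, q⟫_ℝ :=
        mul_lt_mul_of_pos_left hu (div_pos hlam hs0)
      have h3 : lam / s * (t * s) = ⟪z, p⟫_ℝ := by
        rw [ht]; field_simp
      linarith
  obtain ⟨k, hk, hkz⟩ := hmem
  obtain ⟨N, w, v, hw, hw1, hv, hsum⟩ : ∃ (N : ℕ) (w : Fin N → ℝ) (v : Fin N → Obs f),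
      (∀ i, 0 ≤ w i) ∧ ∑ i, w i = 1 ∧ (∀ i, v i ∈ S) ∧ ∑ i, w i • v i = k :=
    ⟨_, exists_fin_of_mem_convexHull (N := Module.finrank ℝ (Obs f) + 1) (fun ι _ v _ hind =>
      hind.card_le_finrank_succ.trans (by
        gcongr; exact Submodule.finrank_le (vectorSpan ℝ (Set.range v)))) hk⟩
  have hv' : ∀ i, ∃ (x : Torus) (e : ℝ), |e| = 1 ∧ v i = e • phi f x := by
    intro i
    rcases hv i with ⟨x, hx⟩ | ⟨x, hx⟩
    · exact ⟨x, 1, by simp, by simp [hx]⟩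
    · exact ⟨x, -1, by simp, by simp [← hx]⟩
  choose x e he hve using hv'
  have hzsum : z = ∑ j, (t * w j * e j) • phi f (x j) := by
    change t • k = z at hkz
    rw [← hkz, ← hsum, Finset.smul_sum]
    exact Finset.sum_congr rfl fun i _ => by rw [hve, smul_smul, smul_smul, mul_assoc]
  have habs : ∀ j, |t * w j * e j| = t * w j := fun j => by
    rw [abs_mul, he, mul_one, abs_of_nonneg (mul_nonneg ht0 (hw j))]
  have hle1 : ∀ j, (t * w j * e j) * ⟪phi f (x j), p⟫_ℝ ≤ lam * |t * w j * e j| := fun j =>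
    (le_abs_self _).trans (by rw [abs_mul, mul_comm]; gcongr; exact h.1 _)
  refine ⟨N, fun j => t * w j * e j, x, by rw [← hzsum, hz]; abel, ?_⟩
  have hsumeq : ∑ j, (t * w j * e j) * ⟪phi f (x j), p⟫_ℝ = ∑ j, lam * |t * w j * e j| := by
    have h1 : ∑ j, (t * w j * e j) * ⟪phi f (x j), p⟫_ℝ = ⟪z, p⟫_ℝ := by
      conv_rhs => rw [hzsum, sum_inner]
      simp only [inner_smul_left, conj_trivial]
    simp only [habs]
    rw [h1, ← Finset.mul_sum, ← Finset.mul_sum, hw1, ht]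
    field_simp
  intro j
  exact (Finset.sum_eq_sum_iff_of_le fun j _ => hle1 j).1 hsumeq j (Finset.mem_univ j)

/-! ### Solutions of the Blasso -/

theorem integralSM_PhiAdj_le {f : ℕ} {lam : ℝ} {p : Obs f} (hp : p ∈ dualBall f lam)
    (m : SignedMeasure Torus) : ⟪p, Phi f m⟫_ℝ ≤ lam * tvNorm m := by
  rw [inner_Phi]
  exact integralSM_le_tvNorm m hp

theorem norm_sq_add_inner {f : ℕ} (y p w : Obs f) :
    1 / 2 * ‖w - y‖ ^ 2 + ⟪p, w⟫_ℝ
      = 1 / 2 * ‖w - (y - p)‖ ^ 2 + (⟪p, y⟫_ℝ - 1 / 2 * ‖p‖ ^ 2) := by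
  have e : w - (y - p) = (w - y) + p := by abel
  rw [e, norm_add_sq_real, inner_sub_left, real_inner_comm w p, real_inner_comm y p]
  ring

theorem exists_isSolution_of_isProj {f : ℕ} {lam : ℝ} (hlam : 0 < lam) {y p : Obs f}
    (h : IsProj f lam y p) : ∃ m, Phi f m = y - p ∧ lam * tvNorm m = ⟪p, Phi f m⟫_ℝ := by
  obtain ⟨N, b, t, hy, hb⟩ := h.exists_atoms hlam
  refine ⟨discreteMeasure b t, by rw [Phi_discreteMeasure, hy, add_sub_cancel_left], ?_⟩
  refine le_antisymm ?_ (integralSM_PhiAdj_le h.1 _)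
  have h1 : ⟪p, Phi f (discreteMeasure b t)⟫_ℝ = lam * ∑ j, |b j| := by
    rw [Phi_discreteMeasure, inner_sum, Finset.mul_sum]
    exact Finset.sum_congr rfl fun j _ => by rw [inner_smul_right, real_inner_comm, hb]
  rw [h1]
  exact mul_le_mul_of_nonneg_left (tvNorm_discreteMeasure_le b t) hlam.le

/-- Primal-dual optimality: `m` solves `P_λ(y)` if and only if `Φ m` is the residual of the
projection of `y` onto the dual ball and the dual certificate is extremal at `m`. -/
theorem isSolution_iff {f : ℕ} {lam : ℝ} (hlam : 0 < lam) {y p : Obs f} (h : IsProj f lam y p)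
    (m : SignedMeasure Torus) :
    IsSolution f lam y m ↔ Phi f m = y - p ∧ lam * tvNorm m = ⟪p, Phi f m⟫_ℝ := by
  have hlow : ∀ m', 1 / 2 * ‖Phi f m' - (y - p)‖ ^ 2 + (⟪p, y⟫_ℝ - 1 / 2 * ‖p‖ ^ 2)
      + (lam * tvNorm m' - ⟪p, Phi f m'⟫_ℝ) = objective f lam y m' := by
    intro m'
    have := norm_sq_add_inner y p (Phi f m')
    rw [objective]
    linarith
  constructor
  · intro hm
    obtain ⟨m0, h1, h2⟩ := exists_isSolution_of_isProj hlam h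
    have h3 := hm m0
    rw [← hlow m, ← hlow m0, h1, h2, h1, sub_self, norm_zero] at h3
    have h4 := integralSM_PhiAdj_le h.1 m
    have h5 : 0 ≤ ‖Phi f m - (y - p)‖ ^ 2 := by positivity
    constructor
    · rw [← sub_eq_zero, ← norm_eq_zero, ← sq_eq_zero_iff]
      linarith
    · linarith
  · rintro ⟨h1, h2⟩ m'
    rw [← hlow m, ← hlow m', h2, h1, sub_self, norm_zero]
    have h4 := integralSM_PhiAdj_le h.1 m'
    have h5 : 0 ≤ ‖Phi f m' - (y - p)‖ ^ 2 := by positivity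
    linarith

/-- `λ` times the dual certificate, as a vector: the residual `y - μ̂(y)`. -/
noncomputable def pHat (f : ℕ) (lam : ℝ) (y : Obs f) : Obs f := y - muHat f lam y

theorem exists_isSolution (f : ℕ) {lam : ℝ} (hlam : 0 < lam) (y : Obs f) :
    ∃ m, IsSolution f lam y m := by
  obtain ⟨p, hp⟩ := exists_isProj f hlam y
  obtain ⟨m, hm⟩ := exists_isSolution_of_isProj hlam hp
  exact ⟨m, (isSolution_iff hlam hp m).2 hm⟩

theorem isProj_pHat (f : ℕ) {lam : ℝ} (hlam : 0 < lam) (y : Obs f) :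
    IsProj f lam y (pHat f lam y) := by
  obtain ⟨p, hp⟩ := exists_isProj f hlam y
  have h := (isSolution_iff hlam hp _).1 (Classical.epsilon_spec (exists_isSolution f hlam y))
  have : pHat f lam y = p := by rw [pHat, muHat, h.1, sub_sub_cancel]
  rwa [this]

theorem IsProj.eq_pHat {f : ℕ} {lam : ℝ} (hlam : 0 < lam) {y p : Obs f} (h : IsProj f lam y p) :
    pHat f lam y = p := h.eq (isProj_pHat f hlam y)

theorem muHat_eq (f : ℕ) (lam : ℝ) (y : Obs f) : muHat f lam y = y - pHat f lam y := by
  rw [pHat, sub_sub_cancel]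

theorem Phi_eq_muHat {f : ℕ} {lam : ℝ} (hlam : 0 < lam) {y : Obs f} {m : SignedMeasure Torus}
    (hm : IsSolution f lam y m) : Phi f m = muHat f lam y := by
  rw [((isSolution_iff hlam (isProj_pHat f hlam y) m).1 hm).1, muHat_eq]

theorem eta_apply (f : ℕ) (lam : ℝ) (y : Obs f) (x : Torus) :
    eta f lam y x = lam⁻¹ * ⟪phi f x, pHat f lam y⟫_ℝ := by
  rw [eta, PhiAdj, ContinuousMap.coe_mk, inner_smul_right]
  rfl

theorem mem_extSupport_iff {f : ℕ} {lam : ℝ} (hlam : 0 < lam) {y : Obs f} {x : Torus} :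
    x ∈ extSupport f lam y ↔ |⟪phi f x, pHat f lam y⟫_ℝ| = lam := by
  rw [extSupport, Set.mem_ofPred_eq, eta_apply, abs_mul, abs_inv, abs_of_pos hlam,
    inv_mul_eq_iff_eq_mul₀ hlam.ne', mul_one]

theorem torusDeriv_eta (f : ℕ) (lam : ℝ) (y : Obs f) (j : ℕ) (x : Torus) :
    torusDeriv j (eta f lam y) x = lam⁻¹ * ⟪(dOp f ^ j) (phi f x), pHat f lam y⟫_ℝ := by
  rw [eta, torusDeriv_PhiAdj, inner_smul_right]
  rfl

theorem IsSolution.integral_eq {f : ℕ} {lam : ℝ} (hlam : 0 < lam) {y : Obs f}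
    {m : SignedMeasure Torus} (hm : IsSolution f lam y m) :
    integralSM m (PhiAdj f (pHat f lam y)) = lam * tvNorm m := by
  rw [((isSolution_iff hlam (isProj_pHat f hlam y) m).1 hm).2, inner_Phi]

/-- A solution does not charge the complement of the extended support. -/
theorem IsSolution.apply_eq_zero {f : ℕ} {lam : ℝ} (hlam : 0 < lam) {y : Obs f}
    {m : SignedMeasure Torus} (hm : IsSolution f lam y m) {s : Set Torus}
    (hs : ∀ x ∈ s, x ∉ extSupport f lam y) : m s = 0 :=
  apply_eq_zero_of_integralSM_eq m (g := PhiAdj f (pHat f lam y)) (isProj_pHat f hlam y).1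
    (hm.integral_eq hlam) fun x hx h =>
    hs x hx ((mem_extSupport_iff hlam).2 h)

theorem isSolution_discreteMeasure {f : ℕ} {lam : ℝ} (hlam : 0 < lam) {y : Obs f} {k : ℕ}
    {β : Fin k → ℝ} {x : Fin k → Torus} (hy : y = pHat f lam y + ∑ j, β j • phi f (x j))
    (hβ : ∀ j, β j * ⟪phi f (x j), pHat f lam y⟫_ℝ = lam * |β j|) :
    IsSolution f lam y (discreteMeasure β x) := by
  have h := isProj_pHat f hlam y
  rw [isSolution_iff hlam h]
  have h0 : Phi f (discreteMeasure β x) = y - pHat f lam y := by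
    rw [Phi_discreteMeasure, eq_sub_iff_add_eq, add_comm, ← hy]
  refine ⟨h0, le_antisymm ?_ (integralSM_PhiAdj_le h.1 _)⟩
  have h1 : ⟪pHat f lam y, Phi f (discreteMeasure β x)⟫_ℝ = lam * ∑ j, |β j| := by
    rw [Phi_discreteMeasure, inner_sum, Finset.mul_sum]
    exact Finset.sum_congr rfl fun j _ => by rw [inner_smul_right, real_inner_comm, hβ]
  rw [h1]
  exact mul_le_mul_of_nonneg_left (tvNorm_discreteMeasure_le β x) hlam.le

/-! ### The subdifferential of the total variation norm -/

theorem mem_tvSubdifferential_iff {m : SignedMeasure Torus} {g : C(Torus, ℝ)} :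
    g ∈ tvSubdifferential m ↔ (∀ x, |g x| ≤ 1) ∧ integralSM m g = tvNorm m := by
  have hsub : ∀ m' : SignedMeasure Torus,
      integralSM (m' - m) g = integralSM m' g - integralSM m g := fun m' =>
    VectorMeasure.integral_sub_vectorMeasure (integrable_variation _ g.continuous)
      (integrable_variation _ g.continuous)
  constructor
  · intro h
    have h' : ∀ m' : SignedMeasure Torus,
        tvNorm m + (integralSM m' g - integralSM m g) ≤ tvNorm m' := fun m' => by
      rw [← hsub]; exact h m'
    have htv0 : tvNorm (0 : SignedMeasure Torus) = 0 := by
      simp [tvNorm, SignedMeasure.totalVariation_zero]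
    have hi0 : integralSM (0 : SignedMeasure Torus) g = 0 :=
      VectorMeasure.integral_zero_vectorMeasure
    have hle : tvNorm m ≤ integralSM m g := by
      have := h' 0
      rw [htv0, hi0] at this
      linarith
    have hdirac : ∀ (x : Torus) (c : ℝ), c * g x ≤ |c| + (integralSM m g - tvNorm m) := by
      intro x c
      have h1 := h' (discreteMeasure (fun _ : Fin 1 => c) fun _ => x)
      rw [integralSM_discreteMeasure _ _ g.continuous] at h1
      have h2 := tvNorm_discreteMeasure_le (fun _ : Fin 1 => c) fun _ => x
      simp at h1 h2
      linarith
    have hbound : ∀ x, |g x| ≤ 1 := by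
      intro x
      by_contra hx
      push Not at hx
      set d := integralSM m g - tvNorm m with hd
      have hc : ∀ c : ℝ, 0 ≤ c → c * |g x| ≤ c + d := by
        intro c hc
        have h1 := hdirac x c
        have h2 := hdirac x (-c)
        rw [abs_neg, abs_of_nonneg hc] at h2
        rw [abs_of_nonneg hc] at h1
        rcases abs_cases (g x) with ⟨e, _⟩ | ⟨e, _⟩ <;> rw [e] <;> linarith
      have h3 := hc ((d + 1) / (|g x| - 1)) (div_nonneg (by linarith) (by linarith))
      have h4 : (d + 1) / (|g x| - 1) * (|g x| - 1) = d + 1 :=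
        div_mul_cancel₀ _ (by linarith)
      rw [mul_sub, mul_one] at h4
      linarith
    refine ⟨hbound, le_antisymm ?_ hle⟩
    simpa using integralSM_le_tvNorm m hbound
  · rintro ⟨h1, h2⟩ m'
    rw [hsub, h2]
    have := integralSM_le_tvNorm m' h1
    linarith

theorem PhiAdj_smul (f : ℕ) (c : ℝ) (p : Obs f) (x : Torus) :
    PhiAdj f (c • p) x = c * ⟪phi f x, p⟫_ℝ := by
  rw [PhiAdj, ContinuousMap.coe_mk, inner_smul_right]

theorem smul_PhiAdj_mem_tvSubdifferential {f : ℕ} {lam : ℝ} (hlam : 0 < lam) {p : Obs f} {k : ℕ}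
    {β : Fin k → ℝ} {x : Fin k → Torus} (hp : p ∈ dualBall f lam)
    (hβ : ∀ j, β j * ⟪phi f (x j), p⟫_ℝ = lam * |β j|) :
    PhiAdj f (lam⁻¹ • p) ∈ tvSubdifferential (discreteMeasure β x) := by
  have hb : ∀ x, |PhiAdj f (lam⁻¹ • p) x| ≤ 1 := by
    intro x
    rw [PhiAdj_smul, abs_mul, abs_inv, abs_of_pos hlam, inv_mul_le_iff₀ hlam, mul_one]
    exact hp x
  refine mem_tvSubdifferential_iff.2 ⟨hb, le_antisymm (by simpa using integralSM_le_tvNorm _ hb) ?_⟩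
  refine (tvNorm_discreteMeasure_le β x).trans (le_of_eq ?_)
  rw [integralSM_discreteMeasure _ _ (ContinuousMap.continuous _)]
  refine Finset.sum_congr rfl fun j _ => ?_
  rw [PhiAdj_smul, smul_eq_mul, mul_left_comm, hβ, inv_mul_cancel_left₀ hlam.ne']

theorem dualBall_of_mem_tvSubdifferential {f : ℕ} {lam : ℝ} (hlam : 0 < lam) {p : Obs f} {k : ℕ}
    {β : Fin k → ℝ} {x : Fin k → Torus} (hx : Function.Injective x)
    (h : PhiAdj f (lam⁻¹ • p) ∈ tvSubdifferential (discreteMeasure β x)) :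
    p ∈ dualBall f lam ∧ ∀ j, β j * ⟪phi f (x j), p⟫_ℝ = lam * |β j| := by
  obtain ⟨h1, h2⟩ := mem_tvSubdifferential_iff.1 h
  refine ⟨fun x => ?_, fun j => ?_⟩
  · have := h1 x
    rwa [PhiAdj_smul, abs_mul, abs_inv, abs_of_pos hlam, inv_mul_le_iff₀ hlam, mul_one] at this
  · have h3 := singleton_mul_of_integralSM_eq _ h1 (by rw [h2, one_mul]) (x j)
    rw [discreteMeasure_singleton β hx, PhiAdj_smul, one_mul] at h3
    rw [← h3]
    field_simp

/-! ### Empty and full extended support -/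

theorem exists_norm_phi_le (f : ℕ) : ∃ B : ℝ, 0 < B ∧ ∀ x, ‖phi f x‖ ≤ B := by
  obtain ⟨x0, -, hx0⟩ := isCompact_univ.exists_isMaxOn (Set.univ_nonempty (α := Torus))
    (f := fun x => ‖phi f x‖) (continuous_phi f).norm.continuousOn
  refine ⟨‖phi f x0‖ + 1, by positivity, fun x => ?_⟩
  have : ‖phi f x‖ ≤ ‖phi f x0‖ := hx0 (Set.mem_univ x)
  linarith

theorem eq_zero_of_inner_phi {f : ℕ} {p : Obs f} (h : ∀ x, ⟪phi f x, p⟫_ℝ = 0) : p = 0 := by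
  have := infinite_torus
  refine eq_zero_of_zeros (ι := Fin (2 * f + 1))
    (x := fun k => Infinite.natEmbedding Torus k)
    (fun a b hab => Fin.ext ((Infinite.natEmbedding Torus).injective hab)) (fun _ => 1) (by simp)
    fun i j hj => ?_
  obtain rfl : j = 0 := by omega
  simpa using h _

theorem inner_phi_delta1 (f : ℕ) (x : Torus) : ⟪phi f x, delta1 f⟫_ℝ = 1 := by
  rw [delta1, EuclideanSpace.inner_single_right]
  simp [phi]

theorem toLp_PhiMat_mulVec (f : ℕ) {k : ℕ} (x : Fin k → Torus) (β : Fin k → ℝ) :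
    WithLp.toLp 2 ((PhiMat f x).mulVec β) = ∑ j, β j • phi f (x j) := by
  ext i
  simp [PhiMat, Matrix.mulVec, dotProduct, mul_comm]

/-- If no constraint is active at `y`, then `μ̂` vanishes near `y`. -/
theorem differentiableAt_of_extSupport_eq_empty {f : ℕ} {lam : ℝ} (hlam : 0 < lam) {y : Obs f}
    (h : extSupport f lam y = ∅) :
    DifferentiableAt ℝ (muHat f lam) y ∧ divergence (muHat f lam) y = 0 := by
  have hproj := isProj_pHat f hlam y
  have hne : ∀ x, |⟪phi f x, pHat f lam y⟫_ℝ| < lam := fun x =>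
    lt_of_le_of_ne (hproj.1 x) fun h' => by
      have := (mem_extSupport_iff hlam (y := y)).2 h'
      rw [h] at this; exact this
  have hpy : pHat f lam y = y := by
    obtain ⟨N, b, t, hy, hb⟩ := hproj.exists_atoms hlam
    have hb0 : ∀ j, b j = 0 := by
      intro j
      by_contra hj
      have h1 : |b j| * |⟪phi f (t j), pHat f lam y⟫_ℝ| = lam * |b j| := by
        rw [← abs_mul, hb j, abs_mul, abs_abs, abs_of_pos hlam]
      have h2 := mul_lt_mul_of_pos_left (hne (t j)) (abs_pos.2 hj)
      rw [h1, mul_comm] at h2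
      exact lt_irrefl _ h2
    conv_rhs => rw [hy]
    simp [hb0]
  rw [hpy] at hne
  obtain ⟨x0, -, hx0⟩ := isCompact_univ.exists_isMaxOn (Set.univ_nonempty (α := Torus))
    (f := fun x => |⟪phi f x, y⟫_ℝ|) ((continuous_phi f).inner continuous_const).abs.continuousOn
  obtain ⟨B, hB, hphi⟩ := exists_norm_phi_le f
  set d := (lam - |⟪phi f x0, y⟫_ℝ|) / B with hd
  have hd0 : 0 < d := div_pos (by have := hne x0; linarith) hB
  have hev : muHat f lam =ᶠ[𝓝 y] fun _ => 0 := by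
    filter_upwards [Metric.ball_mem_nhds y hd0] with y' hy'
    have hmem : y' ∈ dualBall f lam := by
      intro x
      have e : ⟪phi f x, y'⟫_ℝ = ⟪phi f x, y⟫_ℝ + ⟪phi f x, y' - y⟫_ℝ := by
        rw [← inner_add_right]; congr 1; abel
      have h1 : |⟪phi f x, y⟫_ℝ| ≤ |⟪phi f x0, y⟫_ℝ| := hx0 (Set.mem_univ x)
      have h2 : |⟪phi f x, y' - y⟫_ℝ| ≤ B * d := by
        refine (abs_real_inner_le_norm _ _).trans ?_
        have := (mem_ball_iff_norm.1 hy').le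
        gcongr
        exact hphi x
      have h3 : B * d = lam - |⟪phi f x0, y⟫_ℝ| := by rw [hd]; field_simp
      rw [e]
      have := abs_add_le ⟪phi f x, y⟫_ℝ ⟪phi f x, y' - y⟫_ℝ
      linarith
    have : IsProj f lam y' y' := ⟨hmem, fun q _ => by simp⟩
    rw [muHat_eq, this.eq_pHat hlam, sub_self]
  have hfd : HasFDerivAt (muHat f lam) (0 : Obs f →L[ℝ] Obs f) y :=
    (hasFDerivAt_const (0 : Obs f) y).congr_of_eventuallyEq hev
  refine ⟨hfd.differentiableAt, ?_⟩
  simp [divergence, hfd.fderiv]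

/-- The observations whose dual certificate is the constant `ε = ± 1`. -/
def constSet (f : ℕ) (lam ε : ℝ) : Set (Obs f) :=
  {y | ∃ (β : Fin (2 * f + 1) → ℝ) (x : Fin (2 * f + 1) → Torus),
    (∀ j, 0 ≤ ε * β j) ∧ y - WithLp.toLp 2 ((PhiMat f x).mulVec β) = (ε * lam) • delta1 f}

/-- Conic Carathéodory theorem for the curve `φ`, which lies in an affine hyperplane that avoids
the origin: `2 f + 1` atoms suffice. -/
theorem exists_conic_atoms {f N : ℕ} (b : Fin N → ℝ) (t : Fin N → Torus) (hb : ∀ j, 0 ≤ b j) :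
    ∃ (β : Fin (2 * f + 1) → ℝ) (x : Fin (2 * f + 1) → Torus), (∀ j, 0 ≤ β j) ∧
      ∑ j, b j • phi f (t j) = ∑ j, β j • phi f (x j) := by
  rcases (Finset.sum_nonneg fun j (_ : j ∈ Finset.univ) => hb j).eq_or_lt with hs | hs
  · have h0 : ∀ j, b j = 0 := fun j =>
      (Finset.sum_eq_zero_iff_of_nonneg fun j _ => hb j).1 hs.symm j (Finset.mem_univ j)
    exact ⟨0, fun _ => 0, fun _ => le_rfl, by simp [h0]⟩
  · set s := ∑ j, b j with hsdef
    have hmem : ∑ j, (b j / s) • phi f (t j) ∈ convexHull ℝ (Set.range (phi f)) :=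
      (convex_convexHull ℝ _).sum_mem (fun j _ => div_nonneg (hb j) hs.le)
        (by rw [← Finset.sum_div, div_self hs.ne'])
        fun j _ => subset_convexHull ℝ _ ⟨t j, rfl⟩
    obtain ⟨w, v, hw, -, hv, hsum⟩ := exists_fin_of_mem_convexHull (N := 2 * f + 1)
      (fun ι _ z hz hind => by
        have hlin : LinearIndependent ℝ z := by
          rw [linearIndependent_iff']
          intro S g hg
          refine (affineIndependent_iff.1 hind) S g ?_ hg
          have := congrArg (fun v : Obs f => v (Sum.inl ())) hg
          have h1 : ∀ i, z i (Sum.inl ()) = 1 := fun i => by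
            obtain ⟨x, hx⟩ := hz ⟨i, rfl⟩
            rw [← hx]; rfl
          simpa [h1] using this
        have := hlin.fintype_card_le_finrank
        simp at this
        omega) hmem
    choose x hx using hv
    refine ⟨fun j => s * w j, x, fun j => mul_nonneg hs.le (hw j), ?_⟩
    have h1 := congrArg (fun v => s • v) hsum
    simp only [Finset.smul_sum, smul_smul, ← hx] at h1
    rw [h1]
    exact Finset.sum_congr rfl fun j _ => by rw [mul_div_cancel₀ _ hs.ne']

theorem mem_constSet {f : ℕ} {lam ε : ℝ} (hlam : 0 < lam) (hε : ε = 1 ∨ ε = -1) {y : Obs f}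
    (h : ∀ x, ⟪phi f x, pHat f lam y⟫_ℝ = ε * lam) : y ∈ constSet f lam ε := by
  have hε2 : ε * ε = 1 := by rcases hε with rfl | rfl <;> norm_num
  have hp : pHat f lam y = (ε * lam) • delta1 f := by
    rw [← sub_eq_zero]
    refine eq_zero_of_inner_phi fun x => ?_
    rw [inner_sub_right, h, inner_smul_right, inner_phi_delta1]; ring
  obtain ⟨N, b, t, hy, hb⟩ := (isProj_pHat f hlam y).exists_atoms hlam
  have hb' : ∀ j, 0 ≤ ε * b j := by
    intro j
    have h1 := hb j
    rw [h] at h1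
    have h2 : 0 ≤ lam * (ε * b j) := by
      have : lam * (ε * b j) = lam * |b j| := by rw [← h1]; ring
      rw [this]; positivity
    exact nonneg_of_mul_nonneg_right h2 hlam
  obtain ⟨β, x, hβ, hsum⟩ := exists_conic_atoms (f := f) (fun j => ε * b j) t hb'
  refine ⟨fun j => ε * β j, x, fun j => by rw [← mul_assoc, hε2, one_mul]; exact hβ j, ?_⟩
  have h2 : ∑ j, (ε * β j) • phi f (x j) = ∑ j, b j • phi f (t j) := by
    have := congrArg (fun v => ε • v) hsum
    simp only [Finset.smul_sum, smul_smul, ← mul_assoc, hε2, one_mul] at this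
    exact this.symm
  rw [toLp_PhiMat_mulVec, h2, ← hp]
  nth_rewrite 1 [hy]
  abel

theorem differentiableAt_of_mem_interior_constSet {f : ℕ} {lam ε : ℝ} (hlam : 0 < lam)
    (hε : ε = 1 ∨ ε = -1) {y : Obs f} (h : y ∈ interior (constSet f lam ε)) :
    DifferentiableAt ℝ (muHat f lam) y ∧ divergence (muHat f lam) y = 2 * (f : ℝ) + 1 := by
  have hev : muHat f lam =ᶠ[𝓝 y] fun y' => y' - (ε * lam) • delta1 f := by
    filter_upwards [mem_interior_iff_mem_nhds.1 h] with y' hy'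
    obtain ⟨β, x, hβ, hy'⟩ := hy'
    have hin : ∀ x, ⟪phi f x, (ε * lam) • delta1 f⟫_ℝ = ε * lam := fun x => by
      rw [inner_smul_right, inner_phi_delta1, mul_one]
    have habs : |ε| = 1 := by rcases hε with rfl | rfl <;> simp
    have hproj : IsProj f lam y' ((ε * lam) • delta1 f) := by
      refine isProj_of_atoms (b := β) (t := x) (fun x => ?_) ?_ fun j => ?_
      · rw [hin, abs_mul, habs, one_mul, abs_of_pos hlam]
      · rw [← hy', toLp_PhiMat_mulVec, sub_add_cancel]
      · rw [hin]
        have : |β j| = ε * β j := by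
          rw [← abs_of_nonneg (hβ j), abs_mul, habs, one_mul]
        rw [this]; ring
    rw [muHat_eq, hproj.eq_pHat hlam]
  have hfd : HasFDerivAt (muHat f lam) (ContinuousLinearMap.id ℝ (Obs f)) y :=
    ((hasFDerivAt_id y).sub_const _).congr_of_eventuallyEq hev
  refine ⟨hfd.differentiableAt, ?_⟩
  simp [divergence, hfd.fderiv]
  ring

theorem mem_interior_of_mem_of_notMem_frontier {X : Type*} [TopologicalSpace X] {s : Set X} {y : X}
    (h : y ∈ s) (h' : y ∉ frontier s) : y ∈ interior s := by
  by_contra hi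
  exact h' ⟨subset_closure h, hi⟩

theorem differentiableAt_of_extSupport_eq_univ {f : ℕ} {lam : ℝ} (hlam : 0 < lam) {y : Obs f}
    (hp : y ∉ setGpos f lam) (hn : y ∉ setGneg f lam) (h : extSupport f lam y = Set.univ) :
    DifferentiableAt ℝ (muHat f lam) y ∧ divergence (muHat f lam) y = 2 * (f : ℝ) + 1 := by
  have habs : ∀ x, |⟪phi f x, pHat f lam y⟫_ℝ| = lam := fun x =>
    (mem_extSupport_iff hlam).1 (by rw [h]; trivial)
  have hcont : Continuous fun x => ⟪phi f x, pHat f lam y⟫_ℝ :=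
    (continuous_phi f).inner continuous_const
  have hconst : ∀ x, ⟪phi f x, pHat f lam y⟫_ℝ = ⟪phi f 0, pHat f lam y⟫_ℝ := by
    intro x
    by_contra hne
    have hzero : (0 : ℝ) ∈ Set.range fun x => ⟪phi f x, pHat f lam y⟫_ℝ := by
      rcases (abs_eq hlam.le).1 (habs x) with h1 | h1 <;>
        rcases (abs_eq hlam.le).1 (habs 0) with h2 | h2
      · exact absurd (h1.trans h2.symm) hne
      · exact mem_range_of_exists_le_of_exists_ge hcont ⟨0, by rw [h2]; linarith⟩
          ⟨x, by rw [h1]; exact hlam.le⟩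
      · exact mem_range_of_exists_le_of_exists_ge hcont ⟨x, by rw [h1]; linarith⟩
          ⟨0, by rw [h2]; exact hlam.le⟩
      · exact absurd (h1.trans h2.symm) hne
    obtain ⟨x1, hx1⟩ := hzero
    have := habs x1
    simp only at hx1
    rw [hx1, abs_zero] at this
    exact hlam.ne this
  have e1 : setGpos f lam = frontier (constSet f lam 1) := by
    simp only [setGpos, constSet, one_mul]
  have e2 : setGneg f lam = frontier (constSet f lam (-1)) := by
    simp only [setGneg, constSet, neg_mul, one_mul, neg_smul, Left.nonneg_neg_iff]
  rw [e1] at hp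
  rw [e2] at hn
  rcases (abs_eq hlam.le).1 (habs 0) with h0 | h0
  · have := mem_constSet (ε := 1) hlam (Or.inl rfl) fun x => by rw [hconst, h0, one_mul]
    exact differentiableAt_of_mem_interior_constSet hlam (Or.inl rfl)
      (mem_interior_of_mem_of_notMem_frontier this hp)
  · have := mem_constSet (ε := -1) hlam (Or.inr rfl) fun x => by rw [hconst, h0, neg_one_mul]
    exact differentiableAt_of_mem_interior_constSet hlam (Or.inr rfl)
      (mem_interior_of_mem_of_notMem_frontier this hn)

/-! ### Derivatives at a global maximum -/

/-- A function with a positive derivative at a zero is positive on a right neighbourhood. -/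
theorem eventually_pos_right {g : ℝ → ℝ} {d X : ℝ} (hg : HasDerivAt g d X) (h0 : g X = 0)
    (hd : 0 < d) : ∃ e > 0, ∀ t ∈ Set.Ioo X (X + e), 0 < g t := by
  have h := hasDerivAt_iff_tendsto_slope.1 hg
  have h1 : ∀ᶠ t in 𝓝[>] X, 0 < slope g X t :=
    (h.mono_left (nhdsWithin_mono X fun t (ht : X < t) => ht.ne')).eventually_const_lt hd
  obtain ⟨u, hu, hu'⟩ := (mem_nhdsGT_iff_exists_Ioo_subset).1 h1
  refine ⟨u - X, by simpa using hu, fun t ht => ?_⟩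
  have h2 : 0 < slope g X t := hu' ⟨ht.1, by linarith [ht.2]⟩
  rw [slope_def_field, h0, sub_zero] at h2
  have h3 : 0 < t - X := by linarith [ht.1]
  by_contra hneg
  exact absurd h2 (not_lt.2 (div_nonpos_of_nonpos_of_nonneg (not_lt.1 hneg) h3.le))

/-- A function with a positive derivative on a right neighbourhood of a zero is positive there. -/
theorem pos_right_of_deriv_pos {g g' : ℝ → ℝ} {X e : ℝ} (hg : ∀ t, HasDerivAt g (g' t) t)
    (h0 : g X = 0) (h : ∀ t ∈ Set.Ioo X (X + e), 0 < g' t) : ∀ t ∈ Set.Ioo X (X + e), 0 < g t := by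
  intro t ht
  obtain ⟨c, hc, hc'⟩ := exists_hasDerivAt_eq_slope g g' ht.1
    (fun s _ => (hg s).continuousAt.continuousWithinAt) fun s _ => hg s
  have h1 := h c ⟨hc.1, hc.2.trans ht.2⟩
  have h3 : 0 < t - X := by linarith [ht.1]
  rw [hc', h0, sub_zero] at h1
  by_contra hneg
  exact absurd h1 (not_lt.2 (div_nonpos_of_nonpos_of_nonneg (not_lt.1 hneg) h3.le))

/-- At a global maximum the first nonzero derivative among the second and third ones is the second
one, and it is negative. -/
theorem deriv_at_max {g g1 g2 g3 : ℝ → ℝ} {X : ℝ} (h1 : ∀ t, HasDerivAt g (g1 t) t)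
    (h2 : ∀ t, HasDerivAt g1 (g2 t) t) (h3 : ∀ t, HasDerivAt g2 (g3 t) t)
    (hmax : ∀ t, g t ≤ g X) : g1 X = 0 ∧ g2 X ≤ 0 ∧ (g2 X = 0 → g3 X = 0) := by
  have hg1 : g1 X = 0 :=
    IsLocalMax.hasDerivAt_eq_zero (Eventually.of_forall hmax) (h1 X)
  have key : ∀ {k k1 : ℝ → ℝ} {Y e : ℝ}, (∀ t, HasDerivAt k (k1 t) t) → (∀ t, k t ≤ k Y) → 0 < e →
      (∀ t ∈ Set.Ioo Y (Y + e), 0 < k1 t) → False := by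
    intro k k1 Y e hk hm he hpos
    have h5 : 0 < k (Y + e / 2) - k Y := pos_right_of_deriv_pos (g := fun t => k t - k Y)
      (fun t => (hk t).sub_const _) (sub_self _) hpos (Y + e / 2) ⟨by linarith, by linarith⟩
    have := hm (Y + e / 2)
    linarith
  have third : ∀ {k k1 k2 k3 : ℝ → ℝ} {Y : ℝ}, (∀ t, HasDerivAt k (k1 t) t) →
      (∀ t, HasDerivAt k1 (k2 t) t) → (∀ t, HasDerivAt k2 (k3 t) t) → (∀ t, k t ≤ k Y) →
      k1 Y = 0 → k2 Y = 0 → ¬ 0 < k3 Y := by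
    intro k k1 k2 k3 Y hk hk1 hk2 hm e1 e2 hpos
    obtain ⟨e, he, he'⟩ := eventually_pos_right (hk2 Y) e2 hpos
    exact key hk hm he (pos_right_of_deriv_pos hk1 e1 he')
  refine ⟨hg1, ?_, fun hg2 => ?_⟩
  · by_contra hpos
    push Not at hpos
    obtain ⟨e, he, he'⟩ := eventually_pos_right (h2 X) hg1 hpos
    exact key h1 hmax he he'
  · -- the reflected function `t ↦ g (-t)` excludes a negative third derivative
    have hneg : ∀ {k k1 : ℝ → ℝ}, (∀ t, HasDerivAt k (k1 t) t) →
        ∀ t, HasDerivAt (fun s => k (-s)) (-k1 (-t)) t := by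
      intro k k1 hk t
      simpa [Function.comp_def] using (hk (-t)).comp t (hasDerivAt_neg t)
    have A := third h1 h2 h3 hmax hg1 hg2
    have r1 := hneg h1
    have r2 : ∀ t, HasDerivAt (fun s => -g1 (-s)) (g2 (-t)) t := fun t => by
      simpa using (hneg h2 t).fun_neg
    have r3 := hneg h3
    have B := third (Y := -X) r1 r2 r3 (fun t => by simpa using hmax (-t)) (by simpa using hg1)
      (by simpa using hg2)
    simp only [neg_neg, Left.neg_pos_iff] at B
    exact le_antisymm (not_lt.1 A) (not_lt.1 B)

/-- Derivatives of the dual certificate at a contact point. -/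
theorem contact_deriv {f : ℕ} {lam : ℝ} {p : Obs f} (hp : p ∈ dualBall f lam) {σ : ℝ}
    (hσ : σ = 1 ∨ σ = -1) {x : Torus} (hx : ⟪phi f x, p⟫_ℝ = lam * σ) :
    ⟪dOp f (phi f x), p⟫_ℝ = 0 ∧ σ * ⟪(dOp f ^ 2) (phi f x), p⟫_ℝ ≤ 0 ∧
      (⟪(dOp f ^ 2) (phi f x), p⟫_ℝ = 0 → ⟪(dOp f ^ 3) (phi f x), p⟫_ℝ = 0) := by
  obtain ⟨X, rfl⟩ := QuotientAddGroup.mk_surjective x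
  have hσ2 : σ * σ = 1 := by rcases hσ with rfl | rfl <;> norm_num
  have hσ0 : σ ≠ 0 := by rintro rfl; simp at hσ2
  have hd : ∀ j t, HasDerivAt (fun s => σ * ⟪(dOp f ^ j) (psi f s), p⟫_ℝ)
      (σ * ⟪(dOp f ^ (j + 1)) (psi f t), p⟫_ℝ) t := fun j t =>
    (hasDerivAt_inner_pow_dOp_psi f j p t).const_mul σ
  have hmax : ∀ t, σ * ⟪(dOp f ^ 0) (psi f t), p⟫_ℝ ≤ σ * ⟪(dOp f ^ 0) (psi f X), p⟫_ℝ := by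
    intro t
    simp only [pow_zero, one_apply_eq_self]
    have h1 : ⟪psi f X, p⟫_ℝ = lam * σ := hx
    have h2 := abs_le.1 (hp (t : Torus))
    have h3 : ⟪psi f t, p⟫_ℝ = ⟪phi f t, p⟫_ℝ := rfl
    rw [h1, h3]
    rcases hσ with rfl | rfl <;> linarith
  obtain ⟨a1, a2, a3⟩ := deriv_at_max (hd 0) (hd 1) (hd 2) hmax
  refine ⟨?_, a2, fun h => ?_⟩
  · have := (mul_eq_zero.1 a1).resolve_left hσ0
    simpa [psi] using this
  · have h' : σ * ⟪(dOp f ^ (1 + 1)) (psi f X), p⟫_ℝ = 0 := by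
      have : ⟪(dOp f ^ (1 + 1)) (psi f X), p⟫_ℝ = 0 := h
      rw [this, mul_zero]
    exact (mul_eq_zero.1 (a3 h')).resolve_left hσ0

theorem finite_extSupport {f : ℕ} {lam : ℝ} {y : Obs f} (h : IsDiscrete (extSupport f lam y)) :
    (extSupport f lam y).Finite := by
  have hc : IsClosed (extSupport f lam y) :=
    isClosed_eq (eta f lam y).continuous.abs continuous_const
  exact hc.isCompact.finite h

/-- The order of contact counted in the constraints on the extended support: a degenerate contact
counts for three, as then the first three derivatives of the certificate vanish. -/
theorem sum_contact_le {f : ℕ} {lam : ℝ} (hlam : 0 < lam) {y : Obs f}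
    (hfin : (extSupport f lam y).Finite) {m : ℕ} {x : Fin m → Torus} (hx : Function.Injective x)
    (hrange : Set.range x = extSupport f lam y)
    (μ : Fin m → ℕ) (hμ : ∀ i, μ i = 1 ∨
      (μ i = 3 ∧ ⟪(dOp f ^ 2) (phi f (x i)), pHat f lam y⟫_ℝ = 0)) :
    ∑ i, μ i ≤ 2 * f := by
  by_contra hlt
  push Not at hlt
  have hp := (isProj_pHat f hlam y).1
  have hcontact : ∀ i, ∃ σ : ℝ, (σ = 1 ∨ σ = -1) ∧
      ⟪phi f (x i), pHat f lam y⟫_ℝ = lam * σ := by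
    intro i
    have : x i ∈ extSupport f lam y := by rw [← hrange]; exact ⟨i, rfl⟩
    rcases (abs_eq hlam.le).1 ((mem_extSupport_iff hlam).1 this) with h | h
    · exact ⟨1, Or.inl rfl, by rw [h, mul_one]⟩
    · exact ⟨-1, Or.inr rfl, by rw [h]; ring⟩
  have hzero : -dOp f (pHat f lam y) = 0 := by
    refine eq_zero_of_zeros hx μ hlt fun i j hj => ?_
    rw [← inner_pow_dOp_succ]
    obtain ⟨σ, hσ, hσ'⟩ := hcontact i
    obtain ⟨a1, -, a3⟩ := contact_deriv hp hσ hσ'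
    rcases hμ i with h | ⟨h, h2⟩
    · obtain rfl : j = 0 := by omega
      simpa using a1
    · rw [h] at hj
      interval_cases j
      · simpa using a1
      · exact h2
      · exact a3 h2
  have hconst : ∀ t : ℝ, ⟪psi f t, pHat f lam y⟫_ℝ = ⟪psi f 0, pHat f lam y⟫_ℝ := by
    intro t
    refine is_const_of_deriv_eq_zero (f := fun s => ⟪psi f s, pHat f lam y⟫_ℝ) (fun s => ?_)
      (fun s => ?_) t 0
    · simpa using (hasDerivAt_inner_pow_dOp_psi f 0 (pHat f lam y) s).differentiableAt
    · have := (hasDerivAt_inner_pow_dOp_psi f 0 (pHat f lam y) s).deriv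
      rw [inner_pow_dOp_succ, hzero, inner_zero_right] at this
      simpa using this
  have hm : 0 < m := by
    rcases Nat.eq_zero_or_pos m with rfl | h
    · simp at hlt
    · exact h
  have huniv : extSupport f lam y = Set.univ := by
    have h0 : x ⟨0, hm⟩ ∈ extSupport f lam y := by rw [← hrange]; exact ⟨_, rfl⟩
    rw [mem_extSupport_iff hlam] at h0
    obtain ⟨s, hs⟩ := QuotientAddGroup.mk_surjective (x ⟨0, hm⟩)
    rw [← hs] at h0
    refine Set.eq_univ_of_forall fun z => ?_
    obtain ⟨t, rfl⟩ := QuotientAddGroup.mk_surjective z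
    rw [mem_extSupport_iff hlam]
    have h3 : ⟪psi f t, pHat f lam y⟫_ℝ = ⟪psi f s, pHat f lam y⟫_ℝ :=
      (hconst t).trans (hconst s).symm
    have h4 : |⟪psi f s, pHat f lam y⟫_ℝ| = lam := h0
    rw [← h3] at h4
    exact h4
  rw [huniv] at hfin
  have := infinite_torus
  exact Set.infinite_univ hfin

/-! ### First-order expansion of the contact points and amplitudes -/

/-- A perturbation of the observation, the projection, the contact points and the amplitudes along
a filter `l`. The base point has projection `p`, contact points `X i` and amplitudes `β i`; the
observation moves by `V`, the projection by `D`, and the moved contact points and amplitudes are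
`s i` and `b i`. -/
structure ContactFamily {f : ℕ} {ι α : Type*} [Fintype ι] (l : Filter α) (p : Obs f) (X β : ι → ℝ)
    (V D : α → Obs f) (s b : ι → α → ℝ) : Prop where
  base_deriv : ∀ i, ⟪dOp f (psi f (X i)), p⟫_ℝ = 0
  ne_zero : ∀ i, β i ≠ 0
  tendsto_V : Tendsto V l (𝓝 0)
  isBigO_D : D =O[l] V
  tendsto_s : ∀ i, Tendsto (s i) l (𝓝 (X i))
  decomp : ∀ᶠ a in l, V a = D a + (∑ i, b i a • psi f (s i a) - ∑ i, β i • psi f (X i))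
  value : ∀ i, ∀ᶠ a in l, ⟪psi f (s i a), p + D a⟫_ℝ = ⟪psi f (X i), p⟫_ℝ
  deriv : ∀ i, ∀ᶠ a in l, ⟪dOp f (psi f (s i a)), p + D a⟫_ℝ = 0

/-- Vectors dual to the values at all nodes and the derivatives at the degenerate nodes. -/
structure DualVectors {f : ℕ} {ι : Type*} [DecidableEq ι] (p : Obs f) (X : ι → ℝ)
    (ξ ζ : ι → Obs f) : Prop where
  value_ξ : ∀ i k, ⟪psi f (X k), ξ i⟫_ℝ = if k = i then 1 else 0
  deriv_ξ : ∀ i k, ⟪(dOp f ^ 2) (psi f (X k)), p⟫_ℝ = 0 → ⟪dOp f (psi f (X k)), ξ i⟫_ℝ = 0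
  value_ζ : ∀ i k, ⟪psi f (X k), ζ i⟫_ℝ = 0
  deriv_ζ : ∀ i k, ⟪(dOp f ^ 2) (psi f (X k)), p⟫_ℝ = 0 →
    ⟪dOp f (psi f (X k)), ζ i⟫_ℝ = if k = i then 1 else 0

namespace ContactFamily

variable {f : ℕ} {ι α : Type*} [Fintype ι] {l : Filter α} {p : Obs f} {X β : ι → ℝ}
  {V D : α → Obs f} {s b : ι → α → ℝ}

theorem taylor (h : ContactFamily l p X β V D s b) (j : ℕ) (i : ι) :
    (fun a => (dOp f ^ j) (psi f (s i a)) - (dOp f ^ j) (psi f (X i))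
      - (s i a - X i) • (dOp f ^ (j + 1)) (psi f (X i))) =o[l] fun a => s i a - X i :=
  ((hasDerivAt_pow_dOp_psi f j (X i)).isLittleO).comp_tendsto (h.tendsto_s i)

theorem tendsto_sub (h : ContactFamily l p X β V D s b) (j : ℕ) (i : ι) :
    (fun a => (dOp f ^ j) (psi f (s i a)) - (dOp f ^ j) (psi f (X i))) =o[l] fun _ => (1 : ℝ) := by
  rw [isLittleO_one_iff]
  have := (hasDerivAt_pow_dOp_psi f j (X i)).continuousAt.tendsto.comp (h.tendsto_s i)
  simpa using this.sub_const ((dOp f ^ j) (psi f (X i)))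

theorem inner_sub_isLittleO (h : ContactFamily l p X β V D s b) (j : ℕ) (i : ι) :
    (fun a => ⟪(dOp f ^ j) (psi f (s i a)) - (dOp f ^ j) (psi f (X i)), D a⟫_ℝ) =o[l] V := by
  have h1 : (fun a => ⟪(dOp f ^ j) (psi f (s i a)) - (dOp f ^ j) (psi f (X i)), D a⟫_ℝ) =O[l]
      fun a => ‖(dOp f ^ j) (psi f (s i a)) - (dOp f ^ j) (psi f (X i))‖ * ‖D a‖ :=
    IsBigO.of_bound 1 (Eventually.of_forall fun a => by
      simpa using abs_real_inner_le_norm _ _)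
  refine h1.trans_isLittleO ?_
  have h2 := (h.tendsto_sub j i).norm_left.mul_isBigO h.isBigO_D.norm_norm
  simpa using h2

theorem inner_const_isLittleO {E : Type*} [NormedAddCommGroup E] {u : α → Obs f} {g : α → E}
    (hu : u =o[l] g) (q : Obs f) : (fun a => ⟪u a, q⟫_ℝ) =o[l] g := by
  refine IsBigO.trans_isLittleO (IsBigO.of_bound ‖q‖ (Eventually.of_forall fun a => ?_)) hu
  rw [mul_comm]
  exact norm_inner_le_norm _ _

/-- The expansion of the derivatives of the certificate at a moving contact point. -/
theorem inner_expand (h : ContactFamily l p X β V D s b) (j : ℕ) (i : ι) :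
    ∃ e1 e2 : α → ℝ, e1 =o[l] V ∧ (e2 =o[l] fun a => s i a - X i) ∧
      ∀ a, ⟪(dOp f ^ j) (psi f (s i a)), p + D a⟫_ℝ
        = ⟪(dOp f ^ j) (psi f (X i)), p⟫_ℝ + ⟪(dOp f ^ j) (psi f (X i)), D a⟫_ℝ
          + (s i a - X i) * ⟪(dOp f ^ (j + 1)) (psi f (X i)), p⟫_ℝ + e1 a + e2 a := by
  refine ⟨_, _, h.inner_sub_isLittleO j i, inner_const_isLittleO (h.taylor j i) p, fun a => ?_⟩
  simp only [inner_add_right, inner_sub_left, inner_smul_left, conj_trivial]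
  ring

/-- The amplitudes and the contact points move at most linearly. A nondegenerate contact is
controlled by the stationarity of the certificate; pairing the decomposition of the observation with
the dual vectors then controls the amplitudes and the degenerate contacts. -/
theorem isBigO_increments [DecidableEq ι] (h : ContactFamily l p X β V D s b) {ξ ζ : ι → Obs f}
    (hd : DualVectors p X ξ ζ) :
    (fun a => ((fun i => b i a - β i, fun i => s i a - X i) : (ι → ℝ) × (ι → ℝ))) =O[l] V := by
  classical
  set W : α → (ι → ℝ) × (ι → ℝ) := fun a => (fun i => b i a - β i, fun i => s i a - X i) with hW
  set deg : ι → Prop := fun i => ⟪(dOp f ^ 2) (psi f (X i)), p⟫_ℝ = 0 with hdeg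
  have hu : ∀ i, (fun a => b i a - β i) =O[l] W := fun i =>
    isBigO_pi.1 (isBigO_fst_prod (f' := fun a i => b i a - β i) (g' := fun a i => s i a - X i)) i
  have hδ : ∀ i, (fun a => s i a - X i) =O[l] W := fun i =>
    isBigO_pi.1 (isBigO_snd_prod (f' := fun a i => b i a - β i) (g' := fun a i => s i a - X i)) i
  -- at a nondegenerate contact the contact point moves at most as fast as the observation
  have hnon : ∀ i, ¬ deg i → (fun a => s i a - X i) =O[l] V := by
    intro i hi
    obtain ⟨e1, e2, he1, he2, he⟩ := h.inner_expand 1 i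
    set c := ⟪(dOp f ^ 2) (psi f (X i)), p⟫_ℝ with hc
    have hc0 : c ≠ 0 := hi
    have h1 : (fun a => (s i a - X i)) =O[l] fun a => (s i a - X i) - (-(c⁻¹ * e2 a)) :=
      ((he2.const_mul_left c⁻¹).neg_left).right_isBigO_sub
    refine h1.trans ?_
    have h2 : (fun a => -c⁻¹ * (⟪dOp f (psi f (X i)), D a⟫_ℝ + e1 a)) =O[l] V := by
      refine IsBigO.const_mul_left (IsBigO.add ?_ he1.isBigO) _
      refine IsBigO.trans (IsBigO.of_bound ‖dOp f (psi f (X i))‖ (Eventually.of_forall fun a => ?_))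
        h.isBigO_D
      exact norm_inner_le_norm _ _
    refine h2.congr' ?_ EventuallyEq.rfl
    filter_upwards [h.deriv i] with a ha
    have h3 := he a
    simp only [pow_one] at h3
    rw [ha, h.base_deriv i] at h3
    have h4 : c⁻¹ * c = 1 := inv_mul_cancel₀ hc0
    linear_combination c⁻¹ * h3 + (s i a - X i) * h4
  -- `T` collects the increments still to be bounded; it agrees with `R = O(V)` up to `o(W)`
  set R : α → Obs f := fun a => V a - D a
    - ∑ i, if deg i then 0 else β i • (psi f (s i a) - psi f (X i)) with hR
  have hRV : R =O[l] V := by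
    refine ((isBigO_refl V l).sub h.isBigO_D).sub (IsBigO.fun_sum fun i _ => ?_)
    by_cases hi : deg i
    · simp only [hi, if_true]; exact isBigO_zero _ _
    · simp only [hi, if_false]
      change (β i • fun a => psi f (s i a) - psi f (X i)) =O[l] V
      refine IsBigO.const_smul_left ?_ _
      have := ((hasDerivAt_psi f (X i)).isBigO_sub).comp_tendsto (h.tendsto_s i)
      exact this.trans (hnon i hi)
  set T : α → Obs f := fun a => ∑ i, (b i a - β i) • psi f (X i)
    + ∑ i, if deg i then (β i * (s i a - X i)) • dOp f (psi f (X i)) else 0 with hT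
  have hTR : (fun a => T a - R a) =o[l] W := by
    have h1 : (fun a => -(∑ i, (b i a - β i) • (psi f (s i a) - psi f (X i))
        + ∑ i, if deg i then β i • (psi f (s i a) - psi f (X i)
          - (s i a - X i) • dOp f (psi f (X i))) else 0)) =o[l] W := by
      refine (IsLittleO.add (IsLittleO.fun_sum fun i _ => ?_)
        (IsLittleO.fun_sum fun i _ => ?_)).neg_left
      · have := (hu i).norm_right.smul_isLittleO (h.tendsto_sub 0 i)
        simp only [pow_zero, one_apply_eq_self, smul_eq_mul, mul_one] at this
        exact this.of_norm_right
      · by_cases hi : deg i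
        · simp only [hi, if_true]
          have := (h.taylor 0 i).const_smul_left (β i)
          simp only [pow_zero, one_apply_eq_self, zero_add, pow_one] at this
          exact this.trans_isBigO (hδ i)
        · simp only [hi, if_false]; exact isLittleO_zero _ _
    refine h1.congr' ?_ EventuallyEq.rfl
    filter_upwards [h.decomp] with a ha
    simp only [hT, hR]
    rw [ha, add_sub_cancel_left]
    simp only [← Finset.sum_sub_distrib, ← Finset.sum_add_distrib, ← Finset.sum_neg_distrib]
    refine Finset.sum_congr rfl fun i _ => ?_
    by_cases hi : deg i
    · simp only [hi, if_true]; module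
    · simp only [hi, if_false]; module
  have hTξ : ∀ i a, ⟪T a, ξ i⟫_ℝ = b i a - β i := by
    intro i a
    rw [hT, inner_add_left, sum_inner, sum_inner, Finset.sum_eq_single i,
      Finset.sum_eq_zero, inner_smul_left, hd.value_ξ]
    · simp
    · intro k _
      by_cases hk : deg k
      · simp only [hk, if_true, inner_smul_left, hd.deriv_ξ i k hk, mul_zero]
      · simp [hk]
    · intro k _ hk
      simp [inner_smul_left, hd.value_ξ, hk]
    · simp
  have hTζ : ∀ i a, deg i → ⟪T a, ζ i⟫_ℝ = β i * (s i a - X i) := by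
    intro i a hi
    rw [hT, inner_add_left, sum_inner, sum_inner, Finset.sum_eq_zero, Finset.sum_eq_single i]
    · simp [hi, inner_smul_left, hd.deriv_ζ i i hi]
    · intro k _ hk
      by_cases hk' : deg k
      · simp [hk', inner_smul_left, hd.deriv_ζ i k hk', hk]
      · simp [hk']
    · simp
    · intro k _
      simp [inner_smul_left, hd.value_ζ]
  set R' : α → (ι → ℝ) × (ι → ℝ) := fun a => (fun i => ⟪R a, ξ i⟫_ℝ,
    fun i => if deg i then (β i)⁻¹ * ⟪R a, ζ i⟫_ℝ else s i a - X i) with hR'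
  have hR'V : R' =O[l] V := by
    refine IsBigO.prod_left (isBigO_pi.2 fun i => ?_) (isBigO_pi.2 fun i => ?_)
    · exact (IsBigO.of_bound ‖ξ i‖ (Eventually.of_forall fun a => by
        rw [mul_comm]; exact norm_inner_le_norm _ _)).trans hRV
    · by_cases hi : deg i
      · simp only [hi, if_true]
        exact IsBigO.const_mul_left ((IsBigO.of_bound ‖ζ i‖ (Eventually.of_forall fun a => by
          rw [mul_comm]; exact norm_inner_le_norm _ _)).trans hRV) _
      · simp only [hi, if_false]
        exact hnon i hi
  have hWR : (fun a => W a - R' a) =o[l] W := by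
    refine IsLittleO.prod_left (isLittleO_pi.2 fun i => ?_) (isLittleO_pi.2 fun i => ?_)
    · refine (inner_const_isLittleO hTR (ξ i)).congr_left fun a => ?_
      rw [inner_sub_left, hTξ]
      rfl
    · by_cases hi : deg i
      · refine ((inner_const_isLittleO hTR (ζ i)).const_mul_left (β i)⁻¹).congr_left fun a => ?_
        rw [inner_sub_left, hTζ i a hi]
        simp only [hW, hR', Pi.sub_apply, hi, if_true]
        rw [mul_sub, inv_mul_cancel_left₀ (h.ne_zero i)]
      · refine (isLittleO_zero _ _).congr_left fun a => ?_
        simp [hW, hR', hi]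
  have := hWR.right_isBigO_sub
  refine this.trans (hR'V.congr_left fun a => ?_)
  simp

section

variable [DecidableEq ι] {ξ ζ : ι → Obs f}

theorem isBigO_amplitude (h : ContactFamily l p X β V D s b) (hd : DualVectors p X ξ ζ) (i : ι) :
    (fun a => b i a - β i) =O[l] V :=
  isBigO_pi.1 ((isBigO_fst_prod (f' := fun a i => b i a - β i)
    (g' := fun a i => s i a - X i)).trans (h.isBigO_increments hd)) i

theorem isBigO_contact (h : ContactFamily l p X β V D s b) (hd : DualVectors p X ξ ζ) (i : ι) :
    (fun a => s i a - X i) =O[l] V :=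
  isBigO_pi.1 ((isBigO_snd_prod (f' := fun a i => b i a - β i)
    (g' := fun a i => s i a - X i)).trans (h.isBigO_increments hd)) i

/-- The linearized primal equation. -/
theorem linearized_decomp (h : ContactFamily l p X β V D s b) (hd : DualVectors p X ξ ζ) :
    (fun a => V a - D a - (∑ i, (b i a - β i) • psi f (X i)
      + ∑ i, (β i * (s i a - X i)) • dOp f (psi f (X i)))) =o[l] V := by
  have h1 : (fun a => ∑ i, (b i a - β i) • (psi f (s i a) - psi f (X i))
      + ∑ i, β i • (psi f (s i a) - psi f (X i) - (s i a - X i) • dOp f (psi f (X i))))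
      =o[l] V := by
    refine IsLittleO.add (IsLittleO.fun_sum fun i _ => ?_) (IsLittleO.fun_sum fun i _ => ?_)
    · have := (h.isBigO_amplitude hd i).norm_right.smul_isLittleO (h.tendsto_sub 0 i)
      simp only [pow_zero, one_apply_eq_self, smul_eq_mul, mul_one] at this
      exact this.of_norm_right
    · have := (h.taylor 0 i).const_smul_left (β i)
      simp only [pow_zero, one_apply_eq_self, zero_add, pow_one] at this
      exact this.trans_isBigO (h.isBigO_contact hd i)
  refine h1.congr' ?_ EventuallyEq.rfl
  filter_upwards [h.decomp] with a ha
  rw [ha, add_sub_cancel_left]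
  simp only [← Finset.sum_sub_distrib, ← Finset.sum_add_distrib]
  exact Finset.sum_congr rfl fun i _ => by module

/-- To first order the values of the certificate at the contact points do not move. -/
theorem linearized_value (h : ContactFamily l p X β V D s b) (hd : DualVectors p X ξ ζ) (i : ι) :
    (fun a => ⟪psi f (X i), D a⟫_ℝ) =o[l] V := by
  obtain ⟨e1, e2, he1, he2, he⟩ := h.inner_expand 0 i
  refine ((he1.add (he2.trans_isBigO (h.isBigO_contact hd i))).neg_left).congr' ?_ EventuallyEq.rfl
  filter_upwards [h.value i] with a ha
  have h3 := he a
  simp only [pow_zero, one_apply_eq_self, zero_add, pow_one] at h3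
  rw [ha, h.base_deriv i] at h3
  linarith

/-- The linearized stationarity of the certificate at the contact points. -/
theorem linearized_deriv (h : ContactFamily l p X β V D s b) (hd : DualVectors p X ξ ζ) (i : ι) :
    (fun a => ⟪dOp f (psi f (X i)), D a⟫_ℝ
      + (s i a - X i) * ⟪(dOp f ^ 2) (psi f (X i)), p⟫_ℝ) =o[l] V := by
  obtain ⟨e1, e2, he1, he2, he⟩ := h.inner_expand 1 i
  refine ((he1.add (he2.trans_isBigO (h.isBigO_contact hd i))).neg_left).congr' ?_ EventuallyEq.rfl
  filter_upwards [h.deriv i] with a ha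
  have h3 := he a
  simp only [pow_one] at h3
  rw [ha, h.base_deriv i] at h3
  simp only [one_add_one_eq_two] at h3
  linarith

/-- The second derivative of the certificate at the moved contact point. -/
theorem second_deriv_expand (h : ContactFamily l p X β V D s b) (hd : DualVectors p X ξ ζ) (i : ι) :
    (fun a => ⟪(dOp f ^ 2) (psi f (s i a)), p + D a⟫_ℝ - (⟪(dOp f ^ 2) (psi f (X i)), p⟫_ℝ
      + ⟪(dOp f ^ 2) (psi f (X i)), D a⟫_ℝ
      + (s i a - X i) * ⟪(dOp f ^ 3) (psi f (X i)), p⟫_ℝ)) =o[l] V := by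
  obtain ⟨e1, e2, he1, he2, he⟩ := h.inner_expand 2 i
  refine (he1.add (he2.trans_isBigO (h.isBigO_contact hd i))).congr_left fun a => ?_
  have h3 := he a
  linarith

/-- The linearized system is coercive, so its solution `q` approximates the increment `D` of the
projection. -/
theorem sub_isLittleO_of_linearized (h : ContactFamily l p X β V D s b)
    (hd : DualVectors p X ξ ζ) (hQ : ∀ i, 0 ≤ -(⟪(dOp f ^ 2) (psi f (X i)), p⟫_ℝ / β i))
    {q : α → Obs f} {κ γ : ι → α → ℝ} (hq : q =O[l] V) (hκ : ∀ i, κ i =O[l] V)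
    (hγ : ∀ i, γ i =O[l] V)
    (hV : ∀ a, V a = q a + (∑ i, κ i a • psi f (X i) + ∑ i, γ i a • dOp f (psi f (X i))))
    (hval : ∀ i a, ⟪psi f (X i), q a⟫_ℝ = 0)
    (hder : ∀ i a, ⟪dOp f (psi f (X i)), q a⟫_ℝ
      = -(⟪(dOp f ^ 2) (psi f (X i)), p⟫_ℝ / β i) * γ i a) :
    (fun a => D a - q a) =o[l] V := by
  set c : ι → ℝ := fun i => ⟪(dOp f ^ 2) (psi f (X i)), p⟫_ℝ with hc
  set d : α → Obs f := fun a => D a - q a with hdd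
  set u : ι → α → ℝ := fun i a => (b i a - β i) - κ i a with hu
  set g : ι → α → ℝ := fun i a => β i * (s i a - X i) - γ i a with hg
  set e2 : α → Obs f := fun a => V a - D a - (∑ i, (b i a - β i) • psi f (X i)
      + ∑ i, (β i * (s i a - X i)) • dOp f (psi f (X i))) with he2
  set e4 : ι → α → ℝ := fun i a => ⟪dOp f (psi f (X i)), D a⟫_ℝ + (s i a - X i) * c i with he4
  have hdO : d =O[l] V := h.isBigO_D.sub hq
  have huO : ∀ i, u i =O[l] V := fun i => (h.isBigO_amplitude hd i).sub (hκ i)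
  have hgO : ∀ i, g i =O[l] V := fun i => ((h.isBigO_contact hd i).const_mul_left _).sub (hγ i)
  have hd1 : ∀ a, d a = -(∑ i, u i a • psi f (X i) + ∑ i, g i a • dOp f (psi f (X i)) + e2 a) := by
    intro a
    have h1 : e2 a = q a + (∑ i, κ i a • psi f (X i) + ∑ i, γ i a • dOp f (psi f (X i))) - D a
      - (∑ i, (b i a - β i) • psi f (X i)
        + ∑ i, (β i * (s i a - X i)) • dOp f (psi f (X i))) := by rw [he2]; simp only; rw [← hV a]
    rw [h1]
    simp only [hdd, hu, hg, sub_smul, Finset.sum_sub_distrib]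
    abel
  have hd2 : ∀ i a, ⟪psi f (X i), d a⟫_ℝ = ⟪psi f (X i), D a⟫_ℝ := fun i a => by
    rw [hdd]; simp only; rw [inner_sub_right, hval, sub_zero]
  have hd3 : ∀ i a, ⟪dOp f (psi f (X i)), d a⟫_ℝ = -(c i / β i) * g i a + e4 i a := by
    intro i a
    rw [hdd]; simp only
    rw [inner_sub_right, hder]
    simp only [he4, hg, hc]
    have := h.ne_zero i
    field_simp
    ring
  set F : α → ℝ := fun a => -(∑ i, u i a * ⟪psi f (X i), D a⟫_ℝ + ∑ i, g i a * e4 i a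
    + ⟪e2 a, d a⟫_ℝ) with hF
  have hFo : F =o[l] fun a => ‖V a‖ * ‖V a‖ := by
    refine (((IsLittleO.fun_sum fun i _ => ?_).add
      (IsLittleO.fun_sum fun i _ => ?_)).add ?_).neg_left
    · exact (huO i).norm_right.mul_isLittleO (h.linearized_value hd i).norm_right
    · exact (hgO i).norm_right.mul_isLittleO (h.linearized_deriv hd i).norm_right
    · refine IsBigO.trans_isLittleO (IsBigO.of_bound 1 (Eventually.of_forall fun a => ?_))
        ((h.linearized_decomp hd).norm_norm.mul_isBigO hdO.norm_norm)
      rw [one_mul]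
      exact (norm_inner_le_norm _ _).trans (le_abs_self _)
  -- testing the linearized primal equation with the error `d`, the curvature terms have a good sign
  have hle : ∀ a, ‖d a‖ ^ 2 ≤ F a := by
    intro a
    have h1 : ‖d a‖ ^ 2 = ⟪d a, d a⟫_ℝ := (real_inner_self_eq_norm_sq _).symm
    have h2 : ⟪d a, d a⟫_ℝ = F a + ∑ i, (c i / β i) * g i a ^ 2 := by
      refine (congrArg (fun v => ⟪v, d a⟫_ℝ) (hd1 a)).trans ?_
      rw [inner_neg_left, inner_add_left, inner_add_left, sum_inner, sum_inner]
      simp only [inner_smul_left, conj_trivial, hd2, hd3, hF]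
      simp only [mul_add, Finset.sum_add_distrib]
      have : ∑ i, g i a * (-(c i / β i) * g i a) = -∑ i, c i / β i * g i a ^ 2 := by
        rw [← Finset.sum_neg_distrib]
        exact Finset.sum_congr rfl fun i _ => by ring
      rw [this]
      ring
    have h3 : ∑ i, (c i / β i) * g i a ^ 2 ≤ 0 := Finset.sum_nonpos fun i _ => by
      have := mul_nonneg (hQ i) (sq_nonneg (g i a))
      simp only [hc]
      linarith
    linarith
  have hsq : (fun a => ‖d a‖ ^ 2) =o[l] fun a => ‖V a‖ ^ 2 := by
    refine IsBigO.trans_isLittleO (IsBigO.of_bound 1 (Eventually.of_forall fun a => ?_))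
      (hFo.congr_right fun a => (sq _).symm)
    rw [one_mul, Real.norm_of_nonneg (by positivity)]
    exact (hle a).trans (le_abs_self _)
  exact (IsLittleO.of_pow hsq two_ne_zero).of_norm_norm

end

end ContactFamily

/-! ### Full column rank and pseudo-inverses -/

theorem rank_eq_iff_mulVec {n : Type*} [Fintype n] {m : ℕ} (M : Matrix n (Fin m) ℝ) :
    M.rank = m ↔ ∀ v, M *ᵥ v = 0 → v = 0 := by
  have h := LinearMap.finrank_range_add_finrank_ker M.mulVecLin
  rw [Module.finrank_fin_fun] at h
  have h2 : M.rank = Module.finrank ℝ (LinearMap.range M.mulVecLin) := rfl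
  rw [← h2] at h
  constructor
  · intro hr v hv
    have h3 : Module.finrank ℝ (LinearMap.ker M.mulVecLin) = 0 := by omega
    have h4 := Submodule.finrank_eq_zero.1 h3
    exact (LinearMap.ker_eq_bot'.1 h4) v hv
  · intro hv
    have h4 : LinearMap.ker M.mulVecLin = ⊥ := LinearMap.ker_eq_bot'.2 fun v h => hv v h
    rw [h4, finrank_bot] at h
    omega

theorem isUnit_transpose_mul_self {n : Type*} [Fintype n] {m : ℕ} {M : Matrix n (Fin m) ℝ}
    (hM : ∀ v, M *ᵥ v = 0 → v = 0) : IsUnit (Mᵀ * M) := by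
  rw [← Matrix.mulVec_injective_iff_isUnit]
  intro v w hvw
  have h1 : (Mᵀ * M) *ᵥ (v - w) = 0 := by
    rw [Matrix.mulVec_sub]; exact sub_eq_zero.2 hvw
  have h2 : M *ᵥ (v - w) ⬝ᵥ M *ᵥ (v - w) = 0 := by
    rw [Matrix.dotProduct_mulVec, ← Matrix.mulVec_transpose, Matrix.mulVec_mulVec, h1,
      zero_dotProduct]
  exact sub_eq_zero.1 (hM _ (dotProduct_self_eq_zero.1 h2))

/-- The Moore–Penrose pseudo-inverses of a matrix with full column rank and of its transpose. -/
theorem exists_isPseudoInverse {n : Type*} [Fintype n] [DecidableEq n] {m : ℕ}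
    {M : Matrix n (Fin m) ℝ} (hM : ∀ v, M *ᵥ v = 0 → v = 0) :
    ∃ P R, IsPseudoInverse M P ∧ IsPseudoInverse Mᵀ R := by
  set G := Mᵀ * M with hG
  have hdet : IsUnit G.det := (Matrix.isUnit_iff_isUnit_det _).1 (isUnit_transpose_mul_self hM)
  have hGt : Gᵀ = G := by rw [hG, Matrix.transpose_mul, Matrix.transpose_transpose]
  have hGi : (G⁻¹)ᵀ = G⁻¹ := by rw [Matrix.transpose_nonsing_inv, hGt]
  have h1 : G⁻¹ * Mᵀ * M = 1 := by rw [Matrix.mul_assoc, ← hG, Matrix.nonsing_inv_mul _ hdet]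
  have h2 : Mᵀ * (M * G⁻¹) = 1 := by rw [← Matrix.mul_assoc, ← hG, Matrix.mul_nonsing_inv _ hdet]
  refine ⟨G⁻¹ * Mᵀ, M * G⁻¹, ⟨?_, ?_, ?_, ?_⟩, ⟨?_, ?_, ?_, ?_⟩⟩
  · rw [Matrix.mul_assoc, h1, Matrix.mul_one]
  · rw [h1, Matrix.one_mul]
  · rw [Matrix.transpose_mul, Matrix.transpose_mul, hGi, Matrix.transpose_transpose,
      Matrix.mul_assoc]
  · rw [h1, Matrix.transpose_one]
  · rw [h2, Matrix.one_mul]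
  · rw [Matrix.mul_assoc, h2, Matrix.mul_one]
  · rw [h2, Matrix.transpose_one]
  · rw [Matrix.transpose_mul, Matrix.transpose_mul, hGi, Matrix.transpose_transpose,
      Matrix.mul_assoc]

/-- The vector `M† (y - (M*)† z)` solves the normal equations `M* M b = M* y - z`. -/
theorem IsPseudoInverse.normal_eq {n : Type*} [Fintype n] {m : ℕ}
    {M : Matrix n (Fin m) ℝ} (hM : ∀ v, M *ᵥ v = 0 → v = 0) {P : Matrix (Fin m) n ℝ}
    {R : Matrix n (Fin m) ℝ} (hP : IsPseudoInverse M P) (hR : IsPseudoInverse Mᵀ R)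
    (y : n → ℝ) (z : Fin m → ℝ) : (Mᵀ * M) *ᵥ (P *ᵥ (y - R *ᵥ z)) = Mᵀ *ᵥ y - z := by
  obtain ⟨p1, -, p3, -⟩ := hP
  obtain ⟨r1, -, -, -⟩ := hR
  have h1 : Mᵀ * M * P = Mᵀ := by
    rw [Matrix.mul_assoc, ← p3, ← Matrix.transpose_mul, p1]
  have h2 : Mᵀ * R = 1 := by
    have h3 : M * (Rᵀ * M) = M := by
      have := congrArg Matrix.transpose r1
      rw [Matrix.transpose_mul, Matrix.transpose_mul, Matrix.transpose_transpose] at this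
      exact this
    have h4 : Rᵀ * M = 1 := by
      rw [← sub_eq_zero]
      ext i j
      have h5 : M *ᵥ ((Rᵀ * M - 1) *ᵥ Pi.single j 1) = 0 := by
        rw [Matrix.mulVec_mulVec, Matrix.mul_sub, h3, Matrix.mul_one, sub_self, Matrix.zero_mulVec]
      have := congrFun (hM _ h5) i
      simpa using this
    have := congrArg Matrix.transpose h4
    rwa [Matrix.transpose_mul, Matrix.transpose_transpose, Matrix.transpose_one] at this
  rw [Matrix.mulVec_mulVec, h1, Matrix.mulVec_sub, Matrix.mulVec_mulVec, h2, Matrix.one_mulVec]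

theorem PhiMat_mulVec_eq_zero_iff {f m : ℕ} (x : Fin m → Torus) (v : Fin m → ℝ) :
    PhiMat f x *ᵥ v = 0 ↔ ∑ j, v j • phi f (x j) = 0 := by
  rw [← toLp_PhiMat_mulVec]
  constructor
  · intro h; rw [h]; rfl
  · intro h; exact congrArg WithLp.ofLp h

theorem transpose_PhiMat_mulVec {f m : ℕ} (x : Fin m → Torus) (p : Obs f) :
    (PhiMat f x)ᵀ *ᵥ p.ofLp = fun k => ⟪phi f (x k), p⟫_ℝ := by
  ext k
  simp [PhiMat, Matrix.mulVec, dotProduct, PiLp.inner_apply, mul_comm]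

theorem gram_mulVec {f m : ℕ} (x : Fin m → Torus) (v : Fin m → ℝ) :
    ((PhiMat f x)ᵀ * PhiMat f x) *ᵥ v = fun k => ⟪phi f (x k), ∑ j, v j • phi f (x j)⟫_ℝ := by
  rw [← Matrix.mulVec_mulVec, ← toLp_PhiMat_mulVec]
  exact transpose_PhiMat_mulVec x (WithLp.toLp 2 (PhiMat f x *ᵥ v))

/-! ### The strata of the exceptional set -/

/-- An observation whose solution has the atoms `x i`, among them all points of the extended
support, lies in the stratum of its vanishing amplitudes and degenerate contacts. -/
theorem mem_projQ {f m : ℕ} {lam : ℝ} (hlam : 0 < lam) {y : Obs f} {β σ : Fin m → ℝ}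
    {x : Fin m → Torus} {l : Fin m → ℕ} (hlin : ∀ v : Fin m → ℝ, ∑ j, v j • phi f (x j) = 0 → v = 0)
    (hy : y = pHat f lam y + ∑ j, β j • phi f (x j))
    (hβ : ∀ j, β j * ⟪phi f (x j), pHat f lam y⟫_ℝ = lam * |β j|)
    (hσ : ∀ j, ⟪phi f (x j), pHat f lam y⟫_ℝ = lam * σ j)
    (hl : ∀ i, l i = 1 ∨ (l i = 2 ∧ ⟪(dOp f ^ 2) (phi f (x i)), pHat f lam y⟫_ℝ = 0)) :
    y ∈ projQ f lam m σ {i | β i = 0} l := by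
  have hM : ∀ v, PhiMat f x *ᵥ v = 0 → v = 0 := fun v hv =>
    hlin v ((PhiMat_mulVec_eq_zero_iff x v).1 hv)
  have hp : y - WithLp.toLp 2 (PhiMat f x *ᵥ β) = pHat f lam y := by
    rw [toLp_PhiMat_mulVec, sub_eq_iff_eq_add]; exact hy
  refine ⟨x, β, _, rfl, ?_, (rank_eq_iff_mulVec _).2 hM, ?_, ?_⟩
  · rw [hp]
    exact smul_PhiAdj_mem_tvSubdifferential hlam (isProj_pHat f hlam y).1 hβ
  · obtain ⟨P, R, hP, hR⟩ := exists_isPseudoInverse hM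
    refine ⟨P, R, hP, hR, fun i hi => ?_⟩
    have h1 := hP.normal_eq hM hR y.ofLp (lam • σ)
    have h2 : (PhiMat f x)ᵀ *ᵥ y.ofLp - lam • σ = ((PhiMat f x)ᵀ * PhiMat f x) *ᵥ β := by
      rw [transpose_PhiMat_mulVec, gram_mulVec]
      ext k
      have : ⟪phi f (x k), y⟫_ℝ = ⟪phi f (x k), pHat f lam y + ∑ j, β j • phi f (x j)⟫_ℝ := by
        rw [← hy]
      simp only [Pi.sub_apply, Pi.smul_apply, smul_eq_mul]
      rw [this, inner_add_right, hσ]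
      ring
    rw [h2] at h1
    have h3 := Matrix.mulVec_injective_iff_isUnit.2 (isUnit_transpose_mul_self hM) h1
    rw [h3]
    exact hi
  · intro i j hj1 hj2
    rw [hp, torusDeriv_PhiAdj, inner_smul_right]
    rcases hl i with h | ⟨h, h'⟩
    · omega
    · obtain rfl : j = 1 := by omega
      rw [mul_one, h', mul_zero]

/-- What membership in a stratum says about the projection. -/
theorem exists_of_mem_projQ {f m : ℕ} {lam : ℝ} (hlam : 0 < lam) {y : Obs f} {σ : Fin m → ℝ}
    {I : Set (Fin m)} {l : Fin m → ℕ} (h : y ∈ projQ f lam m σ I l) :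
    ∃ (x : Fin m → Torus) (β : Fin m → ℝ), Function.Injective x ∧
      y = pHat f lam y + ∑ j, β j • phi f (x j) ∧
      (∀ j, β j * ⟪phi f (x j), pHat f lam y⟫_ℝ = lam * |β j|) ∧
      (∀ c : Fin m → ℝ, (∀ k, ⟪phi f (x k), ∑ j, c j • phi f (x j)⟫_ℝ
        = lam * σ k - ⟪phi f (x k), pHat f lam y⟫_ℝ) → ∀ i ∈ I, β i = c i) ∧
      ∀ i, 2 ≤ l i → ⟪(dOp f ^ 2) (phi f (x i)), pHat f lam y⟫_ℝ = 0 := by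
  obtain ⟨x, β, η, rfl, hη, hrank, ⟨P, R, hP, hR, hPR⟩, hl⟩ := h
  have hM := (rank_eq_iff_mulVec _).1 hrank
  have hx : Function.Injective x := by
    intro i j hij
    by_contra hne
    have h0 : PhiMat f x *ᵥ (Pi.single i 1 - Pi.single j 1) = 0 := by
      rw [Matrix.mulVec_sub, Matrix.mulVec_single_one, Matrix.mulVec_single_one]
      ext k
      simp [PhiMat, hij]
    have := congrFun (hM _ h0) i
    simp [hne] at this
  set p := y - WithLp.toLp 2 (PhiMat f x *ᵥ β) with hpdef
  obtain ⟨hp, hβ⟩ := dualBall_of_mem_tvSubdifferential hlam hx hη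
  have hy : y = p + ∑ j, β j • phi f (x j) := by
    rw [hpdef, toLp_PhiMat_mulVec, sub_add_cancel]
  have hpe : pHat f lam y = p := (isProj_of_atoms hp hy hβ).eq_pHat hlam
  rw [hpe]
  refine ⟨x, β, hx, hy, hβ, fun c hc i hi => ?_, fun i hi => ?_⟩
  · have h1 := hP.normal_eq hM hR y.ofLp (lam • σ)
    have h2 : (PhiMat f x)ᵀ *ᵥ y.ofLp - lam • σ = ((PhiMat f x)ᵀ * PhiMat f x) *ᵥ (β - c) := by
      rw [transpose_PhiMat_mulVec, Matrix.mulVec_sub, gram_mulVec, gram_mulVec]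
      ext k
      have : ⟪phi f (x k), y⟫_ℝ = ⟪phi f (x k), p + ∑ j, β j • phi f (x j)⟫_ℝ := by rw [← hy]
      simp only [Pi.sub_apply, Pi.smul_apply, smul_eq_mul]
      rw [this, inner_add_right, hc]
      ring
    rw [h2] at h1
    have h3 := Matrix.mulVec_injective_iff_isUnit.2 (isUnit_transpose_mul_self hM) h1
    have h4 := hPR i hi
    rw [h3] at h4
    exact sub_eq_zero.1 h4
  · have := hl i 1 le_rfl (by omega)
    rw [torusDeriv_PhiAdj, inner_smul_right, mul_one] at this
    exact (mul_eq_zero.1 this).resolve_left (inv_ne_zero hlam.ne')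

theorem exists_gram_solution {f m : ℕ} {x : Fin m → Torus}
    (hlin : ∀ v : Fin m → ℝ, ∑ j, v j • phi f (x j) = 0 → v = 0) (z : Fin m → ℝ) :
    ∃ c : Fin m → ℝ, ∀ k, ⟪phi f (x k), ∑ j, c j • phi f (x j)⟫_ℝ = z k := by
  have hM : ∀ v, PhiMat f x *ᵥ v = 0 → v = 0 := fun v hv =>
    hlin v ((PhiMat_mulVec_eq_zero_iff x v).1 hv)
  obtain ⟨c, hc⟩ := Matrix.mulVec_surjective_iff_isUnit.2 (isUnit_transpose_mul_self hM) z
  exact ⟨c, fun k => by rw [← hc, gram_mulVec]⟩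

/-! ### The structure of the solution at a finite extended support -/

/-- An enumeration `x` of the extended support of `y`, with the signs `σ` of the dual certificate
and amplitudes `β`, some of which may vanish, of a solution. -/
structure ContactData (f : ℕ) (lam : ℝ) (y : Obs f) {m : ℕ} (x : Fin m → Torus)
    (σ β : Fin m → ℝ) : Prop where
  injective : Function.Injective x
  range_eq : Set.range x = extSupport f lam y
  decomp : y = pHat f lam y + ∑ j, β j • phi f (x j)
  value : ∀ j, ⟪phi f (x j), pHat f lam y⟫_ℝ = lam * σ j
  sign : ∀ j, σ j = 1 ∨ σ j = -1
  amplitude : ∀ j, β j * σ j = |β j|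

/-- An atom with nonzero amplitude is a point of the extended support. -/
theorem mem_extSupport_of_ne_zero {f : ℕ} {lam : ℝ} (hlam : 0 < lam) {y : Obs f} {b : ℝ}
    {t : Torus} (hb : b * ⟪phi f t, pHat f lam y⟫_ℝ = lam * |b|) (h0 : b ≠ 0) :
    t ∈ extSupport f lam y := by
  rw [mem_extSupport_iff hlam]
  have h1 := congrArg abs hb
  rw [abs_mul, abs_mul, abs_abs, abs_of_pos hlam, mul_comm lam] at h1
  exact mul_left_cancel₀ (abs_pos.2 h0).ne' h1

theorem exists_contactData {f : ℕ} {lam : ℝ} (hlam : 0 < lam) {y : Obs f}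
    (hfin : (extSupport f lam y).Finite) :
    ∃ (m : ℕ) (x : Fin m → Torus) (σ β : Fin m → ℝ), ContactData f lam y x σ β := by
  classical
  have hft : Fintype (extSupport f lam y) := hfin.fintype
  set e := (Fintype.equivFin (extSupport f lam y)).symm
  set x : Fin (Fintype.card (extSupport f lam y)) → Torus := fun i => e i with hx
  have hxinj : Function.Injective x := Subtype.val_injective.comp e.injective
  have hrange : Set.range x = extSupport f lam y := by
    rw [hx]
    ext t
    constructor
    · rintro ⟨i, rfl⟩; exact (e i).2
    · intro ht; exact ⟨e.symm ⟨t, ht⟩, by simp⟩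
  have hσ : ∀ i, ∃ σ : ℝ, (σ = 1 ∨ σ = -1) ∧ ⟪phi f (x i), pHat f lam y⟫_ℝ = lam * σ := by
    intro i
    have : x i ∈ extSupport f lam y := by rw [← hrange]; exact ⟨i, rfl⟩
    rcases (abs_eq hlam.le).1 ((mem_extSupport_iff hlam).1 this) with h | h
    · exact ⟨1, Or.inl rfl, by rw [h, mul_one]⟩
    · exact ⟨-1, Or.inr rfl, by rw [h]; ring⟩
  choose σ hσ1 hσ2 using hσ
  obtain ⟨N, b, t, hy, hb⟩ := (isProj_pHat f hlam y).exists_atoms hlam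
  refine ⟨_, x, σ, fun i => ∑ j, if t j = x i then b j else 0, hxinj, hrange, ?_, hσ2, hσ1, ?_⟩
  · conv_lhs => rw [hy]
    congr 1
    simp only [Finset.sum_smul]
    rw [Finset.sum_comm]
    refine Finset.sum_congr rfl fun j _ => ?_
    by_cases hj : b j = 0
    · simp [hj]
    · have hmem := mem_extSupport_of_ne_zero hlam (hb j) hj
      rw [← hrange] at hmem
      obtain ⟨i, hi⟩ := hmem
      rw [Finset.sum_eq_single i]
      · rw [if_pos hi.symm, hi]
      · intro k _ hk
        rw [if_neg, zero_smul]
        intro h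
        exact hk (hxinj (h.symm.trans hi.symm))
      · simp
  · intro i
    have h1 : (∑ j, if t j = x i then b j else 0) * σ i = ∑ j, if t j = x i then |b j| else 0 := by
      rw [Finset.sum_mul]
      refine Finset.sum_congr rfl fun j _ => ?_
      split_ifs with h
      · have := hb j
        rw [h, hσ2] at this
        have h2 : lam * (b j * σ i) = lam * |b j| := by rw [← this]; ring
        exact mul_left_cancel₀ hlam.ne' h2
      · rw [zero_mul]
    have h2 : 0 ≤ (∑ j, if t j = x i then b j else 0) * σ i := by
      rw [h1]
      exact Finset.sum_nonneg fun j _ => by split_ifs <;> positivity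
    have h3 : |σ i| = 1 := by rcases hσ1 i with h | h <;> simp [h]
    rw [← abs_of_nonneg h2, abs_mul, h3, mul_one]

namespace ContactData

variable {f : ℕ} {lam : ℝ} {y : Obs f} {m : ℕ} {x : Fin m → Torus} {σ β : Fin m → ℝ}

theorem saturated (h : ContactData f lam y x σ β) (j : Fin m) :
    β j * ⟪phi f (x j), pHat f lam y⟫_ℝ = lam * |β j| := by
  rw [h.value, ← h.amplitude]; ring

theorem sign_mul_self (h : ContactData f lam y x σ β) (j : Fin m) : σ j * σ j = 1 := by
  rcases h.sign j with h | h <;> rw [h] <;> norm_num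

theorem sum_mult_le (hlam : 0 < lam) (h : ContactData f lam y x σ β)
    (μ : Fin m → ℕ) (hμ : ∀ i, μ i = 1 ∨
      (μ i = 3 ∧ ⟪(dOp f ^ 2) (phi f (x i)), pHat f lam y⟫_ℝ = 0)) : ∑ i, μ i ≤ 2 * f :=
  sum_contact_le hlam (by rw [← h.range_eq]; exact Set.finite_range x) h.injective h.range_eq μ hμ

theorem card_le (hlam : 0 < lam) (h : ContactData f lam y x σ β) : m ≤ 2 * f := by
  simpa using h.sum_mult_le hlam (fun _ => 1) fun _ => Or.inl rfl

theorem exists_dual (hlam : 0 < lam) (h : ContactData f lam y x σ β) :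
    ∃ ξ : Fin m → Obs f, ∀ i k, ⟪phi f (x k), ξ i⟫_ℝ = if k = i then 1 else 0 := by
  have : ∀ i, ∃ ξ : Obs f, ∀ k, ⟪phi f (x k), ξ⟫_ℝ = if k = i then 1 else 0 := by
    intro i
    obtain ⟨q, hq⟩ := exists_hermite (f := f) h.injective (fun _ => 1)
      (by have := h.card_le hlam; simp; omega) fun k _ => if k = i then 1 else 0
    exact ⟨q, fun k => by simpa using hq k 0 one_pos⟩
  choose ξ hξ using this
  exact ⟨ξ, hξ⟩

theorem inner_sum_dual {ξ : Obs f} {i : Fin m}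
    (hξ : ∀ k, ⟪phi f (x k), ξ⟫_ℝ = if k = i then 1 else 0) (v : Fin m → ℝ) :
    ⟪∑ j, v j • phi f (x j), ξ⟫_ℝ = v i := by
  simp [sum_inner, inner_smul_left, hξ]

theorem linearIndependent (hlam : 0 < lam) (h : ContactData f lam y x σ β) (v : Fin m → ℝ)
    (hv : ∑ j, v j • phi f (x j) = 0) : v = 0 := by
  obtain ⟨ξ, hξ⟩ := h.exists_dual hlam
  ext i
  rw [← inner_sum_dual (hξ i) v, hv, inner_zero_left]
  rfl

/-- The solution is unique, as the vectors `φ(x i)` at the extended support are independent. -/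
theorem eq_of_isSolution (hlam : 0 < lam) (h : ContactData f lam y x σ β)
    {m' : SignedMeasure Torus} (hm : IsSolution f lam y m') : m' = discreteMeasure β x := by
  classical
  have h1 : m' = discreteMeasure (fun j => m' {x j}) x := by
    ext s hs
    have hsplit : m' s = m' (s ∩ Set.range x) := by
      have h2 := VectorMeasure.of_add_of_sdiff (v := m')
        (hs.inter (Set.finite_range x).measurableSet) hs Set.inter_subset_left
      have h3 : m' (s \ (s ∩ Set.range x)) = 0 := by
        refine hm.apply_eq_zero hlam ?_
        rintro t ⟨ht, ht'⟩ hmem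
        rw [← h.range_eq] at hmem
        exact ht' ⟨ht, hmem⟩
      rw [← h2, h3, add_zero]
    have hunion : s ∩ Set.range x = ⋃ j ∈ Finset.univ.filter (fun j => x j ∈ s), {x j} := by
      ext t
      simp only [Set.mem_inter_iff, Set.mem_range, Finset.mem_filter, Finset.mem_univ, true_and,
        Set.mem_iUnion, Set.mem_singleton_iff, exists_prop]
      constructor
      · rintro ⟨ht, j, rfl⟩; exact ⟨j, ht, rfl⟩
      · rintro ⟨j, hj, rfl⟩; exact ⟨hj, j, rfl⟩
    rw [hsplit, hunion, VectorMeasure.of_biUnion_finset, discreteMeasure_apply _ _ hs,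
      Finset.sum_filter]
    · intro i _ j _ hij
      simpa using fun hh => hij (h.injective hh)
    · intro i _
      exact measurableSet_singleton _
  rw [h1]
  congr 1
  have h2 : Phi f m' = ∑ j, m' {x j} • phi f (x j) := by
    conv_lhs => rw [h1]
    exact Phi_discreteMeasure f _ x
  have h3 : Phi f m' = ∑ j, β j • phi f (x j) := by
    rw [Phi_eq_muHat hlam hm, muHat_eq, sub_eq_iff_eq_add, add_comm]
    exact h.decomp
  have h4 := h.linearIndependent hlam (fun j => m' {x j} - β j) (by
    simp only [sub_smul, Finset.sum_sub_distrib]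
    rw [← h2, ← h3, sub_self])
  ext j
  exact sub_eq_zero.1 (congrFun h4 j)

/-- If `y` is interior to its stratum, no amplitude vanishes: adding a small positive multiple of
the sign pattern to the amplitudes does not move the certificate, and for a generic multiple it
leaves the stratum. -/
theorem amplitude_ne_zero (hlam : 0 < lam) (h : ContactData f lam y x σ β) {l : Fin m → ℕ}
    (hint : y ∈ interior (projQ f lam m σ {i | β i = 0} l)) (i₀ : Fin m) : β i₀ ≠ 0 := by
  classical
  intro hi₀
  obtain ⟨ξ, hξ⟩ := h.exists_dual hlam
  set p := pHat f lam y with hp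
  -- the solutions of the normal equations for all orderings of the atoms
  have hgram : ∀ π : Equiv.Perm (Fin m), ∃ c : Fin m → ℝ,
      ∀ k, ⟪phi f (x (π k)), ∑ j, c j • phi f (x (π j))⟫_ℝ
        = lam * σ k - ⟪phi f (x (π k)), p⟫_ℝ := fun π =>
    exists_gram_solution (x := fun k => x (π k)) (fun v hv => by
      have h1 : ∑ j, v (π.symm j) • phi f (x j) = 0 := by
        rw [← hv, ← Equiv.sum_comp π]
        simp
      have h2 := h.linearIndependent hlam _ h1
      ext j
      have := congrFun h2 (π j)
      simpa using this) _
  choose c hc using hgram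
  set bad : Set ℝ := ⋃ q : Equiv.Perm (Fin m) × Fin m,
    {t | β (q.1 q.2) + t * σ (q.1 q.2) = c q.1 q.2} with hbad
  have hbadfin : bad.Finite := by
    refine Set.finite_iUnion fun q => Set.Subsingleton.finite fun t ht t' ht' => ?_
    have h1 : t * σ (q.1 q.2) = t' * σ (q.1 q.2) := by
      have ht1 : β (q.1 q.2) + t * σ (q.1 q.2) = c q.1 q.2 := ht
      have ht2 : β (q.1 q.2) + t' * σ (q.1 q.2) = c q.1 q.2 := ht'
      linarith
    have h2 : σ (q.1 q.2) ≠ 0 := by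
      intro h0
      have := h.sign_mul_self (q.1 q.2)
      rw [h0] at this; simp at this
    exact mul_right_cancel₀ h2 h1
  set Y : ℝ → Obs f := fun t => y + t • ∑ j, σ j • phi f (x j) with hY
  have hYc : Continuous Y := by fun_prop
  have hY0 : Y 0 = y := by simp [hY]
  have hev : ∀ᶠ t in 𝓝 (0 : ℝ), Y t ∈ projQ f lam m σ {i | β i = 0} l := by
    refine hYc.continuousAt.eventually ?_
    rw [hY0]
    exact mem_interior_iff_mem_nhds.1 hint
  obtain ⟨ε, hε, hball⟩ := Metric.eventually_nhds_iff_ball.1 hev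
  obtain ⟨t, ht, htbad⟩ := ((Set.Ioo_infinite hε).sdiff hbadfin).nonempty
  have htmem := hball t (by simpa [abs_of_pos ht.1] using ht.2)
  set w : Fin m → ℝ := fun j => β j + t * σ j with hw
  have hYt : Y t = p + ∑ j, w j • phi f (x j) := by
    have h1 : ∑ j, w j • phi f (x j)
        = ∑ j, β j • phi f (x j) + t • ∑ j, σ j • phi f (x j) := by
      rw [Finset.smul_sum, ← Finset.sum_add_distrib]
      exact Finset.sum_congr rfl fun j _ => by rw [hw, add_smul, smul_smul]
    rw [h1, ← add_assoc, hp, ← h.decomp]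
  have hwσ : ∀ j, w j = (|β j| + t) * σ j := fun j => by
    have h1 := h.sign_mul_self j
    have h2 := h.amplitude j
    simp only [hw]
    rw [← h2]
    linear_combination (-β j) * h1
  have hwabs : ∀ j, |w j| = |β j| + t := fun j => by
    have h3 : |σ j| = 1 := by rcases h.sign j with h | h <;> simp [h]
    have : 0 ≤ |β j| + t := by have := ht.1; positivity
    rw [hwσ, abs_mul, h3, mul_one, abs_of_nonneg this]
  have hpt : pHat f lam (Y t) = p := by
    refine IsProj.eq_pHat hlam (isProj_of_atoms (isProj_pHat f hlam y).1 hYt fun j => ?_)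
    rw [h.value, hwabs, hwσ]
    linear_combination (lam * (|β j| + t)) * h.sign_mul_self j
  obtain ⟨x', β', hx', hy', hβ', hI, -⟩ := exists_of_mem_projQ hlam htmem
  rw [hpt] at hy' hβ' hI
  have hsum : ∑ j, β' j • phi f (x' j) = ∑ j, w j • phi f (x j) := by
    have := hYt.symm.trans hy'
    exact (add_left_cancel this).symm
  have hx'mem : ∀ j, β' j ≠ 0 → ∃ i, x i = x' j := fun j hj => by
    have h1 : x' j ∈ extSupport f lam (Y t) :=
      mem_extSupport_of_ne_zero hlam (by rw [hpt]; exact hβ' j) hj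
    rw [mem_extSupport_iff hlam, hpt, ← mem_extSupport_iff hlam, ← h.range_eq] at h1
    exact h1
  have hcoef : ∀ i, w i = ∑ j, if x' j = x i then β' j else 0 := by
    intro i
    rw [← inner_sum_dual (hξ i) w, ← hsum, sum_inner]
    refine Finset.sum_congr rfl fun j _ => ?_
    rw [inner_smul_left, conj_trivial]
    by_cases hj : β' j = 0
    · simp [hj]
    · obtain ⟨k, hk⟩ := hx'mem j hj
      rw [← hk, hξ i k]
      by_cases hki : k = i
      · simp [hki]
      · rw [if_neg hki, if_neg fun hh => hki (h.injective hh), mul_zero]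
  have hw0 : ∀ i, w i ≠ 0 := fun i h0 => by
    have h1 := hwabs i
    rw [h0, abs_zero] at h1
    have := ht.1
    have := abs_nonneg (β i)
    linarith
  have hex : ∀ i, ∃ j, x' j = x i := by
    intro i
    by_contra hno
    push Not at hno
    refine hw0 i ?_
    rw [hcoef i]
    exact Finset.sum_eq_zero fun j _ => if_neg (hno j)
  choose τ hτ using hex
  have hτinj : Function.Injective τ := fun i k hik => h.injective (by rw [← hτ i, ← hτ k, hik])
  set π := Equiv.ofBijective τ (Finite.injective_iff_bijective.1 hτinj) with hπ
  have hx'π : ∀ j, x' j = x (π.symm j) := fun j => by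
    have := hτ (π.symm j)
    rw [← this]
    congr 1
    exact (π.apply_symm_apply j).symm
  have hβ'π : ∀ j, β' j = w (π.symm j) := fun j => by
    rw [hcoef, Finset.sum_eq_single j]
    · rw [if_pos (hx'π j)]
    · intro k _ hk
      rw [if_neg]
      rw [← hx'π j]
      exact fun hh => hk (hx' hh)
    · simp
  have hfinal := hI (c π.symm) (fun k => by
    simp only [hx'π]
    exact hc π.symm k) i₀ hi₀
  rw [hβ'π] at hfinal
  exact htbad (Set.mem_iUnion.2 ⟨(π.symm, i₀), hfinal⟩)

end ContactData

/-! ### Stability of the extended support -/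

theorem continuous_pHat (f : ℕ) {lam : ℝ} (hlam : 0 < lam) : Continuous (pHat f lam) := by
  refine LipschitzWith.continuous (K := 1) (LipschitzWith.of_dist_le_mul fun y y' => ?_)
  rw [NNReal.coe_one, one_mul, dist_eq_norm, dist_eq_norm]
  exact (isProj_pHat f hlam y').norm_sub_le (isProj_pHat f hlam y)

/-- Near `y` the extended support stays in a neighbourhood of the extended support of `y`. -/
theorem eventually_extSupport_subset {f : ℕ} {lam : ℝ} (hlam : 0 < lam) {y : Obs f} {U : Set Torus}
    (hU : IsOpen U) (h : extSupport f lam y ⊆ U) : ∀ᶠ y' in 𝓝 y, extSupport f lam y' ⊆ U := by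
  have hK : IsCompact Uᶜ := hU.isClosed_compl.isCompact
  have h1 : ∀ t ∈ Uᶜ, ∀ᶠ q : Obs f × Torus in 𝓝 y ×ˢ 𝓝 t,
      |⟪phi f q.2, pHat f lam q.1⟫_ℝ| ≠ lam := by
    intro t ht
    rw [← nhds_prod_eq]
    have hc : Continuous fun q : Obs f × Torus => |⟪phi f q.2, pHat f lam q.1⟫_ℝ| :=
      (((continuous_phi f).comp continuous_snd).inner
        ((continuous_pHat f hlam).comp continuous_fst)).abs
    exact hc.continuousAt.eventually_ne fun hh => ht (h ((mem_extSupport_iff hlam).2 hh))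
  have h2 := hK.eventually_forall_of_forall_eventually (P := fun y' t =>
    |⟪phi f t, pHat f lam y'⟫_ℝ| ≠ lam) (x₀ := y) fun t ht => by
      rw [nhds_prod_eq]; exact h1 t ht
  filter_upwards [h2] with y' hy' t ht
  by_contra hne
  exact hy' t hne ((mem_extSupport_iff hlam).1 ht)

theorem exists_pos_forall_le {ι : Type*} [Finite ι] {r : ι → ℝ} (hr : ∀ i, 0 < r i) :
    ∃ e : ℝ, 0 < e ∧ ∀ i, e ≤ r i := by
  obtain ⟨M, hM⟩ := Finite.exists_le (fun i => (⟨(r i)⁻¹, inv_pos.2 (hr i)⟩ : Set.Ioi (0 : ℝ)))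
  exact ⟨(M : ℝ)⁻¹, inv_pos.2 M.2, fun i => inv_le_of_inv_le₀ (hr i) (hM i)⟩

theorem exists_lift_near {t : Torus} {X r : ℝ} (h : dist t (X : Torus) < r) :
    ∃ s : ℝ, (s : Torus) = t ∧ |s - X| < r := by
  obtain ⟨u, rfl⟩ := QuotientAddGroup.mk_surjective t
  refine ⟨u - round (u - X), ?_, ?_⟩
  · have h0 : ((u - round (u - X) : ℝ) : Torus) = (u : Torus) - ((round (u - X) : ℝ) : Torus) := rfl
    have h1 : ((round (u - X) : ℝ) : Torus) = 0 :=
      (AddCircle.coe_eq_zero_iff 1).2 ⟨round (u - X), by simp⟩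
    rw [h0, h1, sub_zero]
  · rw [dist_eq_norm] at h
    have h1 : ‖((u - X : ℝ) : Torus)‖ < r := h
    rw [UnitAddCircle.norm_eq] at h1
    convert h1 using 2
    ring

theorem dist_coe_lt {s X r : ℝ} (h : |s - X| < r) : dist (s : Torus) (X : Torus) < r := by
  rw [dist_eq_norm]
  have h1 : ‖((s - X : ℝ) : Torus)‖ ≤ |s - X| := by
    rw [UnitAddCircle.norm_eq]
    have := round_le (s - X) 0
    simpa using this
  exact h1.trans_lt h

theorem abs_sub_lt_of_dist_lt {s X r : ℝ} (h : dist (s : Torus) (X : Torus) < r)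
    (h' : |s - X| ≤ 1 / 2) : |s - X| < r := by
  rw [dist_eq_norm] at h
  have h1 : ‖((s - X : ℝ) : Torus)‖ < r := h
  rwa [(AddCircle.norm_coe_eq_abs_iff 1 one_ne_zero).2 (by simpa using h')] at h1

namespace ContactData

variable {f : ℕ} {lam : ℝ} {y : Obs f} {m : ℕ} {x : Fin m → Torus} {σ β : Fin m → ℝ}

theorem eventually_near (hlam : 0 < lam) (h : ContactData f lam y x σ β) {r : ℝ} (hr : 0 < r) :
    ∀ᶠ y' in 𝓝 y, ∀ t ∈ extSupport f lam y', ∃ i, dist t (x i) < r := by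
  have hU : IsOpen (⋃ i, Metric.ball (x i) r) := isOpen_iUnion fun i => Metric.isOpen_ball
  have hsub : extSupport f lam y ⊆ ⋃ i, Metric.ball (x i) r := by
    rw [← h.range_eq]
    rintro _ ⟨i, rfl⟩
    exact Set.mem_iUnion.2 ⟨i, Metric.mem_ball_self hr⟩
  filter_upwards [eventually_extSupport_subset hlam hU hsub] with y' hy' t ht
  obtain ⟨i, hi⟩ := Set.mem_iUnion.1 (hy' ht)
  exact ⟨i, hi⟩

theorem exists_separation (h : ContactData f lam y x σ β) :
    ∃ r₀ : ℝ, 0 < r₀ ∧ r₀ ≤ 1 / 4 ∧ ∀ i k, i ≠ k → 2 * r₀ ≤ dist (x i) (x k) := by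
  have h1 : ∀ q : Fin m × Fin m, ∃ r : ℝ, 0 < r ∧ (q.1 ≠ q.2 → r ≤ dist (x q.1) (x q.2)) := by
    intro q
    by_cases hq : q.1 = q.2
    · exact ⟨1, one_pos, fun hh => absurd hq hh⟩
    · exact ⟨dist (x q.1) (x q.2), dist_pos.2 fun hh => hq (h.injective hh), fun _ => le_rfl⟩
  choose r hr hr' using h1
  obtain ⟨e, he, he'⟩ := exists_pos_forall_le hr
  refine ⟨min (1 / 4) (e / 2), lt_min (by norm_num) (by linarith), min_le_left _ _, ?_⟩
  intro i k hik
  have h2 := hr' (i, k) hik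
  have h3 := he' (i, k)
  have h4 := min_le_right (1 / 4 : ℝ) (e / 2)
  simp only at h2
  linarith

theorem unique_near {r₀ r r' : ℝ} (hsep : ∀ i k, i ≠ k → 2 * r₀ ≤ dist (x i) (x k)) (hr : r ≤ r₀)
    (hr' : r' ≤ r₀) {t : Torus} {i k : Fin m} (hi : dist t (x i) < r) (hk : dist t (x k) < r') :
    i = k := by
  by_contra hne
  have h1 := hsep i k hne
  have h2 := dist_triangle_left (x i) (x k) t
  linarith

/-- Near `y` every solution charges a neighbourhood of every point of the extended support whose
amplitude does not vanish. Otherwise its pairing with a vector dual to this point would be small,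
as the mass of the solution is bounded; but the pairing is close to the amplitude. -/
theorem eventually_charges (hlam : 0 < lam) (h : ContactData f lam y x σ β) {r : ℝ} (hr : 0 < r)
    {i : Fin m} (hβ : β i ≠ 0) :
    ∀ᶠ y' in 𝓝 y, ∀ (N : ℕ) (b : Fin N → ℝ) (t : Fin N → Torus),
      y' = pHat f lam y' + ∑ j, b j • phi f (t j) →
      (∀ j, b j * ⟪phi f (t j), pHat f lam y'⟫_ℝ = lam * |b j|) →
      ∃ j, b j ≠ 0 ∧ dist (t j) (x i) < r := by
  obtain ⟨ξ, hξ⟩ := h.exists_dual hlam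
  set B := ⟪y - pHat f lam y, pHat f lam y⟫_ℝ / lam + 1 with hB
  have hc1 : Continuous fun y' => ⟪y' - pHat f lam y', pHat f lam y'⟫_ℝ / lam :=
    ((continuous_id.sub (continuous_pHat f hlam)).inner (continuous_pHat f hlam)).div_const _
  have hc2 : Continuous fun y' => |⟪y' - pHat f lam y', ξ i⟫_ℝ| :=
    ((continuous_id.sub (continuous_pHat f hlam)).inner continuous_const).abs
  have hval : ⟪y - pHat f lam y, ξ i⟫_ℝ = β i := by
    have : y - pHat f lam y = ∑ j, β j • phi f (x j) := by
      rw [sub_eq_iff_eq_add, add_comm]; exact h.decomp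
    rw [this, inner_sum_dual (hξ i)]
  have hmass : ∀ (y' : Obs f) (N : ℕ) (b : Fin N → ℝ) (t : Fin N → Torus),
      y' = pHat f lam y' + ∑ j, b j • phi f (t j) →
      (∀ j, b j * ⟪phi f (t j), pHat f lam y'⟫_ℝ = lam * |b j|) →
      ∑ j, |b j| = ⟪y' - pHat f lam y', pHat f lam y'⟫_ℝ / lam := by
    intro y' N b t hy' hb
    have h1 : y' - pHat f lam y' = ∑ j, b j • phi f (t j) := by
      rw [sub_eq_iff_eq_add, add_comm]; exact hy'
    rw [h1, sum_inner]
    simp only [inner_smul_left, conj_trivial, hb]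
    rw [← Finset.mul_sum, mul_div_cancel_left₀ _ hlam.ne']
  have hB0 : 0 < B := by
    obtain h1 := hmass y m β x h.decomp h.saturated
    rw [hB, ← h1]
    have := Finset.sum_nonneg fun j (_ : j ∈ Finset.univ) => abs_nonneg (β j)
    linarith
  set ε := |β i| / (2 * B) with hε
  have hβ0 : 0 < |β i| := abs_pos.2 hβ
  have hε0 : 0 < ε := by positivity
  -- the dual vector is small near the other points of the extended support
  obtain ⟨r', hr', hsmall⟩ : ∃ r' > 0, r' ≤ r ∧ ∀ k, k ≠ i → ∀ t, dist t (x k) < r' →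
      |⟪phi f t, ξ i⟫_ℝ| < ε := by
    have hev : ∀ k, k ≠ i → ∀ᶠ t in 𝓝 (x k), |⟪phi f t, ξ i⟫_ℝ| < ε := by
      intro k hk
      have hc : Continuous fun t => |⟪phi f t, ξ i⟫_ℝ| :=
        ((continuous_phi f).inner continuous_const).abs
      refine hc.continuousAt.eventually_lt continuousAt_const ?_
      rw [hξ i k, if_neg hk, abs_zero]
      exact hε0
    have hex : ∀ k, ∃ r' : ℝ, 0 < r' ∧
        (k ≠ i → ∀ t, dist t (x k) < r' → |⟪phi f t, ξ i⟫_ℝ| < ε) := by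
      intro k
      by_cases hk : k = i
      · exact ⟨1, one_pos, fun hh => absurd hk hh⟩
      · obtain ⟨r', hr', h2⟩ := Metric.eventually_nhds_iff.1 (hev k hk)
        exact ⟨r', hr', fun _ t ht => h2 ht⟩
    choose ρ hρ hρ' using hex
    obtain ⟨e, he, he'⟩ := exists_pos_forall_le hρ
    exact ⟨min r e, lt_min hr he, min_le_left _ _, fun k hk t ht =>
      hρ' k hk t (ht.trans_le ((min_le_right _ _).trans (he' k)))⟩
  have e1 : ∀ᶠ y' in 𝓝 y, ⟪y' - pHat f lam y', pHat f lam y'⟫_ℝ / lam < B :=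
    hc1.continuousAt.eventually_lt continuousAt_const (by rw [hB]; linarith)
  have e2 : ∀ᶠ y' in 𝓝 y, |β i| / 2 < |⟪y' - pHat f lam y', ξ i⟫_ℝ| :=
    continuousAt_const.eventually_lt hc2.continuousAt (by rw [hval]; linarith)
  filter_upwards [e1, e2, h.eventually_near hlam hr'] with y' h1 h2 h3 N b t hy' hb
  by_contra hno
  push Not at hno
  have h4 : y' - pHat f lam y' = ∑ j, b j • phi f (t j) := by
    rw [sub_eq_iff_eq_add, add_comm]; exact hy'
  have h5 : |⟪y' - pHat f lam y', ξ i⟫_ℝ| ≤ ∑ j, |b j| * ε := by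
    rw [h4, sum_inner]
    refine (Finset.abs_sum_le_sum_abs _ _).trans (Finset.sum_le_sum fun j _ => ?_)
    rw [inner_smul_left, conj_trivial, abs_mul]
    by_cases hj : b j = 0
    · simp [hj]
    · obtain ⟨k, hk⟩ := h3 (t j) (mem_extSupport_of_ne_zero hlam (hb j) hj)
      have hki : k ≠ i := by
        rintro rfl
        exact absurd (hno j hj) (not_le.2 (hk.trans_le hsmall.1))
      gcongr
      exact (hsmall.2 k hki _ hk).le
  rw [← Finset.sum_mul, hmass y' N b t hy' hb] at h5
  have h6 : ⟪y' - pHat f lam y', pHat f lam y'⟫_ℝ / lam * ε ≤ B * ε :=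
    mul_le_mul_of_nonneg_right h1.le hε0.le
  have h7 : B * ε = |β i| / 2 := by rw [hε]; field_simp
  linarith

/-- Atoms of solutions for observations tending to `y`, one near each contact of `y`, form a
`ContactFamily`: they converge to the contacts, and the signs of the certificate persist. -/
theorem contactFamily (hlam : 0 < lam) {X : Fin m → ℝ}
    (h : ContactData f lam y (fun i => (X i : Torus)) σ β) (hβ : ∀ i, β i ≠ 0) {r₀ : ℝ}
    (hr₀ : r₀ ≤ 1 / 4)
    (hsep : ∀ i k, i ≠ k → 2 * r₀ ≤ dist (X i : Torus) (X k : Torus)) {α : Type*} {l : Filter α}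
    {Y : α → Obs f} (hY : Tendsto Y l (𝓝 y)) {s b : Fin m → α → ℝ}
    (hgood : ∀ᶠ a in l, (∀ i, |s i a - X i| < r₀) ∧
      Y a = pHat f lam (Y a) + ∑ i, b i a • psi f (s i a) ∧
      ∀ i, (s i a : Torus) ∈ extSupport f lam (Y a)) :
    ContactFamily l (pHat f lam y) X β (fun a => Y a - y)
      (fun a => pHat f lam (Y a) - pHat f lam y) s b := by
  have hs : ∀ i, Tendsto (s i) l (𝓝 (X i)) := by
    intro i
    rw [Metric.tendsto_nhds]
    intro r hr
    by_cases hr0 : 0 < r₀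
    · have h2 := hY.eventually (h.eventually_near hlam (lt_min hr hr0))
      filter_upwards [hgood, h2] with a ⟨ha1, _, ha3⟩ ha
      obtain ⟨k, hk⟩ := ha _ (ha3 i)
      have hik : i = k := unique_near hsep le_rfl (min_le_right r r₀) (dist_coe_lt (ha1 i)) hk
      subst hik
      rw [Real.dist_eq]
      exact abs_sub_lt_of_dist_lt (hk.trans_le (min_le_left _ _)) (by linarith [ha1 i])
    · filter_upwards [hgood] with a ha
      have ha1 := ha.1
      have := (abs_nonneg _).trans_lt (ha1 i)
      exact absurd this hr0
  have hp : Tendsto (fun a => pHat f lam (Y a)) l (𝓝 (pHat f lam y)) :=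
    (continuous_pHat f hlam).continuousAt.tendsto.comp hY
  have hbase : ∀ i, ⟪dOp f (psi f (X i)), pHat f lam y⟫_ℝ = 0 := fun i =>
    (contact_deriv (isProj_pHat f hlam y).1 (h.sign i) (h.value i)).1
  have hvalue : ∀ i, ∀ᶠ a in l, ⟪psi f (s i a), pHat f lam (Y a)⟫_ℝ = lam * σ i := by
    intro i
    have hlim : Tendsto (fun a => σ i * ⟪psi f (s i a), pHat f lam (Y a)⟫_ℝ) l (𝓝 lam) := by
      have h1 : Tendsto (fun a => psi f (s i a)) l (𝓝 (psi f (X i))) :=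
        ((continuous_psi f).tendsto (X i)).comp (hs i)
      have h2 := (h1.inner hp).const_mul (σ i)
      have h3 : σ i * ⟪psi f (X i), pHat f lam y⟫_ℝ = lam := by
        have h4 : ⟪psi f (X i), pHat f lam y⟫_ℝ = lam * σ i := h.value i
        rw [h4]
        linear_combination lam * h.sign_mul_self i
      rwa [h3] at h2
    filter_upwards [hgood, hlim.eventually (lt_mem_nhds hlam)] with a ⟨_, _, ha⟩ hpos
    have h1 := (mem_extSupport_iff hlam).1 (ha i)
    have h2 : |⟪psi f (s i a), pHat f lam (Y a)⟫_ℝ| = lam := h1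
    rcases (abs_eq hlam.le).1 h2 with h3 | h3 <;> rcases h.sign i with h4 | h4 <;>
      rw [h3, h4] at hpos ⊢ <;> linarith
  refine ⟨hbase, hβ, ?_, ?_, hs, ?_, fun i => ?_, fun i => ?_⟩
  · simpa using hY.sub_const y
  · refine IsBigO.of_bound 1 (Eventually.of_forall fun a => ?_)
    rw [one_mul]
    exact (isProj_pHat f hlam y).norm_sub_le (isProj_pHat f hlam (Y a))
  · filter_upwards [hgood] with a ⟨_, ha, _⟩
    have h1 : y = pHat f lam y + ∑ i, β i • psi f (X i) := h.decomp
    have h2 : Y a - y = (pHat f lam (Y a) + ∑ i, b i a • psi f (s i a))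
        - (pHat f lam y + ∑ i, β i • psi f (X i)) := by rw [← ha, ← h1]
    rw [h2]
    abel
  · filter_upwards [hvalue i] with a ha
    rw [add_sub_cancel, ha]
    exact (h.value i).symm
  · filter_upwards [hvalue i] with a ha
    rw [add_sub_cancel]
    exact (contact_deriv (isProj_pHat f hlam (Y a)).1 (h.sign i) (x := (s i a : Torus)) ha).1

/-- Dual vectors for the values at the contacts and the derivatives at the degenerate contacts;
they exist because a degenerate contact is a triple zero of the derivative of the certificate. -/
theorem exists_dualVectors (hlam : 0 < lam) {X : Fin m → ℝ}
    (h : ContactData f lam y (fun i => (X i : Torus)) σ β) :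
    ∃ ξ ζ, DualVectors (pHat f lam y) X ξ ζ := by
  classical
  set μ : Fin m → ℕ := fun i =>
    if ⟪(dOp f ^ 2) (psi f (X i)), pHat f lam y⟫_ℝ = 0 then 3 else 1 with hμ
  have hsum : ∑ i, μ i ≤ 2 * f + 1 := by
    refine (h.sum_mult_le hlam μ fun i => ?_).trans (Nat.le_succ _)
    by_cases hi : ⟪(dOp f ^ 2) (psi f (X i)), pHat f lam y⟫_ℝ = 0
    · exact Or.inr ⟨if_pos hi, hi⟩
    · exact Or.inl (if_neg hi)
  have hμ0 : ∀ i, 0 < μ i := fun i => by simp only [hμ]; split_ifs <;> norm_num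
  have hμ1 : ∀ i, ⟪(dOp f ^ 2) (psi f (X i)), pHat f lam y⟫_ℝ = 0 → 1 < μ i := fun i hi => by
    simp only [hμ, if_pos hi]; norm_num
  have h1 := fun i => exists_hermite (f := f) h.injective μ hsum
    (fun k j => if j = 0 then (if k = i then 1 else 0) else 0)
  have h2 := fun i => exists_hermite (f := f) h.injective μ hsum
    (fun k j => if j = 0 then 0 else (if k = i then 1 else 0))
  choose ξ hξ using h1
  choose ζ hζ using h2
  refine ⟨ξ, ζ, fun i k => ?_, fun i k hk => ?_, fun i k => ?_, fun i k hk => ?_⟩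
  · simpa [psi] using hξ i k 0 (hμ0 k)
  · simpa [psi] using hξ i k 1 (hμ1 k hk)
  · simpa [psi] using hζ i k 0 (hμ0 k)
  · simpa [psi] using hζ i k 1 (hμ1 k hk)

end ContactData

/-! ### Nondegeneracy of the contacts in the interior of a stratum -/

namespace ContactData

variable {f : ℕ} {lam : ℝ} {y : Obs f} {m : ℕ} {X σ β : Fin m → ℝ}

/-- Near `y`, a solution with as many atoms as contacts has exactly one atom near each contact. -/
theorem eventually_exists_perm (hlam : 0 < lam)
    (h : ContactData f lam y (fun i => (X i : Torus)) σ β) (hβ : ∀ i, β i ≠ 0) {r₀ : ℝ}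
    (hr₀ : 0 < r₀) (hsep : ∀ i k, i ≠ k → 2 * r₀ ≤ dist (X i : Torus) (X k : Torus)) :
    ∀ᶠ y' in 𝓝 y, ∀ (b : Fin m → ℝ) (t : Fin m → Torus),
      y' = pHat f lam y' + ∑ j, b j • phi f (t j) →
      (∀ j, b j * ⟪phi f (t j), pHat f lam y'⟫_ℝ = lam * |b j|) →
      ∃ (π : Equiv.Perm (Fin m)) (s : Fin m → ℝ), (∀ i, |s i - X i| < r₀) ∧
        (∀ i, (s i : Torus) = t (π i)) ∧ ∀ i, t (π i) ∈ extSupport f lam y' := by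
  filter_upwards [eventually_all.2 fun i => h.eventually_charges hlam hr₀ (hβ i)]
    with y' hy' b t hd hb
  choose τ hτ0 hτ using fun i => hy' i m b t hd hb
  have hinj : Function.Injective τ := fun i k hik => by
    have h1 := hτ i
    rw [hik] at h1
    exact unique_near hsep le_rfl le_rfl h1 (hτ k)
  choose s hs hs' using fun i => exists_lift_near (hτ i)
  exact ⟨Equiv.ofBijective τ (Finite.injective_iff_bijective.1 hinj), s, hs', hs,
    fun i => mem_extSupport_of_ne_zero hlam (hb (τ i)) (hτ0 i)⟩

theorem curvature_nonneg (h : ContactData f lam y (fun i => (X i : Torus)) σ β)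
    (hlam : 0 < lam) (i : Fin m) :
    0 ≤ -(⟪(dOp f ^ 2) (psi f (X i)), pHat f lam y⟫_ℝ / β i) := by
  have h1 := (contact_deriv (isProj_pHat f hlam y).1 (h.sign i) (h.value i)).2.1
  have h2 := h.amplitude i
  have h4 : ⟪(dOp f ^ 2) (phi f (X i)), pHat f lam y⟫_ℝ / β i
      = (σ i * ⟪(dOp f ^ 2) (phi f (X i)), pHat f lam y⟫_ℝ) / |β i| := by
    rw [← h2]
    rcases h.sign i with hs | hs <;> rw [hs] <;> ring
  change 0 ≤ -(⟪(dOp f ^ 2) (phi f (X i)), pHat f lam y⟫_ℝ / β i)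
  rw [h4, neg_nonneg]
  exact div_nonpos_of_nonpos_of_nonneg h1 (abs_nonneg _)

/-- If `y` is interior to a stratum which prescribes degenerate contacts wherever `y` has them, then
`y` has no degenerate contact: otherwise there is a direction in which, to first order, the second
derivative of the certificate grows at all degenerate contacts. -/
theorem second_deriv_ne_zero (hlam : 0 < lam)
    (h : ContactData f lam y (fun i => (X i : Torus)) σ β) (hβ : ∀ i, β i ≠ 0) {I : Set (Fin m)}
    {l : Fin m → ℕ} (hl : ∀ i, ⟪(dOp f ^ 2) (psi f (X i)), pHat f lam y⟫_ℝ = 0 → 2 ≤ l i)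
    (hint : y ∈ interior (projQ f lam m σ I l)) (i₀ : Fin m) :
    ⟪(dOp f ^ 2) (psi f (X i₀)), pHat f lam y⟫_ℝ ≠ 0 := by
  classical
  intro hi₀
  set p := pHat f lam y with hp
  set c : Fin m → ℝ := fun i => ⟪(dOp f ^ 2) (psi f (X i)), p⟫_ℝ with hc
  obtain ⟨r₀, hr₀, hr₀', hsep⟩ := h.exists_separation
  obtain ⟨ξ, ζ, hd⟩ := h.exists_dualVectors hlam
  obtain ⟨q₀, hq₀⟩ : ∃ q₀ : Obs f, (∀ i, ⟪psi f (X i), q₀⟫_ℝ = 0) ∧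
      ∀ i, c i = 0 → ⟪dOp f (psi f (X i)), q₀⟫_ℝ = 0 ∧ ⟪(dOp f ^ 2) (psi f (X i)), q₀⟫_ℝ = 1 := by
    have hsum : ∑ i, (if c i = 0 then 3 else 1) ≤ 2 * f + 1 := by
      refine (h.sum_mult_le hlam _ fun i => ?_).trans (Nat.le_succ _)
      by_cases hi : c i = 0
      · exact Or.inr ⟨if_pos hi, hi⟩
      · exact Or.inl (if_neg hi)
    obtain ⟨q, hq⟩ := exists_hermite (f := f) h.injective _ hsum fun _ j => if j = 2 then 1 else 0
    refine ⟨q, fun i => ?_, fun i hi => ⟨?_, ?_⟩⟩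
    · simpa [psi] using hq i 0 (by split_ifs <;> norm_num)
    · simpa [psi] using hq i 1 (by rw [if_pos hi]; norm_num)
    · simpa [psi] using hq i 2 (by rw [if_pos hi]; norm_num)
  -- at a degenerate contact the quotient is `0 / 0 = 0`
  set γ : Fin m → ℝ := fun i => ⟪dOp f (psi f (X i)), q₀⟫_ℝ / -(c i / β i) with hγ
  have hγc : ∀ i, -(c i / β i) * γ i = ⟪dOp f (psi f (X i)), q₀⟫_ℝ := fun i => by
    by_cases hi : c i = 0
    · rw [(hq₀.2 i hi).1, hi]; simp
    · exact mul_div_cancel₀ _ (neg_ne_zero.2 (div_ne_zero hi (hβ i)))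
  -- in the direction `v₀` the linearized system has the solution `q₀`
  set v₀ : Obs f := q₀ + ∑ i, γ i • dOp f (psi f (X i)) with hv₀
  set Y : ℝ → Obs f := fun ε => y + ε • v₀ with hYdef
  have hY : Tendsto Y (𝓝[>] 0) (𝓝 y) := by
    have h1 : Continuous Y := by fun_prop
    have h2 : Tendsto Y (𝓝 0) (𝓝 y) := by
      have := h1.tendsto 0
      simpa [hYdef] using this
    exact h2.mono_left nhdsWithin_le_nhds
  have hVε : (fun ε => Y ε - y) =O[𝓝[>] 0] fun ε : ℝ => ε := by
    refine IsBigO.of_bound ‖v₀‖ (Eventually.of_forall fun ε => ?_)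
    simp [hYdef, norm_smul, mul_comm]
  have hex : ∀ᶠ ε in 𝓝[>] (0 : ℝ), ∃ sb : (Fin m → ℝ) × (Fin m → ℝ),
      ((∀ i, |sb.1 i - X i| < r₀) ∧ Y ε = pHat f lam (Y ε) + ∑ i, sb.2 i • psi f (sb.1 i) ∧
        ∀ i, (sb.1 i : Torus) ∈ extSupport f lam (Y ε)) ∧
      ∃ i, ⟪(dOp f ^ 2) (psi f (sb.1 i)), pHat f lam (Y ε)⟫_ℝ = 0 := by
    filter_upwards [hY.eventually (mem_interior_iff_mem_nhds.1 hint),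
      hY.eventually (h.eventually_exists_perm hlam hβ hr₀ hsep)] with ε h1 h2
    obtain ⟨t, b, -, hdec, hsat, -, hdeg⟩ := exists_of_mem_projQ hlam h1
    obtain ⟨π, s, hs1, hs2, hs3⟩ := h2 b t hdec hsat
    refine ⟨(s, fun i => b (π i)), ⟨hs1, ?_, fun i => ?_⟩, π.symm i₀, ?_⟩
    · have h3 : ∑ i, b (π i) • psi f (s i) = ∑ j, b j • phi f (t j) := by
        rw [← Equiv.sum_comp π fun j => b j • phi f (t j)]
        exact Finset.sum_congr rfl fun i _ => by rw [psi, hs2]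
      rw [h3]
      exact hdec
    · rw [hs2]; exact hs3 i
    · rw [psi, hs2, π.apply_symm_apply]
      exact hdeg i₀ (hl i₀ hi₀)
  obtain ⟨sb, hsb⟩ := hex.choice
  set s : Fin m → ℝ → ℝ := fun i ε => (sb ε).1 i with hs
  set b : Fin m → ℝ → ℝ := fun i ε => (sb ε).2 i with hb
  have hF : ContactFamily (𝓝[>] 0) p X β (fun ε => Y ε - y) (fun ε => pHat f lam (Y ε) - p) s b :=
    h.contactFamily hlam hβ hr₀' hsep hY (hsb.mono fun ε hε => hε.1)
  have hεV : (fun ε : ℝ => ε) =O[𝓝[>] 0] fun ε => Y ε - y := by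
    have h1 : v₀ ≠ 0 := by
      intro h0
      have h2 : ‖q₀‖ ^ 2 + ∑ i, γ i * ⟪dOp f (psi f (X i)), q₀⟫_ℝ = 0 := by
        rw [← real_inner_self_eq_norm_sq]
        have : ⟪v₀, q₀⟫_ℝ = 0 := by rw [h0, inner_zero_left]
        rw [hv₀, inner_add_left, sum_inner] at this
        simpa [inner_smul_left] using this
      have h3 : 0 ≤ ∑ i, γ i * ⟪dOp f (psi f (X i)), q₀⟫_ℝ := Finset.sum_nonneg fun i _ => by
        rw [← hγc]
        have := mul_nonneg (h.curvature_nonneg hlam i) (mul_self_nonneg (γ i))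
        linarith
      have h4 : ‖q₀‖ = 0 := by
        have := sq_nonneg ‖q₀‖
        exact pow_eq_zero_iff two_ne_zero |>.1 (by linarith)
      have h5 := (hq₀.2 i₀ hi₀).2
      rw [norm_eq_zero.1 h4, inner_zero_right] at h5
      exact zero_ne_one h5
    refine IsBigO.of_bound ‖v₀‖⁻¹ (Eventually.of_forall fun ε => ?_)
    have : ‖v₀‖ ≠ 0 := norm_ne_zero_iff.2 h1
    simp only [hYdef, add_sub_cancel_left, norm_smul]
    field_simp
    exact le_rfl
  have hD : (fun ε => (pHat f lam (Y ε) - p) - ε • q₀) =o[𝓝[>] 0] fun ε : ℝ => ε := by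
    refine (hF.sub_isLittleO_of_linearized hd (fun i => h.curvature_nonneg hlam i)
      (q := fun ε => ε • q₀) (κ := fun _ _ => 0) (γ := fun i ε => ε * γ i)
      ?_ ?_ ?_ ?_ ?_ ?_).trans_isBigO hVε
    · refine IsBigO.trans (IsBigO.of_bound ‖q₀‖ (Eventually.of_forall fun ε => ?_)) hεV
      rw [norm_smul, mul_comm]
    · exact fun i => isBigO_zero _ _
    · refine fun i => IsBigO.trans (IsBigO.of_bound ‖γ i‖ (Eventually.of_forall fun ε => ?_)) hεV
      rw [norm_mul, mul_comm]
    · intro ε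
      simp [hYdef, hv₀, Finset.smul_sum, smul_smul]
    · intro i ε
      rw [inner_smul_right, hq₀.1, mul_zero]
    · intro i ε
      rw [inner_smul_right, ← hγc]
      ring
  have hne : ∀ i, ∀ᶠ ε in 𝓝[>] (0 : ℝ),
      ⟪(dOp f ^ 2) (psi f (s i ε)), pHat f lam (Y ε)⟫_ℝ ≠ 0 := by
    intro i
    by_cases hi : c i = 0
    · have h3 := (contact_deriv (isProj_pHat f hlam y).1 (h.sign i) (h.value i)).2.2 hi
      have h4 : (fun ε => ⟪(dOp f ^ 2) (psi f (s i ε)), pHat f lam (Y ε)⟫_ℝ - ε)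
          =o[𝓝[>] 0] fun ε : ℝ => ε := by
        have h5 := (hF.second_deriv_expand hd i).trans_isBigO hVε
        have h6 := ContactFamily.inner_const_isLittleO hD ((dOp f ^ 2) (psi f (X i)))
        refine (h5.add h6).congr_left fun ε => ?_
        have h7 : ⟪(dOp f ^ 3) (psi f (X i)), p⟫_ℝ = 0 := h3
        have h8 : ⟪(dOp f ^ 2) (psi f (X i)), p⟫_ℝ = 0 := hi
        rw [h7, h8, add_sub_cancel, inner_sub_left, inner_smul_left,
          real_inner_comm ((dOp f ^ 2) (psi f (X i))) q₀, (hq₀.2 i hi).2,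
          real_inner_comm ((dOp f ^ 2) (psi f (X i))) (pHat f lam (Y ε) - p)]
        simp
      filter_upwards [h4.bound (by norm_num : (0 : ℝ) < 1 / 2), self_mem_nhdsWithin] with ε h5 h6 h7
      rw [h7, zero_sub, norm_neg, Real.norm_of_nonneg (le_of_lt h6)] at h5
      have : (0 : ℝ) < ε := h6
      linarith
    · have h1 : Tendsto (fun ε => ⟪(dOp f ^ 2) (psi f (s i ε)), pHat f lam (Y ε)⟫_ℝ) (𝓝[>] 0)
          (𝓝 (c i)) := by
        have h2 : Tendsto (fun ε => (dOp f ^ 2) (psi f (s i ε))) (𝓝[>] 0)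
            (𝓝 ((dOp f ^ 2) (psi f (X i)))) :=
          (((dOp f ^ 2).continuous.comp (continuous_psi f)).tendsto (X i)).comp (hF.tendsto_s i)
        exact h2.inner (((continuous_pHat f hlam).tendsto y).comp hY)
      exact h1.eventually_ne hi
  obtain ⟨ε, h1, h2⟩ := (hsb.and (eventually_all.2 hne)).exists
  obtain ⟨i, hi⟩ := h1.2
  exact h2 i hi

/-! ### Differentiability at a nondegenerate finite support -/

/-- Near `y` the solution has exactly one atom near each atom of the solution at `y`. -/
theorem eventually_exists_atoms (hlam : 0 < lam)
    (h : ContactData f lam y (fun i => (X i : Torus)) σ β) (hβ : ∀ i, β i ≠ 0)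
    (hnd : ∀ i, ⟪(dOp f ^ 2) (psi f (X i)), pHat f lam y⟫_ℝ ≠ 0) {r₀ : ℝ} (hr₀ : 0 < r₀)
    (hsep : ∀ i k, i ≠ k → 2 * r₀ ≤ dist (X i : Torus) (X k : Torus)) :
    ∀ᶠ y' in 𝓝 y, ∃ sb : (Fin m → ℝ) × (Fin m → ℝ), (∀ i, |sb.1 i - X i| < r₀) ∧
      y' = pHat f lam y' + ∑ i, sb.2 i • psi f (sb.1 i) ∧
      ∀ i, (sb.1 i : Torus) ∈ extSupport f lam y' := by
  classical
  have hex : ∀ i, ∃ r : ℝ, 0 < r ∧ ∀ s p', |s - X i| < r → dist p' (pHat f lam y) < r →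
      ⟪(dOp f ^ 2) (psi f s), p'⟫_ℝ ≠ 0 := by
    intro i
    have hc : Continuous fun q : ℝ × Obs f => ⟪(dOp f ^ 2) (psi f q.1), q.2⟫_ℝ :=
      ((dOp f ^ 2).continuous.comp ((continuous_psi f).comp continuous_fst)).inner continuous_snd
    obtain ⟨r, hr, hr'⟩ := Metric.eventually_nhds_iff.1
      ((hc.continuousAt (x := (X i, pHat f lam y))).eventually_ne (hnd i))
    exact ⟨r, hr, fun s p' hs hp' => hr' (y := (s, p')) (by
      rw [Prod.dist_eq]; exact max_lt (by rwa [Real.dist_eq]) hp')⟩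
  choose ρ hρ hρ' using hex
  obtain ⟨e, he, he'⟩ := exists_pos_forall_le hρ
  set r := min r₀ e with hr
  have hr0 : 0 < r := lt_min hr₀ he
  have hclose : ∀ᶠ y' in 𝓝 y, dist (pHat f lam y') (pHat f lam y) < e :=
    (continuous_pHat f hlam).continuousAt.eventually (Metric.ball_mem_nhds _ he)
  filter_upwards [hclose, h.eventually_near hlam hr0,
    eventually_all.2 fun i => h.eventually_charges hlam hr0 (hβ i)] with y' h1 h2 h3
  have hderiv : ∀ s : ℝ, (s : Torus) ∈ extSupport f lam y' →
      ⟪dOp f (psi f s), pHat f lam y'⟫_ℝ = 0 := by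
    intro s hs
    rcases (abs_eq hlam.le).1 ((mem_extSupport_iff hlam).1 hs) with h4 | h4
    · exact (contact_deriv (isProj_pHat f hlam y').1 (Or.inl rfl) (by rw [h4, mul_one])).1
    · exact (contact_deriv (isProj_pHat f hlam y').1 (Or.inr rfl)
        (by rw [h4, mul_neg, mul_one])).1
  -- by Rolle's theorem there is only one contact near each contact of `y`
  have hrolle : ∀ i, ∀ s s' : ℝ, |s - X i| < r → |s' - X i| < r → s < s' →
      (s : Torus) ∈ extSupport f lam y' → (s' : Torus) ∈ extSupport f lam y' → False := by
    intro i s s' hs hs' hlt hm hm'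
    have hder : ∀ u, HasDerivAt (fun v => ⟪dOp f (psi f v), pHat f lam y'⟫_ℝ)
        ⟪(dOp f ^ 2) (psi f u), pHat f lam y'⟫_ℝ u := fun u => by
      have := hasDerivAt_inner_pow_dOp_psi f 1 (pHat f lam y') u
      simpa using this
    obtain ⟨u, hu, hu'⟩ := exists_hasDerivAt_eq_zero hlt
      (fun u _ => (hder u).continuousAt.continuousWithinAt)
      (by rw [hderiv s hm, hderiv s' hm']) fun u _ => hder u
    refine hρ' i u (pHat f lam y') ?_ (h1.trans_le (he' i)) hu'
    have hre : r ≤ ρ i := (min_le_right _ _).trans (he' i)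
    rw [abs_lt] at hs hs' ⊢
    constructor <;> linarith [hu.1, hu.2]
  obtain ⟨N, b, t, hy', hb⟩ := (isProj_pHat f hlam y').exists_atoms hlam
  choose τ hτ0 hτ using fun i => h3 i N b t hy' hb
  choose s hs hs' using fun i => exists_lift_near (hτ i)
  have hmem : ∀ j, b j ≠ 0 → t j ∈ extSupport f lam y' := fun j hj =>
    mem_extSupport_of_ne_zero hlam (hb j) hj
  have hsmem : ∀ i, (s i : Torus) ∈ extSupport f lam y' := fun i => by
    rw [hs]; exact hmem _ (hτ0 i)
  have hinj : ∀ i k, (s i : Torus) = s k → i = k := fun i k hik =>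
    unique_near hsep (min_le_left _ _) (min_le_left _ _) (dist_coe_lt (hs' i))
      (hik ▸ dist_coe_lt (hs' k))
  have hcover : ∀ j, b j ≠ 0 → ∃ i, t j = (s i : Torus) := by
    intro j hj
    obtain ⟨i, hi⟩ := h2 _ (hmem j hj)
    obtain ⟨u, hu, hu'⟩ := exists_lift_near hi
    refine ⟨i, ?_⟩
    have hum : (u : Torus) ∈ extSupport f lam y' := by rw [hu]; exact hmem j hj
    rcases lt_trichotomy u (s i) with hlt | heq | hlt
    · exact (hrolle i u (s i) hu' (hs' i) hlt hum (hsmem i)).elim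
    · rw [← hu, heq]
    · exact (hrolle i (s i) u (hs' i) hu' hlt (hsmem i) hum).elim
  refine ⟨(s, fun i => ∑ j, if t j = (s i : Torus) then b j else 0),
    fun i => (hs' i).trans_le (min_le_left _ _), ?_, hsmem⟩
  conv_lhs => rw [hy']
  congr 1
  simp only [Finset.sum_smul]
  rw [Finset.sum_comm]
  refine Finset.sum_congr rfl fun j _ => ?_
  by_cases hj : b j = 0
  · simp [hj]
  · obtain ⟨i, hi⟩ := hcover j hj
    rw [Finset.sum_eq_single i]
    · rw [if_pos hi, hi, psi]
    · intro k _ hk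
      rw [if_neg, zero_smul]
      exact fun hh => hk (hinj k i (hh.symm.trans hi))
    · simp

end ContactData

/-! ### The derivative and its trace -/

theorem toLp_Gam_mulVec (f : ℕ) {k : ℕ} (x : Fin k → Torus) (c : Fin k ⊕ Fin k → ℝ) :
    WithLp.toLp 2 (Gam f x *ᵥ c) = ∑ j, c (Sum.inl j) • phi f (x j)
      + ∑ j, c (Sum.inr j) • dOp f (phi f (x j)) := by
  ext i
  simp [Gam, PhiMat, PhiMat', Matrix.mulVec, dotProduct, mul_comm, torusDeriv_phi]

theorem transpose_Gam_mulVec_inl (f : ℕ) {k : ℕ} (x : Fin k → Torus) (q : Obs f) (j : Fin k) :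
    ((Gam f x)ᵀ *ᵥ q.ofLp) (Sum.inl j) = ⟪phi f (x j), q⟫_ℝ := by
  simp [Gam, PhiMat, Matrix.mulVec, dotProduct, mul_comm, PiLp.inner_apply]

theorem transpose_Gam_mulVec_inr (f : ℕ) {k : ℕ} (x : Fin k → Torus) (q : Obs f) (j : Fin k) :
    ((Gam f x)ᵀ *ᵥ q.ofLp) (Sum.inr j) = ⟪dOp f (phi f (x j)), q⟫_ℝ := by
  simp [Gam, PhiMat', Matrix.mulVec, dotProduct, mul_comm, PiLp.inner_apply, torusDeriv_phi]

theorem Qcoef_eq {f : ℕ} {lam : ℝ} (hlam : 0 < lam) (y : Obs f) {k : ℕ} (β : Fin k → ℝ)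
    (x : Fin k → Torus) (j : Fin k) :
    Qcoef f lam y β x j = -(⟪(dOp f ^ 2) (phi f (x j)), pHat f lam y⟫_ℝ / β j) := by
  rw [Qcoef, torusDeriv_eta]
  have := hlam.ne'
  field_simp

theorem fromBlocks_diagonal_mulVec {k : ℕ} (Q : Fin k → ℝ) (c : Fin k ⊕ Fin k → ℝ) :
    Matrix.fromBlocks 0 0 0 (Matrix.diagonal Q) *ᵥ c
      = Sum.elim (0 : Fin k → ℝ) fun j => Q j * c (Sum.inr j) := by
  rw [Matrix.fromBlocks_mulVec]
  ext i
  rcases i with i | i <;> simp [Matrix.mulVec_diagonal]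

theorem divergence_toEuclideanCLM {f : ℕ} {F : Obs f → Obs f} {y : Obs f}
    {T : Matrix (Idx f) (Idx f) ℝ} (h : HasFDerivAt F (Matrix.toEuclideanCLM (𝕜 := ℝ) T) y) :
    divergence F y = T.trace := by
  rw [divergence, h.fderiv, Matrix.trace]
  refine Finset.sum_congr rfl fun i _ => ?_
  rw [Matrix.ofLp_toEuclideanCLM, PiLp.ofLp_single, Matrix.mulVec_single_one]
  rfl

namespace ContactData

variable {f : ℕ} {lam : ℝ} {y : Obs f} {m : ℕ} {x : Fin m → Torus} {σ β : Fin m → ℝ}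

theorem Qcoef_pos (hlam : 0 < lam) (h : ContactData f lam y x σ β) (hβ : ∀ i, β i ≠ 0)
    (hnd : ∀ i, ⟪(dOp f ^ 2) (phi f (x i)), pHat f lam y⟫_ℝ ≠ 0) (i : Fin m) :
    0 < Qcoef f lam y β x i := by
  choose X hX using fun i => QuotientAddGroup.mk_surjective (x i)
  obtain rfl : (fun i => (X i : Torus)) = x := funext hX
  rw [Qcoef_eq hlam]
  exact lt_of_le_of_ne (h.curvature_nonneg hlam i)
    (neg_ne_zero.2 (div_ne_zero (hnd i) (hβ i))).symm

theorem posDef_Mmat (hlam : 0 < lam) (h : ContactData f lam y x σ β) (hβ : ∀ i, β i ≠ 0)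
    (hnd : ∀ i, ⟪(dOp f ^ 2) (phi f (x i)), pHat f lam y⟫_ℝ ≠ 0) :
    (Mmat f lam y β x).PosDef := by
  have hQ := h.Qcoef_pos hlam hβ hnd
  refine Matrix.posDef_iff_dotProduct_mulVec.2 ⟨?_, fun c hc => ?_⟩
  · rw [Mmat, Matrix.IsHermitian, Matrix.conjTranspose_eq_transpose_of_trivial,
      Matrix.transpose_add, Matrix.transpose_mul, Matrix.transpose_transpose,
      Matrix.fromBlocks_transpose]
    simp
  · have hexp : star c ⬝ᵥ (Mmat f lam y β x *ᵥ c)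
        = (Gam f x *ᵥ c) ⬝ᵥ (Gam f x *ᵥ c) + ∑ j, Qcoef f lam y β x j * c (Sum.inr j) ^ 2 := by
      rw [star_trivial, Mmat, Matrix.add_mulVec, dotProduct_add, fromBlocks_diagonal_mulVec,
        ← Matrix.mulVec_mulVec, Matrix.dotProduct_mulVec, Matrix.vecMul_transpose]
      congr 1
      simp only [dotProduct, Fintype.sum_sum_type, Sum.elim_inl, Sum.elim_inr, Pi.zero_apply,
        mul_zero, Finset.sum_const_zero, zero_add]
      exact Finset.sum_congr rfl fun j _ => by ring
    have h1 : 0 ≤ (Gam f x *ᵥ c) ⬝ᵥ (Gam f x *ᵥ c) :=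
      Finset.sum_nonneg fun i _ => mul_self_nonneg _
    have h2 : ∀ j ∈ Finset.univ, 0 ≤ Qcoef f lam y β x j * c (Sum.inr j) ^ 2 := fun j _ =>
      mul_nonneg (hQ j).le (sq_nonneg _)
    rw [hexp]
    refine lt_of_le_of_ne (add_nonneg h1 (Finset.sum_nonneg h2)) fun h0 => hc ?_
    obtain ⟨h3, h4⟩ := (add_eq_zero_iff_of_nonneg h1 (Finset.sum_nonneg h2)).1 h0.symm
    have h5 : ∀ j, c (Sum.inr j) = 0 := fun j => by
      have := (Finset.sum_eq_zero_iff_of_nonneg h2).1 h4 j (Finset.mem_univ j)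
      exact pow_eq_zero_iff two_ne_zero |>.1 ((mul_eq_zero.1 this).resolve_left (hQ j).ne')
    have h6 : ∑ j, c (Sum.inl j) • phi f (x j) = 0 := by
      have h7 := toLp_Gam_mulVec f x c
      rw [dotProduct_self_eq_zero.1 h3] at h7
      simpa [h5] using h7.symm
    have h8 := h.linearIndependent hlam _ h6
    ext i
    rcases i with i | i
    · exact congrFun h8 i
    · exact h5 i

/-- At a nondegenerate finite support the derivative of `μ̂` is `Γ M⁻¹ Γ*`. -/
theorem hasFDerivAt_muHat (hlam : 0 < lam) (h : ContactData f lam y x σ β) (hβ : ∀ i, β i ≠ 0)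
    (hnd : ∀ i, ⟪(dOp f ^ 2) (phi f (x i)), pHat f lam y⟫_ℝ ≠ 0) :
    HasFDerivAt (muHat f lam) (Matrix.toEuclideanCLM (𝕜 := ℝ)
      (Gam f x * (Mmat f lam y β x)⁻¹ * (Gam f x)ᵀ)) y := by
  have hdet := (Matrix.isUnit_iff_isUnit_det _).1 (h.posDef_Mmat hlam hβ hnd).isUnit
  choose X hX using fun i => QuotientAddGroup.mk_surjective (x i)
  obtain rfl : (fun i => (X i : Torus)) = x := funext hX
  set x : Fin m → Torus := fun i => (X i : Torus) with hx
  set G := Gam f x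
  set M := Mmat f lam y β x with hM
  set T := Matrix.toEuclideanCLM (𝕜 := ℝ) (G * M⁻¹ * Gᵀ) with hT
  set C : Obs f →L[ℝ] (Fin m ⊕ Fin m → ℝ) := LinearMap.toContinuousLinearMap
    (Matrix.toLin' (M⁻¹ * Gᵀ) ∘ₗ (WithLp.linearEquiv 2 ℝ (Idx f → ℝ)).toLinearMap) with hC
  have hCv : ∀ v, C v = (M⁻¹ * Gᵀ) *ᵥ v.ofLp := fun v => rfl
  have hTv : ∀ v, T v = WithLp.toLp 2 (G *ᵥ C v) := fun v => by
    rw [hCv, Matrix.mulVec_mulVec, ← Matrix.mul_assoc]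
    rfl
  -- the normal equations of the linearized problem
  have hnormal : ∀ v, Gᵀ *ᵥ (v - T v).ofLp
      = Sum.elim (0 : Fin m → ℝ) fun j => Qcoef f lam y β x j * C v (Sum.inr j) := by
    intro v
    have h1 : M *ᵥ C v = Gᵀ *ᵥ v.ofLp := by
      rw [hCv, Matrix.mulVec_mulVec, ← Matrix.mul_assoc, Matrix.mul_nonsing_inv _ hdet,
        Matrix.one_mul]
    rw [WithLp.ofLp_sub, Matrix.mulVec_sub, ← h1, hTv, Matrix.mulVec_mulVec, hM, Mmat,
      Matrix.add_mulVec, add_sub_cancel_left, fromBlocks_diagonal_mulVec]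
  obtain ⟨r₀, hr₀, hr₀', hsep⟩ := h.exists_separation
  obtain ⟨ξ, ζ, hd⟩ := h.exists_dualVectors hlam
  obtain ⟨sb, hsb⟩ := (h.eventually_exists_atoms hlam hβ hnd hr₀ hsep).choice
  have hF := h.contactFamily hlam hβ hr₀' hsep (Y := fun y' => y') tendsto_id
    (s := fun i y' => (sb y').1 i) (b := fun i y' => (sb y').2 i) hsb
  have hκ : ∀ i, (fun y' => C (y' - y) i) =O[𝓝 y] fun y' => y' - y := fun i =>
    ((ContinuousLinearMap.proj (R := ℝ) (φ := fun _ : Fin m ⊕ Fin m => ℝ) i).comp C).isBigO_comp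
      (fun y' => y' - y) (𝓝 y)
  have hmain : (fun y' => (pHat f lam y' - pHat f lam y) - ((y' - y) - T (y' - y)))
      =o[𝓝 y] fun y' => y' - y := by
    refine hF.sub_isLittleO_of_linearized hd (fun i => h.curvature_nonneg hlam i)
      (κ := fun i y' => C (y' - y) (Sum.inl i)) (γ := fun i y' => C (y' - y) (Sum.inr i))
      ((isBigO_refl _ _).sub (T.isBigO_comp _ _)) (fun i => hκ _) (fun i => hκ _) ?_ ?_ ?_
    · intro y'
      have h1 := toLp_Gam_mulVec f x (C (y' - y))
      rw [← hTv] at h1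
      exact (sub_add_cancel (y' - y) (T (y' - y))).symm.trans (congrArg _ h1)
    · intro i y'
      have h1 := congrFun (hnormal (y' - y)) (Sum.inl i)
      rw [transpose_Gam_mulVec_inl] at h1
      exact h1
    · intro i y'
      have h1 := congrFun (hnormal (y' - y)) (Sum.inr i)
      rw [transpose_Gam_mulVec_inr, Sum.elim_inr, Qcoef_eq hlam] at h1
      exact h1
  refine HasFDerivAt.of_isLittleO (hmain.neg_left.congr_left fun y' => ?_)
  rw [muHat_eq, muHat_eq]
  abel

/-- `μ̂` is differentiable at a nondegenerate finite support, and its divergence is the trace of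
`M⁻¹ Γ* Γ = 1 - M⁻¹ diag(0, Q)`. -/
theorem differentiableAt_muHat (hlam : 0 < lam) (h : ContactData f lam y x σ β)
    (hβ : ∀ i, β i ≠ 0)
    (hnd : ∀ i, ⟪(dOp f ^ 2) (phi f (x i)), pHat f lam y⟫_ℝ ≠ 0) :
    DifferentiableAt ℝ (muHat f lam) y ∧ IsUnit (Mmat f lam y β x) ∧ 0 ≤ nu f lam y β x ∧
      divergence (muHat f lam) y = 2 * (m : ℝ) - nu f lam y β x := by
  have hpos := h.posDef_Mmat hlam hβ hnd
  have hdet := (Matrix.isUnit_iff_isUnit_det _).1 hpos.isUnit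
  have hder := h.hasFDerivAt_muHat hlam hβ hnd
  have hnu : nu f lam y β x
      = ∑ j, Qcoef f lam y β x j * (Mmat f lam y β x)⁻¹ (Sum.inr j) (Sum.inr j) := by
    rw [nu, Finset.mul_sum]
    exact Finset.sum_congr rfl fun j _ => by rw [Qcoef]; ring
  refine ⟨hder.differentiableAt, hpos.isUnit, ?_, ?_⟩
  · rw [hnu]
    exact Finset.sum_nonneg fun j _ =>
      mul_nonneg (h.Qcoef_pos hlam hβ hnd j).le hpos.inv.diag_pos.le
  · rw [divergence_toEuclideanCLM hder, Matrix.mul_assoc, Matrix.trace_mul_comm, Matrix.mul_assoc,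
      hnu]
    set D : Matrix (Fin m ⊕ Fin m) (Fin m ⊕ Fin m) ℝ :=
      Matrix.fromBlocks 0 0 0 (Matrix.diagonal (Qcoef f lam y β x)) with hD
    have h1 : (Gam f x)ᵀ * Gam f x = Mmat f lam y β x - D := by rw [Mmat, hD, add_sub_cancel_right]
    have h2 : ((Mmat f lam y β x)⁻¹ * D).trace
        = ∑ j, Qcoef f lam y β x j * (Mmat f lam y β x)⁻¹ (Sum.inr j) (Sum.inr j) := by
      rw [Matrix.trace, Fintype.sum_sum_type]
      simp [hD, Matrix.mul_apply, Matrix.diagonal_apply, mul_comm]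
    rw [h1, Matrix.mul_sub, Matrix.nonsing_inv_mul _ hdet, Matrix.trace_sub, Matrix.trace_one, h2]
    simp
    ring

/-- Outside the exceptional set the amplitudes do not vanish and the contacts are
nondegenerate. -/
theorem regular_of_notMem_setH (hlam : 0 < lam) (h : ContactData f lam y x σ β)
    (hy : y ∉ setH f lam) : (∀ i, β i ≠ 0) ∧
      ∀ i, ⟪(dOp f ^ 2) (phi f (x i)), pHat f lam y⟫_ℝ ≠ 0 := by
  classical
  rcases Nat.eq_zero_or_pos m with rfl | hm
  · exact ⟨fun i => i.elim0, fun i => i.elim0⟩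
  set c : Fin m → ℝ := fun i => ⟪(dOp f ^ 2) (phi f (x i)), pHat f lam y⟫_ℝ with hc
  set l : Fin m → ℕ := fun i => if c i = 0 then 2 else 1 with hl
  have hmem : y ∈ projQ f lam m σ {i | β i = 0} l := by
    refine mem_projQ hlam (h.linearIndependent hlam) h.decomp h.saturated h.value fun i => ?_
    by_cases hi : c i = 0
    · exact Or.inr ⟨if_pos hi, hi⟩
    · exact Or.inl (if_neg hi)
  have hsum : ∑ i, l i ≤ 2 * f + 1 := by
    have h1 : ∑ i, l i ≤ ∑ i, (if c i = 0 then 3 else 1) :=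
      Finset.sum_le_sum fun i _ => by simp only [hl]; split_ifs <;> norm_num
    refine h1.trans ((h.sum_mult_le hlam _ fun i => ?_).trans (Nat.le_succ _))
    by_cases hi : c i = 0
    · exact Or.inr ⟨if_pos hi, hi⟩
    · exact Or.inl (if_neg hi)
  have hint : y ∈ interior (projQ f lam m σ {i | β i = 0} l) :=
    mem_interior_of_mem_of_notMem_frontier hmem fun hfr =>
      hy ⟨m, σ, _, l, hm, h.card_le hlam, fun i => (h.sign i).symm, hsum, hfr⟩
  have hβ := h.amplitude_ne_zero hlam hint
  refine ⟨hβ, ?_⟩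
  choose X hX using fun i => QuotientAddGroup.mk_surjective (x i)
  obtain rfl : (fun i => (X i : Torus)) = x := funext hX
  exact h.second_deriv_ne_zero hlam hβ (fun i hi => (if_pos hi).ge) hint

/-- Every solution with distinct atoms and nonzero amplitudes is an enumeration of the extended
support. -/
theorem of_isSolution (hlam : 0 < lam) (h : ContactData f lam y x σ β) (hβ : ∀ i, β i ≠ 0) {k : ℕ}
    {β' : Fin k → ℝ} {x' : Fin k → Torus} (hx' : Function.Injective x') (hβ' : ∀ j, β' j ≠ 0)
    (hm : IsSolution f lam y (discreteMeasure β' x')) :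
    ∃ σ', ContactData f lam y x' σ' β' := by
  classical
  have hatom : ∀ j, β' j * ⟪phi f (x' j), pHat f lam y⟫_ℝ = lam * |β' j| := fun j => by
    have h1 := singleton_mul_of_integralSM_eq (discreteMeasure β' x')
      (isProj_pHat f hlam y).1 (g := PhiAdj f (pHat f lam y)) (hm.integral_eq hlam) (x' j)
    rwa [discreteMeasure_singleton β' hx' j] at h1
  have hmem : ∀ j, x' j ∈ extSupport f lam y := fun j =>
    mem_extSupport_of_ne_zero hlam (hatom j) (hβ' j)
  have heq := h.eq_of_isSolution hlam hm
  have hval : ∀ j, ∃ s : ℝ, (s = 1 ∨ s = -1) ∧ ⟪phi f (x' j), pHat f lam y⟫_ℝ = lam * s := by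
    intro j
    rcases (abs_eq hlam.le).1 ((mem_extSupport_iff hlam).1 (hmem j)) with h1 | h1
    · exact ⟨1, Or.inl rfl, by rw [h1, mul_one]⟩
    · exact ⟨-1, Or.inr rfl, by rw [h1]; ring⟩
  choose σ' hσ1 hσ2 using hval
  refine ⟨σ', hx', ?_, ?_, hσ2, hσ1, fun j => ?_⟩
  · refine Set.Subset.antisymm (Set.range_subset_iff.2 hmem) ?_
    rw [← h.range_eq]
    rintro _ ⟨i, rfl⟩
    by_contra hno
    refine hβ i ?_
    rw [← discreteMeasure_singleton β h.injective i, ← heq,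
      discreteMeasure_apply β' x' (measurableSet_singleton _)]
    exact Finset.sum_eq_zero fun j _ => if_neg fun hj => hno ⟨j, hj⟩
  · have h1 := Phi_eq_muHat hlam hm
    rw [Phi_discreteMeasure, muHat_eq] at h1
    rw [h1, add_sub_cancel]
  · have h1 := hatom j
    rw [hσ2] at h1
    have h2 : lam * (β' j * σ' j) = lam * |β' j| := by rw [← h1]; ring
    exact mul_left_cancel₀ hlam.ne' h2

end ContactData

end BlassoFourier

open BlassoFourier

theorem mainTheorem2 (f : ℕ) (lam : ℝ) (hlam : 0 < lam) :
    -- the problem has solutions and all of them have the same image, so that `muHat` and `eta`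
    -- are the objects of the claim
    (∀ y : Obs f, (∃ m, IsSolution f lam y m) ∧
      ∀ m, IsSolution f lam y m → Phi f m = muHat f lam y) ∧
    ∀ y : Obs f, y ∉ setK f lam →
      (extSupport f lam y = ∅ →
        DifferentiableAt ℝ (muHat f lam) y ∧ divergence (muHat f lam) y = 0) ∧
      (extSupport f lam y = Set.univ →
        DifferentiableAt ℝ (muHat f lam) y ∧
          divergence (muHat f lam) y = 2 * (f : ℝ) + 1) ∧
      (IsDiscrete (extSupport f lam y) →
        DifferentiableAt ℝ (muHat f lam) y ∧
        -- there is a unique solution, and it is of the form `∑ j, β_j δ_{x_j}`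
        (∃ (k : ℕ) (β : Fin k → ℝ) (x : Fin k → Torus),
          Function.Injective x ∧ (∀ j, β j ≠ 0) ∧
          IsSolution f lam y (discreteMeasure β x) ∧
          ∀ m, IsSolution f lam y m → m = discreteMeasure β x) ∧
        ∀ (k : ℕ) (β : Fin k → ℝ) (x : Fin k → Torus),
          Function.Injective x → (∀ j, β j ≠ 0) →
          IsSolution f lam y (discreteMeasure β x) →
          IsUnit (Mmat f lam y β x) ∧
          0 ≤ nu f lam y β x ∧
          divergence (muHat f lam) y = 2 * (k : ℝ) - nu f lam y β x) := by
  refine ⟨fun y => ⟨exists_isSolution f hlam y, fun m hm => Phi_eq_muHat hlam hm⟩, fun y hy => ?_⟩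
  have hH : y ∉ setH f lam := fun hh => hy (Or.inl (Or.inl hh))
  refine ⟨differentiableAt_of_extSupport_eq_empty hlam, fun h =>
    differentiableAt_of_extSupport_eq_univ hlam (fun hh => hy (Or.inl (Or.inr hh)))
      (fun hh => hy (Or.inr hh)) h, fun hdisc => ?_⟩
  obtain ⟨m, x, σ, β, h⟩ := exists_contactData hlam (finite_extSupport hdisc)
  obtain ⟨hβ, hnd⟩ := h.regular_of_notMem_setH hlam hH
  refine ⟨(h.differentiableAt_muHat hlam hβ hnd).1, ⟨m, β, x, h.injective, hβ,
    isSolution_discreteMeasure hlam h.decomp h.saturated,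
    fun m' hm' => h.eq_of_isSolution hlam hm'⟩, fun k β' x' hx' hβ' hsol => ?_⟩
  obtain ⟨σ', h'⟩ := h.of_isSolution hlam hβ hx' hβ' hsol
  exact (h'.differentiableAt_muHat hlam hβ' (h'.regular_of_notMem_setH hlam hH).2).2
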